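/- **Corollary 2.4 (inversion formula).** Let $N\ge 0$ and let $B$ be a continuous closed 2-form (magnetic field) on $\mathbb R^N$, with components $B_{jk}=-B_{kj}$ (closedness $dB=0$ is meant in the sense of distributions). Let $\Xi=\mathbb R^N\times\mathbb R^N$ be phase space with points $X=(x,\xi)$, $Y=(y,\eta)$, $Z=(z,\zeta)$, with Lebesgue measure, and with the symplectic form $\sigma(X,Y)=y\cdot\xi-x\cdot\eta$. Write $\Gamma^B(\langle a,b,c\rangle)=\int_{\langle a,b,c\rangle}B$ for the flux of $B$ through the oriented triangle with vertices $a,b,c$, put $\langle f,g\rangle=\int_\Xi f(X)g(X)\,dX$ (bilinear pairing) and $\mathfrak e_X(Z)=e^{-i\sigma(X,Z)}$, and let $$(f\#^Bg)(X)=\pi^{-2N}\int_\Xi dY\int_\Xi dZ\,e^{-2i\sigma(X-Y,X-Z)}\,e^{-i\Gamma^B(\langle x-y+z,\,y-z+x,\,z-x+y\rangle)}f(Y)g(Z)$$ be the magnetic composition. The integral is oscillatory: $f,g$ are replaced by $e^{-\varepsilon|\cdot|^2}f$, $e^{-\varepsilon|\cdot|^2}g$, and the limit $\varepsilon\to0^+$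 is taken in $L^2(\Xi)$. Then the following hold. 1. For $f\in L^2(\Xi)$ and $X,Y\in\Xi$ the products $\mathfrak e_X\#^Bf$ and $f\#^B\mathfrak e_X$ exist in $L^2(\Xi)$, and $(\mathfrak e_X\#^Bf)\#^B\mathfrak e_Y=\mathfrak e_X\#^B(f\#^B\mathfrak e_Y)$. 2. For every $h\in L^2(\Xi)$, the magnetic modulation mapping $$[M^B_h(f)](X,Y)=\langle \mathfrak e_{-X}\#^Bf\#^B\mathfrak e_{X-Y},h\rangle$$ is a bounded linear operator $M^B_h:L^2(\Xi)\to L^2(\Xi\times\Xi)$. 3. For all $h,k\in L^2(\Xi)$, with $(\cdot)^*$ the Hilbert-space adjoint for Lebesgue measure on $\Xi$ and on $\Xi\times\Xi$, $$(M^B_k)^*M^B_h=(2\pi)^{2N}\,\langle h,\overline k\rangle\,\mathrm{id}_{L^2(\Xi)}.$$ 4. For all $h\in L^2(\Xi)$ and $G\in L^2(\Xi\times\Xi)$, $$(M^B_h)^*(G)=\int_\Xi\int_\Xi dX\,dY\,G(X,Y)\;\mathfrak e_X\#^B\overline h\,\#^B\mathfrak e_{Y-X},$$ the integral being taken in the weak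 sense (its scalar product with any $g\in L^2(\Xi)$ is an absolutely convergent integral). -/

import Mathlib

open MeasureTheory Filter Topology
open scoped ContDiff ComplexConjugate

noncomputable section

namespace MagneticWeyl

/-- The configuration space `ℝ^N`, with its Euclidean structure. -/
abbrev Config (N : ℕ) : Type := EuclideanSpace ℝ (Fin N)

/-- The phase space `Ξ = ℝ^N × (ℝ^N)^*`; the dual is identified with `ℝ^N` through the
pairing `x · ξ = ∑ j, x j * ξ j`.  Its `volume` is Lebesgue measure `dx dξ`. -/
abbrev Phase (N : ℕ) : Type := Config N × Config N

/-- The Hilbert space `L²(Ξ)` for Lebesgue measure. -/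
abbrev L2Phase (N : ℕ) : Type := Lp ℂ 2 (volume : Measure (Phase N))

/-- The Hilbert space `L²(Ξ × Ξ)` for Lebesgue measure. -/
abbrev L2Double (N : ℕ) : Type := Lp ℂ 2 (volume : Measure (Phase N × Phase N))

/-- A magnetic field: a continuous closed 2-form `B` on `ℝ^N`, given by its components
`B_{jk} = -B_{kj}`.  As the components are only continuous, `dB = 0`, that is
`∂_l B_{jk} + ∂_j B_{kl} + ∂_k B_{lj} = 0`, is meant in the sense of distributions. -/
structure MagneticField (N : ℕ) where
  comp : Fin N → Fin N → Config N → ℝ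
  continuous_comp : ∀ j k, Continuous (comp j k)
  antisymm : ∀ j k x, comp j k x = -comp k j x
  closed : ∀ φ : Config N → ℝ, ContDiff ℝ ∞ φ → HasCompactSupport φ → ∀ j k l : Fin N,
    ∫ x, (comp j k x * fderiv ℝ φ x (EuclideanSpace.single l 1)
        + comp k l x * fderiv ℝ φ x (EuclideanSpace.single j 1)
        + comp l j x * fderiv ℝ φ x (EuclideanSpace.single k 1)) = 0

variable {N : ℕ}

/-- The flux `Γ^B(<a,b,c>) = ∫_{<a,b,c>} B` through the oriented triangle of vertices
`a`, `b`, `c`, in the parametrization `(s,t) ↦ a + s (b - a) + t (c - a)`, `0 ≤ s, t`, `s + t ≤ 1`. -/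
def flux (B : MagneticField N) (a b c : Config N) : ℝ :=
  ∫ s in (0 : ℝ)..1, ∫ t in (0 : ℝ)..(1 - s),
    ∑ j, ∑ k, B.comp j k (a + s • (b - a) + t • (c - a)) * (b - a) j * (c - a) k

/-- The symplectic form `σ((x,ξ),(y,η)) = y·ξ - x·η`. -/
def sympl (X Y : Phase N) : ℝ := inner ℝ Y.1 X.2 - inner ℝ X.1 Y.2

/-- The integral that defines the magnetic composition law,
`π^{-2N} ∫ dY ∫ dZ exp(-2iσ(X-Y,X-Z)) exp(-iΓ^B(<x-y+z,y-z+x,z-x+y>)) f(Y) g(Z)`.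
It converges absolutely when `f` and `g` are integrable. -/
def compositionIntegral (B : MagneticField N) (f g : Phase N → ℂ) (X : Phase N) : ℂ :=
  ((Real.pi ^ (2 * N))⁻¹ : ℝ) * ∫ Y : Phase N, ∫ Z : Phase N,
    Complex.exp (-(2 * Complex.I * (sympl (X - Y) (X - Z) : ℝ))) *
      Complex.exp (-(Complex.I *
        (flux B (X.1 - Y.1 + Z.1) (Y.1 - Z.1 + X.1) (Z.1 - X.1 + Y.1) : ℝ))) * f Y * g Z

/-- The function `f` multiplied by the Gaussian cut-off `exp(-ε(|x|² + |ξ|²))`. For `ε > 0` it is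
integrable whenever `f` is square integrable, or bounded and measurable. -/
def damp (ε : ℝ) (f : Phase N → ℂ) (X : Phase N) : ℂ :=
  (Real.exp (-(ε * (‖X.1‖ ^ 2 + ‖X.2‖ ^ 2))) : ℝ) * f X

/-- `p ∈ L²(Ξ)` is the magnetic product `f #^B g`. The composition integral is read as an
oscillatory integral: the Gaussian cut-offs of the two factors are removed in the limit `ε → 0+`,
which is taken in `L²(Ξ)`.
For `f` and `g` in `L²(Ξ)` this is the extension of the absolutely convergent integral by
`L²`-continuity; it also makes sense when one factor is an exponential `e_X`. -/
def IsMagneticProduct (B : MagneticField N) (f g : Phase N → ℂ) (p : L2Phase N) : Prop :=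
  Tendsto (fun ε : ℝ =>
      eLpNorm (fun X => compositionIntegral B (damp ε f) (damp ε g) X - p X) 2 volume)
    (𝓝[>] 0) (𝓝 0)

open Classical in
/-- The magnetic product `f #^B g` as an element of `L²(Ξ)` (and `0` if it does not exist). -/
def magneticProduct (B : MagneticField N) (f g : Phase N → ℂ) : L2Phase N :=
  if h : ∃ p, IsMagneticProduct B f g p then h.choose else 0

/-- The exponential `e_X(Z) = exp(-iσ(X,Z))`. -/
def expSymbol (X Z : Phase N) : ℂ := Complex.exp (-(Complex.I * (sympl X Z : ℝ)))

/-- The triple product `e_X #^B f #^B e_Y`, bracketed as `(e_X #^B f) #^B e_Y`. -/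
def sandwich (B : MagneticField N) (X : Phase N) (f : Phase N → ℂ) (Y : Phase N) : L2Phase N :=
  magneticProduct B (magneticProduct B (expSymbol X) f) (expSymbol Y)

/-- The bilinear pairing `⟨f, g⟩ = ∫_Ξ f(X) g(X) dX` (no complex conjugation). -/
def pairing (f g : Phase N → ℂ) : ℂ := ∫ X, f X * g X

/-- The magnetic modulation mapping:
`[M^B_h(f)](X,Y) = ⟨e_{-X} #^B f #^B e_{X-Y}, h⟩`. -/
def modulation (B : MagneticField N) (h f : Phase N → ℂ) (W : Phase N × Phase N) : ℂ :=
  pairing (sandwich B (-W.1) f (W.1 - W.2)) h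

end MagneticWeyl

end

open MagneticWeyl

/-! The Fourier transform in the momentum variable turns a symbol into an integral kernel K(a,b):
the value of `weylTransform N f` at (q,w) belongs to the points a = q - πw and b = q + πw. In this
picture the magnetic composition is formally the composition of kernels twisted by
exp(-iΓ^B(<a,c,b>)), and e_X is a delta kernel on b = a + x. So e_X #^B f should have the kernel
exp(-i(Γ^B(<a,a+x,b>) + (a + x/2)·ξ)) K(a+x,b): a phase times a translation, hence a unitary of L².
The same holds on the right, with b moved to b - y. These unitaries are `leftProduct` and
`rightProduct`.

That they are the oscillatory products is an approximation argument. With Gaussian cut-offs the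
delta kernel becomes a Gaussian of width √ε, and the damped product is an average of phase shifts
against a fixed probability measure (`dampedKernel`). It converges in L² by continuity of
translations and dominated convergence (`isMagneticProduct_leftProduct`). The right product follows
by complex conjugation, which reverses the order of the factors.

The two bracketings of e_X #^B f #^B e_Y differ by the flux through the boundary of the tetrahedron
a, a+x, b-y, b. It vanishes because B is closed (`flux_cocycle`). For a field that is merely
continuous this is Stokes' theorem for mollified fields, passed to the limit (`flux_eq_add`).

For the inversion formula let ψ and φ be the transforms of the conjugate of h and of f. After a
linear change of variables, M_h(f) is a unimodular factor times the partial Fourier transform of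
(t,p) ↦ exp(-i·flux) conj(ψ(p)) φ(p+t) (`modulation_eq_sliceFourier`). Plancherel removes the
transform, the flux phases cancel, and the remaining integral factors into two scalar products. The
Jacobian gives (2π)^{2N}. The adjoint formula uses that the adjoint of multiplication by e_X is
multiplication by e_{-X}. -/

noncomputable section

namespace MagneticWeyl

set_option linter.unusedSectionVars false
set_option maxSynthPendingDepth 3

/-! ### The unitary partial Fourier transform. -/

section PartialFourier

open FourierTransform SchwartzMap
open scoped ENNReal

section SliceFourier

variable {V : Type*} [NormedAddCommGroup V] [InnerProductSpace ℝ V] [FiniteDimensional ℝ V]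
  [MeasurableSpace V] [BorelSpace V]

theorem continuous_fourier_of_integrable {g : V → ℂ} (hg : Integrable g) : Continuous (𝓕 g) :=
  VectorFourier.fourierIntegral_continuous Real.continuous_fourierChar
    (by exact continuous_inner) hg

theorem integral_fourier_mul_eq {f g : V → ℂ} (hf : Integrable f) (hg : Integrable g) :
    ∫ v, 𝓕 f v * g v = ∫ v, f v * 𝓕 g v := by
  simpa using! (VectorFourier.integral_fourierIntegral_smul_eq_flip (L := innerₗ V)
    Real.continuous_fourierChar continuous_inner hf hg)

/-- Against a test function both transforms can be moved onto the test function, the L² one through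
tempered distributions and the integral one through `integral_fourier_mul_eq`. Both pairings become
the same integral. -/
theorem fourier_toLp_coeFn {g : V → ℂ} (h1 : Integrable g) (h2 : MemLp g 2 volume) :
    ((𝓕 (h2.toLp g) : Lp ℂ 2 (volume : Measure V)) : V → ℂ) =ᵐ[volume] 𝓕 g := by
  refine ae_eq_of_integral_contDiff_smul_eq
    ((Lp.memLp (𝓕 (h2.toLp g) : Lp ℂ 2 (volume : Measure V))).locallyIntegrable (by norm_num))
    (continuous_fourier_of_integrable h1).locallyIntegrable fun ψ hψ hψ' => ?_
  have hc : HasCompactSupport (fun v => (ψ v : ℂ)) := hψ'.comp_left (g := fun r : ℝ => (r : ℂ)) rfl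
  have hs : ContDiff ℝ ∞ (fun v => (ψ v : ℂ)) := Complex.ofRealCLM.contDiff.comp hψ
  let Ψ : 𝓢(V, ℂ) := hc.toSchwartzMap hs
  have hΨ : ∀ v, Ψ v = (ψ v : ℂ) := fun v => rfl
  have key := congrArg (fun T => T Ψ) (Lp.fourier_toTemperedDistribution_eq (h2.toLp g))
  simp only [TemperedDistribution.fourier_apply] at key
  rw [Lp.toTemperedDistribution_apply, Lp.toTemperedDistribution_apply] at key
  have e1 : ∫ v, ψ v • (𝓕 (h2.toLp g) : Lp ℂ 2 (volume : Measure V)) v =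
      ∫ v, Ψ v • (𝓕 (h2.toLp g) : Lp ℂ 2 (volume : Measure V)) v := by
    simp [hΨ]
  rw [e1, ← key]
  have e2 : ∫ v, ψ v • 𝓕 g v = ∫ v, 𝓕 (⇑Ψ) v * g v := by
    rw [integral_fourier_mul_eq Ψ.integrable h1]
    simp [hΨ]
  rw [e2]
  refine integral_congr_ae ?_
  filter_upwards [h2.coeFn_toLp] with v hv
  rw [hv, SchwartzMap.fourier_coe, smul_eq_mul]

theorem eLpNorm_fourier_eq {g : V → ℂ} (h1 : Integrable g) (h2 : MemLp g 2 volume) :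
    eLpNorm (𝓕 g) 2 volume = eLpNorm g 2 volume := by
  rw [← eLpNorm_congr_ae (fourier_toLp_coeFn h1 h2), ← eLpNorm_congr_ae h2.coeFn_toLp,
    ← Lp.enorm_def, ← Lp.enorm_def, ← ofReal_norm, ← ofReal_norm,  Lp.norm_fourier_eq]

theorem eLpNorm_two_sq {α : Type*} [MeasurableSpace α] {ν : Measure α} (f : α → ℂ) :
    eLpNorm f 2 ν ^ 2 = ∫⁻ x, ‖f x‖ₑ ^ 2 ∂ν := by
  have := eLpNorm_nnreal_pow_eq_lintegral (f := f) (μ := ν) (p := 2) (by norm_num)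
  simpa using this

variable {Z : Type*} [MeasurableSpace Z] {μ : Measure Z} [SFinite μ]

/-- The Fourier transform in the second variable. -/
def sliceFourier (φ : Z × V → ℂ) (p : Z × V) : ℂ := 𝓕 (fun v => φ (p.1, v)) p.2

/-- The inverse Fourier transform in the second variable. -/
def sliceFourierInv (φ : Z × V → ℂ) (p : Z × V) : ℂ := 𝓕⁻ (fun v => φ (p.1, v)) p.2

theorem sliceFourierInv_eq (φ : Z × V → ℂ) (p : Z × V) :
    sliceFourierInv φ p = sliceFourier φ (p.1, -p.2) := by
  simp only [sliceFourierInv, sliceFourier, Real.fourierInv_eq_fourier_neg]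

/-- Conjugation flips the sign in the exponent. The estimates for the inverse transform are deduced
from the direct ones in this way. -/
theorem sliceFourierInv_eq_conj (φ : Z × V → ℂ) (p : Z × V) :
    sliceFourierInv φ p = conj (sliceFourier (fun q => conj (φ q)) p) := by
  simp only [sliceFourierInv, sliceFourier, Real.fourierInv_eq', Real.fourier_eq']
  rw [← integral_conj]
  congr 1 with v
  simp [← Complex.exp_conj, Complex.conj_ofNat]

theorem sliceFourier_congr_ae {φ ψ : Z × V → ℂ} (h : φ =ᵐ[μ.prod volume] ψ) :
    ∀ᵐ z ∂μ, ∀ w, sliceFourier φ (z, w) = sliceFourier ψ (z, w) := by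
  filter_upwards [Measure.ae_ae_of_ae_prod h] with z hz w
  simp only [sliceFourier, Real.fourier_eq]
  refine integral_congr_ae ?_
  filter_upwards [hz] with v hv
  simp only [hv]

theorem ae_prod_of_ae_left {p : Z × V → Prop} (h : ∀ᵐ z ∂μ, ∀ w, p (z, w)) :
    ∀ᵐ q ∂(μ.prod (volume : Measure V)), p q := by
  have := Measure.quasiMeasurePreserving_fst (μ := μ) (ν := (volume : Measure V)) |>.ae h
  filter_upwards [this] with q hq using hq q.2

theorem aestronglyMeasurable_sliceFourier {φ : Z × V → ℂ}
    (h : AEStronglyMeasurable φ (μ.prod volume)) :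
    AEStronglyMeasurable (sliceFourier φ) (μ.prod volume) := by
  have e := ae_prod_of_ae_left (p := fun q => sliceFourier φ q = sliceFourier (h.mk φ) q)
    (sliceFourier_congr_ae h.ae_eq_mk)
  refine AEStronglyMeasurable.congr ?_ (EventuallyEq.symm e)
  refine StronglyMeasurable.aestronglyMeasurable ?_
  have hm : StronglyMeasurable fun x : (Z × V) × V =>
      Complex.exp (↑(-2 * Real.pi * inner ℝ x.2 x.1.2) * Complex.I) • h.mk φ (x.1.1, x.2) := by
    have h1 : Measurable fun x : (Z × V) × V =>
      Complex.exp (↑(-2 * Real.pi * inner ℝ x.2 x.1.2) * Complex.I) := by fun_prop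
    exact h1.stronglyMeasurable.smul (h.stronglyMeasurable_mk.comp_measurable (by fun_prop))
  have := hm.integral_prod_right' (ν := (volume : Measure V))
  convert this using 2 with p
  simp [sliceFourier, Real.fourier_eq']

variable (μ) in
/-- Almost all slices are integrable. -/
def SliceIntegrable (φ : Z × V → ℂ) : Prop := ∀ᵐ z ∂μ, Integrable fun v => φ (z, v)

theorem SliceIntegrable.ae {φ : Z × V → ℂ} (h : SliceIntegrable μ φ) :
    ∀ᵐ z ∂μ, Integrable fun v => φ (z, v) := h

theorem SliceIntegrable.conj {φ : Z × V → ℂ} (h : SliceIntegrable μ φ) :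
    SliceIntegrable μ fun p => conj (φ p) := by
  refine h.ae.mono fun z hz => ?_
  exact (Complex.conjCLE.integrable_comp_iff).2 hz

/-- Tonelli, with Plancherel on almost every slice. Almost every slice is square integrable because
the total integral is finite. -/
theorem eLpNorm_sliceFourier {φ : Z × V → ℂ} (h : MemLp φ 2 (μ.prod volume))
    (hs : SliceIntegrable μ φ) :
    eLpNorm (sliceFourier φ) 2 (μ.prod volume) = eLpNorm φ 2 (μ.prod volume) := by
  have hm1 : AEMeasurable (fun p => ‖φ p‖ₑ ^ 2) (μ.prod volume) := h.1.enorm.pow_const 2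
  have hm2 : AEMeasurable (fun p => ‖sliceFourier φ p‖ₑ ^ 2) (μ.prod volume) :=
    (aestronglyMeasurable_sliceFourier h.1).enorm.pow_const 2
  have hsq : eLpNorm (sliceFourier φ) 2 (μ.prod volume) ^ 2 =
      eLpNorm φ 2 (μ.prod volume) ^ 2 := by
    have hfin : ∀ᵐ z ∂μ, ∫⁻ v, ‖φ (z, v)‖ₑ ^ 2 < ⊤ := by
      refine ae_lt_top' hm1.lintegral_prod_right' ?_
      rw [← lintegral_prod _ hm1, ← eLpNorm_two_sq]
      exact (ENNReal.pow_lt_top h.2).ne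
    rw [eLpNorm_two_sq, eLpNorm_two_sq, lintegral_prod _ hm1, lintegral_prod _ hm2]
    refine lintegral_congr_ae ?_
    filter_upwards [hs.ae, hfin, h.1.prodMk_left] with z hz hz' hm
    have hz2 : MemLp (fun v => φ (z, v)) 2 volume := by
      refine ⟨hm, ?_⟩
      rw [← eLpNorm_two_sq (fun v => φ (z, v))] at hz'
      by_contra hcon
      simp [not_lt_top_iff.1 hcon] at hz'
    have := congrArg (fun t => t ^ 2) (eLpNorm_fourier_eq hz hz2)
    simp only [eLpNorm_two_sq] at this
    exact this
  exact (ENNReal.pow_right_strictMono two_ne_zero).injective hsq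

theorem memLp_sliceFourier {φ : Z × V → ℂ} (h : MemLp φ 2 (μ.prod volume))
    (hs : SliceIntegrable μ φ) :
    MemLp (sliceFourier φ) 2 (μ.prod volume) :=
  ⟨aestronglyMeasurable_sliceFourier h.1, by rw [eLpNorm_sliceFourier h hs]; exact h.2⟩

theorem ae_integrable_slice_congr {φ ψ : Z × V → ℂ} (h : φ =ᵐ[μ.prod volume] ψ)
    (hs : SliceIntegrable μ φ) : SliceIntegrable μ ψ := by
  filter_upwards [Measure.ae_ae_of_ae_prod h, hs.ae] with z hz hi
  exact hi.congr hz

variable (V μ) in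
/-- The square integrable functions whose slices are integrable. -/
def sliceDomain : Submodule ℂ (Lp ℂ 2 (μ.prod (volume : Measure V))) where
  carrier := {Φ | SliceIntegrable μ Φ}
  add_mem' := by
    intro Φ Ψ hΦ hΨ
    refine ae_integrable_slice_congr (EventuallyEq.symm (Lp.coeFn_add Φ Ψ)) ?_
    filter_upwards [hΦ.ae, hΨ.ae] with z h1 h2 using h1.add h2
  zero_mem' := by
    refine ae_integrable_slice_congr (EventuallyEq.symm (Lp.coeFn_zero ..)) ?_
    exact Eventually.of_forall fun z => integrable_zero _ _ _
  smul_mem' := by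
    intro c Φ hΦ
    refine ae_integrable_slice_congr (EventuallyEq.symm (Lp.coeFn_smul c Φ)) ?_
    filter_upwards [hΦ.ae] with z h1 using h1.smul c

theorem mem_sliceDomain {Φ : Lp ℂ 2 (μ.prod (volume : Measure V))} :
    Φ ∈ sliceDomain V μ ↔ SliceIntegrable μ Φ := Iff.rfl

theorem toLp_mem_sliceDomain {φ : Z × V → ℂ} (h : MemLp φ 2 (μ.prod volume))
    (hs : SliceIntegrable μ φ) : h.toLp φ ∈ sliceDomain V μ :=
  ae_integrable_slice_congr (EventuallyEq.symm h.coeFn_toLp) hs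

/-- Indicators of sets of finite measure are integrable on the product, so by Fubini almost all
their slices are integrable; such indicators span a dense subspace. -/
theorem sliceDomain_topologicalClosure : (sliceDomain V μ).topologicalClosure = ⊤ := by
  refine (Submodule.eq_top_iff').2 fun Φ => ?_
  refine Lp.induction (p := 2) (by norm_num)
    (fun Φ : Lp ℂ 2 (μ.prod (volume : Measure V)) => Φ ∈ (sliceDomain V μ).topologicalClosure)
    ?_ ?_ ?_ Φ
  · intro c s hs hμs
    refine Submodule.le_topologicalClosure _ ?_
    have hi : Integrable (s.indicator fun _ => c) (μ.prod (volume : Measure V)) :=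
      (integrable_indicator_iff hs).2 (integrableOn_const hμs.ne)
    have : SliceIntegrable μ (s.indicator fun _ => c) := hi.prod_right_ae
    refine ae_integrable_slice_congr (EventuallyEq.symm ?_) this
    rw [Lp.simpleFunc.coe_indicatorConst]
    exact indicatorConstLp_coeFn
  · intro f g hf hg _ h1 h2
    exact Submodule.add_mem _ h1 h2
  · exact Submodule.isClosed_topologicalClosure _

theorem denseRange_sliceDomain : DenseRange (sliceDomain V μ).subtype := by
  have := Submodule.dense_iff_topologicalClosure_eq_top.2
    (sliceDomain_topologicalClosure (V := V) (μ := μ))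
  simpa [DenseRange] using this

theorem sliceFourier_add {φ ψ : Z × V → ℂ} {z : Z} (h1 : Integrable fun v => φ (z, v))
    (h2 : Integrable fun v => ψ (z, v)) (w : V) :
    sliceFourier (φ + ψ) (z, w) = sliceFourier φ (z, w) + sliceFourier ψ (z, w) := by
  simp only [sliceFourier, Real.fourier_eq, Pi.add_apply, smul_add]
  exact integral_add ((Real.fourierIntegral_convergent_iff w).2 h1)
    ((Real.fourierIntegral_convergent_iff w).2 h2)

theorem sliceFourier_smul (c : ℂ) (φ : Z × V → ℂ) (p : Z × V) :
    sliceFourier (c • φ) p = c * sliceFourier φ p := by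
  simp only [sliceFourier, Real.fourier_eq, Pi.smul_apply, ← smul_eq_mul (a := c)]
  rw [← integral_smul]
  congr 1 with v
  rw [smul_comm]

variable (V μ) in
/-- The partial Fourier transform on functions with integrable slices. -/
def partialFourierDomain : sliceDomain V μ →ₗ[ℂ] Lp ℂ 2 (μ.prod (volume : Measure V)) where
  toFun Φ := (memLp_sliceFourier (Lp.memLp Φ.1) (mem_sliceDomain.1 Φ.2)).toLp _
  map_add' Φ Ψ := by
    rw [← MemLp.toLp_add]
    refine MemLp.toLp_congr _ _ ?_
    refine ae_prod_of_ae_left ?_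
    filter_upwards [(mem_sliceDomain.1 Φ.2).ae, (mem_sliceDomain.1 Ψ.2).ae, sliceFourier_congr_ae (Lp.coeFn_add Φ.1 Ψ.1)] with z h1 h2 h w
    simpa using (h w).trans (sliceFourier_add h1 h2 w)
  map_smul' c Φ := by
    rw [RingHom.id_apply, ← MemLp.toLp_const_smul]
    refine MemLp.toLp_congr _ _ ?_
    refine ae_prod_of_ae_left ?_
    filter_upwards [sliceFourier_congr_ae (Lp.coeFn_smul c Φ.1)] with z h w
    simpa using (h w).trans (sliceFourier_smul c _ _)

theorem norm_partialFourierDomain (Φ : sliceDomain V μ) :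
    ‖partialFourierDomain V μ Φ‖ = ‖Φ.1‖ := by
  simp only [partialFourierDomain, LinearMap.coe_mk, AddHom.coe_mk]
  rw [Lp.norm_toLp, Lp.norm_def, eLpNorm_sliceFourier (Lp.memLp Φ.1) (mem_sliceDomain.1 Φ.2)]

variable (V μ) in
/-- The extension of the partial Fourier transform to square integrable functions. -/
def partialFourierCLM :
    Lp ℂ 2 (μ.prod (volume : Measure V)) →L[ℂ] Lp ℂ 2 (μ.prod (volume : Measure V)) :=
  (partialFourierDomain V μ).extendOfNorm (sliceDomain V μ).subtype

theorem partialFourierCLM_apply (Φ : sliceDomain V μ) :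
    partialFourierCLM V μ Φ.1 = partialFourierDomain V μ Φ :=
  -- The extension agrees with the original map once the domain is dense and the map bounded; the
  -- isometry property gives the bound 1.
  LinearMap.extendOfNorm_eq denseRange_sliceDomain
    ⟨1, fun x => by rw [one_mul]; exact (norm_partialFourierDomain x).le⟩ Φ

theorem norm_partialFourierCLM (Φ : Lp ℂ 2 (μ.prod (volume : Measure V))) :
    ‖partialFourierCLM V μ Φ‖ = ‖Φ‖ := by
  refine denseRange_sliceDomain.induction_on
    (p := fun Φ => ‖partialFourierCLM V μ Φ‖ = ‖Φ‖) Φ ?_ ?_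
  · exact isClosed_eq (by fun_prop) (by fun_prop)
  · intro Ψ
    exact (congrArg norm (partialFourierCLM_apply Ψ)).trans (norm_partialFourierDomain Ψ)

theorem memLp_conj {α : Type*} [MeasurableSpace α] {ν : Measure α} {f : α → ℂ}
    {r : ℝ≥0∞} (h : MemLp f r ν) : MemLp (fun x => conj (f x)) r ν := h.star

theorem memLp_sliceFourierInv {φ : Z × V → ℂ} (h : MemLp φ 2 (μ.prod volume))
    (hs : SliceIntegrable μ φ) :
    MemLp (sliceFourierInv φ) 2 (μ.prod volume) := by
  have : sliceFourierInv φ = fun p => conj (sliceFourier (fun q => conj (φ q)) p) := by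
    ext p; exact sliceFourierInv_eq_conj φ p
  rw [this]
  refine memLp_conj (memLp_sliceFourier (memLp_conj h) hs.conj)

theorem eLpNorm_sliceFourierInv {φ : Z × V → ℂ} (h : MemLp φ 2 (μ.prod volume))
    (hs : SliceIntegrable μ φ) :
    eLpNorm (sliceFourierInv φ) 2 (μ.prod volume) = eLpNorm φ 2 (μ.prod volume) := by
  have : sliceFourierInv φ = fun p => conj (sliceFourier (fun q => conj (φ q)) p) := by
    ext p; exact sliceFourierInv_eq_conj φ p
  have hc : ∀ f : Z × V → ℂ, eLpNorm (fun p => conj (f p)) 2 (μ.prod volume) =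
      eLpNorm f 2 (μ.prod volume) := fun f => eLpNorm_congr_norm_ae (by simp)
  rw [this, hc, eLpNorm_sliceFourier (memLp_conj h) hs.conj, hc]

theorem integral_conj_fourier_mul {f g : V → ℂ} (hf : Integrable f) (hg : Integrable g) :
    ∫ v, conj (𝓕 f v) * g v = ∫ v, conj (f v) * 𝓕⁻ g v := by
  have hg' : Integrable fun v => conj (g v) := (Complex.conjCLE.integrable_comp_iff).2 hg
  have := congrArg (fun t : ℂ => conj t) (integral_fourier_mul_eq hf hg')
  simp only [← integral_conj, map_mul, Complex.conj_conj] at this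
  rw [this]
  congr 1 with v
  congr 1
  exact (sliceFourierInv_eq_conj (fun p : Unit × V => g p.2) ((), v)).symm

/-- It suffices to pair with the dense domain, where Fubini reduces the claim to
`integral_conj_fourier_mul` on slices. -/
theorem adjoint_partialFourierCLM_apply {φ : Z × V → ℂ} (h : MemLp φ 2 (μ.prod volume))
    (hs : SliceIntegrable μ φ) :
    ContinuousLinearMap.adjoint (partialFourierCLM V μ) (h.toLp φ) =
      (memLp_sliceFourierInv h hs).toLp (sliceFourierInv φ) := by
  refine (denseRange_sliceDomain (V := V) (μ := μ)).eq_of_inner_right ℂ ?_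
  intro Ψ
  rw [ContinuousLinearMap.adjoint_inner_right, Submodule.subtype_apply, partialFourierCLM_apply,
    L2.inner_def, L2.inner_def]
  simp only [RCLike.inner_apply']
  have hF := memLp_sliceFourier (Lp.memLp Ψ.1) (mem_sliceDomain.1 Ψ.2)
  have hFi := memLp_sliceFourierInv h hs
  have e1 : ∫ p, conj ((partialFourierDomain V μ Ψ : Lp ℂ 2 (μ.prod volume)) p) * (h.toLp φ) p
        ∂(μ.prod volume)
      = ∫ p, conj (sliceFourier Ψ.1 p) * φ p ∂(μ.prod volume) := by
    refine integral_congr_ae ?_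
    filter_upwards [hF.coeFn_toLp, h.coeFn_toLp] with p h1 h2
    rw [h2]
    congr 2
  have e2 : ∫ p, conj (Ψ.1 p) * (hFi.toLp (sliceFourierInv φ)) p ∂(μ.prod volume)
      = ∫ p, conj (Ψ.1 p) * sliceFourierInv φ p ∂(μ.prod volume) := by
    refine integral_congr_ae ?_
    filter_upwards [hFi.coeFn_toLp] with p h1
    rw [h1]
  rw [e1, e2, integral_prod, integral_prod]
  · refine integral_congr_ae ?_
    filter_upwards [hs.ae, (mem_sliceDomain.1 Ψ.2).ae] with z h1 h2
    exact integral_conj_fourier_mul h2 h1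
  · exact (memLp_conj (Lp.memLp Ψ.1)).integrable_mul hFi
  · exact (memLp_conj hF).integrable_mul h

theorem norm_adjoint_partialFourierCLM (Φ : Lp ℂ 2 (μ.prod (volume : Measure V))) :
    ‖ContinuousLinearMap.adjoint (partialFourierCLM V μ) Φ‖ = ‖Φ‖ := by
  refine denseRange_sliceDomain.induction_on
    (p := fun Φ => ‖ContinuousLinearMap.adjoint (partialFourierCLM V μ) Φ‖ = ‖Φ‖) Φ ?_ ?_
  · exact isClosed_eq (by fun_prop) (by fun_prop)
  · intro Ψ
    have h := adjoint_partialFourierCLM_apply (Lp.memLp Ψ.1) Ψ.2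
    rw [Lp.toLp_coeFn] at h
    rw [Submodule.subtype_apply, h, Lp.norm_toLp, Lp.norm_def,
      eLpNorm_sliceFourierInv (Lp.memLp Ψ.1) Ψ.2]

variable (V μ) in
/-- The partial Fourier transform as a unitary operator. -/
def partialFourier :
    Lp ℂ 2 (μ.prod (volume : Measure V)) ≃ₗᵢ[ℂ] Lp ℂ 2 (μ.prod (volume : Measure V)) where
  -- The operator and its adjoint are both isometries, so their products in either order are the
  -- identity.
  toLinearEquiv := LinearEquiv.ofLinearMap (partialFourierCLM V μ).toLinearMap
    (ContinuousLinearMap.adjoint (partialFourierCLM V μ)).toLinearMap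
    (by
      have := (ContinuousLinearMap.norm_map_iff_adjoint_comp_self
        (ContinuousLinearMap.adjoint (partialFourierCLM V μ))).1 norm_adjoint_partialFourierCLM
      rw [ContinuousLinearMap.adjoint_adjoint] at this
      ext1 Φ
      exact congrArg (fun T => T Φ) this)
    (by
      have := (ContinuousLinearMap.norm_map_iff_adjoint_comp_self
        (partialFourierCLM V μ)).1 norm_partialFourierCLM
      ext1 Φ
      exact congrArg (fun T => T Φ) this)
  norm_map' := norm_partialFourierCLM

theorem partialFourier_toLp {φ : Z × V → ℂ} (h : MemLp φ 2 (μ.prod volume))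
    (hs : SliceIntegrable μ φ) :
    partialFourier V μ (h.toLp φ) = (memLp_sliceFourier h hs).toLp (sliceFourier φ) := by
  refine (partialFourierCLM_apply ⟨h.toLp φ, toLp_mem_sliceDomain h hs⟩).trans ?_
  exact MemLp.toLp_congr (memLp_sliceFourier (Lp.memLp _) (toLp_mem_sliceDomain h hs))
    (memLp_sliceFourier h hs) (ae_prod_of_ae_left (sliceFourier_congr_ae h.coeFn_toLp))

theorem partialFourier_symm_toLp {φ : Z × V → ℂ} (h : MemLp φ 2 (μ.prod volume))
    (hs : SliceIntegrable μ φ) :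
    (partialFourier V μ).symm (h.toLp φ) = (memLp_sliceFourierInv h hs).toLp (sliceFourierInv φ) :=
  adjoint_partialFourierCLM_apply h hs

theorem inner_sliceFourier {φ ψ : Z × V → ℂ} (h : MemLp φ 2 (μ.prod volume))
    (hs : SliceIntegrable μ φ) (h' : MemLp ψ 2 (μ.prod volume))
    (hs' : SliceIntegrable μ ψ) :
    ∫ p, conj (sliceFourier φ p) * sliceFourier ψ p ∂(μ.prod volume) =
      ∫ p, conj (φ p) * ψ p ∂(μ.prod volume) := by
  have key := (partialFourier V μ).inner_map_map (h.toLp φ) (h'.toLp ψ)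
  rw [partialFourier_toLp h hs, partialFourier_toLp h' hs', L2.inner_def, L2.inner_def] at key
  simp only [RCLike.inner_apply'] at key
  refine (integral_congr_ae ?_).trans (key.trans (integral_congr_ae ?_))
  · filter_upwards [(memLp_sliceFourier h hs).coeFn_toLp,
      (memLp_sliceFourier h' hs').coeFn_toLp] with p h1 h2
    rw [h1, h2]
  · filter_upwards [h.coeFn_toLp, h'.coeFn_toLp] with p h1 h2
    rw [h1, h2]

end SliceFourier

end PartialFourier

/-! ### Stokes' theorem for a cone over a triangle, for a continuously differentiable closed 2-form.
-/

section SmoothFlux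

variable {N : ℕ}

section Triangle

open Set intervalIntegral

theorem integral_triangle_swap {H : ℝ → ℝ → ℝ} (hH : Continuous H.uncurry) :
    ∫ s in (0 : ℝ)..1, ∫ u in s..1, H s u = ∫ u in (0 : ℝ)..1, ∫ s in (0 : ℝ)..u, H s u := by
  have hswap := intervalIntegral_intervalIntegral_swap (a := 0) (b := 1) (c := 0) (d := 1)
    (F := fun s u : ℝ => Set.indicator {p : ℝ × ℝ | p.1 < p.2} H.uncurry (s, u)) (by
      refine IntegrableOn.mono_set (t := Icc 0 1 ×ˢ Icc 0 1) ?_ ?_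
      · exact IntegrableOn.indicator
          (hH.continuousOn.integrableOn_compact (isCompact_Icc.prod isCompact_Icc))
          (measurableSet_lt measurable_fst measurable_snd)
      · rw [uIoc_of_le zero_le_one]
        exact prod_mono Ioc_subset_Icc_self Ioc_subset_Icc_self)
  refine (intervalIntegral.integral_congr_ae ?_).trans
    (hswap.trans (intervalIntegral.integral_congr_ae ?_))
  · refine Eventually.of_forall fun s hs => ?_
    rw [uIoc_of_le zero_le_one] at hs
    have e : ∀ u, Set.indicator {p : ℝ × ℝ | p.1 < p.2} H.uncurry (s, u) =
        (Ioi s).indicator (H s) u := fun u => by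
      simp [Set.indicator, Function.uncurry]
    simp only [e]
    rw [integral_of_le zero_le_one, integral_of_le hs.2, setIntegral_indicator measurableSet_Ioi]
    congr 2
    ext u
    simp only [mem_Ioc, mem_inter_iff, mem_Ioi]
    constructor
    · rintro ⟨h1, h2⟩; exact ⟨⟨hs.1.trans h1, h2⟩, h1⟩
    · rintro ⟨⟨h1, h2⟩, h3⟩; exact ⟨h3, h2⟩
  · refine Eventually.of_forall fun u hu => ?_
    rw [uIoc_of_le zero_le_one] at hu
    have e : ∀ s, Set.indicator {p : ℝ × ℝ | p.1 < p.2} H.uncurry (s, u) =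
        (Iio u).indicator (fun s => H s u) s := fun u => by
      simp [Set.indicator, Function.uncurry]
    simp only [e]
    rw [integral_of_le zero_le_one, integral_of_le hu.1.le, setIntegral_indicator measurableSet_Iio,
      integral_Ioc_eq_integral_Ioo]
    congr 2
    ext s
    simp only [mem_Ioc, mem_inter_iff, mem_Iio, mem_Ioo]
    constructor
    · rintro ⟨⟨h1, h2⟩, h3⟩; exact ⟨h1, h3⟩
    · rintro ⟨h1, h2⟩; exact ⟨⟨h1, h2.le.trans hu.2⟩, h2⟩

theorem integral_simplex_eq {h : ℝ → ℝ → ℝ} (hh : Continuous h.uncurry) :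
    ∫ s in (0 : ℝ)..1, ∫ t in (0 : ℝ)..(1 - s), h s t =
      ∫ u in (0 : ℝ)..1, ∫ s in (0 : ℝ)..u, h s (u - s) := by
  rw [← integral_triangle_swap (H := fun s u => h s (u - s))
    (hh.comp (f := fun p : ℝ × ℝ => (p.1, p.2 - p.1)) (by fun_prop))]
  refine integral_congr fun s _ => ?_
  simp only [integral_comp_sub_right (fun t => h s t), sub_self]

theorem integral_simplex_swap {h : ℝ → ℝ → ℝ} (hh : Continuous h.uncurry) :
    ∫ s in (0 : ℝ)..1, ∫ t in (0 : ℝ)..(1 - s), h s t =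
      ∫ t in (0 : ℝ)..1, ∫ s in (0 : ℝ)..(1 - t), h s t := by
  rw [integral_simplex_eq hh, integral_simplex_eq (h := fun t s => h s t)
    (hh.comp (f := fun p : ℝ × ℝ => (p.2, p.1)) (by fun_prop))]
  refine integral_congr fun u _ => ?_
  simpa using (integral_comp_sub_left (fun s => h s (u - s)) u (a := 0) (b := u)).symm

/-- The substitution s = r(1-τ), t = rτ has Jacobian r. It is the parametrization of a triangle as a
cone over the side opposite to a vertex. -/
theorem integral_simplex_polar {h : ℝ → ℝ → ℝ} (hh : Continuous h.uncurry) :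
    ∫ s in (0 : ℝ)..1, ∫ t in (0 : ℝ)..(1 - s), h s t =
      ∫ r in (0 : ℝ)..1, ∫ τ in (0 : ℝ)..1, r * h (r * (1 - τ)) (r * τ) := by
  rw [integral_simplex_swap hh, integral_simplex_eq (h := fun t s => h s t)
    (hh.comp (f := fun p : ℝ × ℝ => (p.2, p.1)) (by fun_prop))]
  refine integral_congr fun r _ => ?_
  simp only [intervalIntegral.integral_const_mul]
  have := mul_integral_comp_mul_left (f := fun t => h (r - t) t) (c := r) (a := 0) (b := 1)
  simp only [mul_zero, mul_one] at this
  rw [← this]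
  congr 2 with τ
  congr 1
  ring

end Triangle

section Stokes

open intervalIntegral

variable {E : Type*} [NormedAddCommGroup E] [NormedSpace ℝ E]

/-- The flux of the two-form `β` through the triangle of vertices `a`, `b`, `c`. -/
def formFlux (β : E → E → E → ℝ) (a b c : E) : ℝ :=
  ∫ s in (0 : ℝ)..1, ∫ t in (0 : ℝ)..(1 - s), β (a + s • (b - a) + t • (c - a)) (b - a) (c - a)

/-- Polar coordinates with apex 0. By antisymmetry c may be replaced by the edge vector c - b, which
is the form of the boundary terms in `formFlux_eq_cone`. -/
theorem formFlux_zero_left {β : E → E →L[ℝ] E →L[ℝ] ℝ} (hβ : Continuous β)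
    (hanti : ∀ x u, β x u u = 0) (b c : E) :
    formFlux (fun x u v => β x u v) 0 b c =
      ∫ r in (0 : ℝ)..1, ∫ τ in (0 : ℝ)..1, r * β (r • (b + τ • (c - b))) b (c - b) := by
  have hc : Continuous fun p : ℝ × ℝ => β (p.1 • b + p.2 • c) b c := by fun_prop
  simp only [formFlux, sub_zero, zero_add]
  rw [integral_simplex_polar (h := fun s t => β (s • b + t • c) b c) hc]
  refine integral_congr fun r _ => integral_congr fun τ _ => ?_
  simp only [map_sub, hanti, sub_zero]
  congr 4
  module

-- The Poincaré homotopy. With T(s,t) running over the triangle, β(T)(v,w) is the integral over r in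
-- [0,1] of the derivative of r²β(rT)(v,w). Closedness makes this derivative minus the divergence of
-- (rβ(rT)(w,T), rβ(rT)(T,v)) in (s,t). Integrating the divergence leaves one term per edge, and
-- each is the flux through the cone over that edge.
set_option maxHeartbeats 1000000 in
theorem formFlux_eq_cone {β : E → E →L[ℝ] E →L[ℝ] ℝ} {β' : E → E →L[ℝ] E →L[ℝ] E →L[ℝ] ℝ}
    (hβ : ∀ x, HasFDerivAt β (β' x) x) (hβ' : Continuous β')
    (hanti : ∀ x u, β x u u = 0)
    (hclosed : ∀ x u v w, β' x w u v + β' x u v w + β' x v w u = 0) (a b c : E) :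
    formFlux (fun x u v => β x u v) a b c =
      formFlux (fun x u v => β x u v) 0 a b + formFlux (fun x u v => β x u v) 0 b c +
        formFlux (fun x u v => β x u v) 0 c a := by
  have hcont : Continuous β := continuous_iff_continuousAt.2 fun x => (hβ x).continuousAt
  have hswap : ∀ x u v, β x u v = -β x v u := fun x u v => by
    have := hanti x (u + v)
    simp only [map_add, add_apply, hanti] at this
    linarith
  set v := b - a with hv
  set w := c - a with hw
  let T : ℝ → ℝ → E := fun s t => a + s • v + t • w
  have hTs : ∀ s t, HasDerivAt (fun s => T s t) v s := fun s t => by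
    simpa [T] using (((hasDerivAt_id s).smul_const v).const_add a).add_const (t • w)
  have hTt : ∀ s t, HasDerivAt (fun t => T s t) w t := fun s t => by
    simpa [T] using ((hasDerivAt_id t).smul_const w).const_add (a + s • v)
  -- the three partial derivatives
  let G : ℝ → ℝ → ℝ → ℝ := fun r s t =>
    2 * r * β (r • T s t) v w + r ^ 2 * β' (r • T s t) (T s t) v w
  let P' : ℝ → ℝ → ℝ → ℝ := fun r s t =>
    r * (r * β' (r • T s t) v w (T s t) + β (r • T s t) w v)
  let Q' : ℝ → ℝ → ℝ → ℝ := fun r s t =>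
    r * (r * β' (r • T s t) w (T s t) v + β (r • T s t) w v)
  have hG : ∀ r s t, HasDerivAt (fun r => r ^ 2 * β (r • T s t) v w) (G r s t) r := by
    intro r s t
    have h1 : HasDerivAt (fun r : ℝ => r • T s t) (T s t) r := by
      simpa using (hasDerivAt_id r).smul_const (T s t)
    have h2 := ((hβ (r • T s t)).comp_hasDerivAt r h1)
    have h3 := (h2.clm_apply (hasDerivAt_const r v)).clm_apply (hasDerivAt_const r w)
    refine ((hasDerivAt_pow 2 r).mul h3).congr_deriv ?_
    simp [G]
  have hP : ∀ r s t, HasDerivAt (fun s => r * β (r • T s t) w (T s t)) (P' r s t) s := by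
    intro r s t
    have h2 := ((hβ (r • T s t)).comp_hasDerivAt s ((hTs s t).const_smul r))
    have h3 := (h2.clm_apply (hasDerivAt_const s w)).clm_apply (hTs s t)
    refine (h3.const_mul r).congr_deriv ?_
    simp [P']
  have hQ : ∀ r s t, HasDerivAt (fun t => r * β (r • T s t) (T s t) v) (Q' r s t) t := by
    intro r s t
    have h2 := ((hβ (r • T s t)).comp_hasDerivAt t ((hTt s t).const_smul r))
    have h3 := (h2.clm_apply (hTt s t)).clm_apply (hasDerivAt_const t v)
    refine (h3.const_mul r).congr_deriv ?_
    simp [Q']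
  -- Closedness is applied to the three vectors v, w and T(s,t).
  have hsum : ∀ r s t, G r s t = -(P' r s t + Q' r s t) := by
    intro r s t
    have h1 := hclosed (r • T s t) v w (T s t)
    have h2 := hswap (r • T s t) v w
    simp only [G, P', Q', h2]
    linear_combination r ^ 2 * h1
  have hGc : Continuous fun p : ℝ × ℝ × ℝ => G p.1 p.2.1 p.2.2 := by
    simp only [G, T]; fun_prop
  have hPc : Continuous fun p : ℝ × ℝ × ℝ => P' p.1 p.2.1 p.2.2 := by
    simp only [P', T]; fun_prop
  have hQc : Continuous fun p : ℝ × ℝ × ℝ => Q' p.1 p.2.1 p.2.2 := by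
    simp only [Q', T]; fun_prop
  have hG1 : ∀ r, Continuous (Function.uncurry (G r)) := fun r =>
    hGc.comp (f := fun p : ℝ × ℝ => (r, p.1, p.2)) (by fun_prop)
  have hP1 : ∀ r, Continuous (Function.uncurry (P' r)) := fun r =>
    hPc.comp (f := fun p : ℝ × ℝ => (r, p.1, p.2)) (by fun_prop)
  have hQ1 : ∀ r, Continuous (Function.uncurry (Q' r)) := fun r =>
    hQc.comp (f := fun p : ℝ × ℝ => (r, p.1, p.2)) (by fun_prop)
  -- the integral over the cone
  have e1 : formFlux (fun x u v => β x u v) a b c =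
      ∫ r in (0 : ℝ)..1, ∫ s in (0 : ℝ)..1, ∫ t in (0 : ℝ)..(1 - s), G r s t := by
    have h1 : ∀ s t, β (T s t) v w = ∫ r in (0 : ℝ)..1, G r s t := by
      intro s t
      rw [integral_eq_sub_of_hasDerivAt (fun r _ => hG r s t)]
      · simp
      · exact (hGc.comp (f := fun r : ℝ => (r, s, t)) (by fun_prop)).intervalIntegrable _ _
    have h2 : formFlux (fun x u v => β x u v) a b c =
        ∫ s in (0 : ℝ)..1, ∫ t in (0 : ℝ)..(1 - s), ∫ r in (0 : ℝ)..1, G r s t := by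
      simp only [formFlux, ← hv, ← hw]
      refine integral_congr fun s _ => integral_congr fun t _ => h1 s t
    rw [h2]
    have h3 : ∀ s, ∫ t in (0 : ℝ)..(1 - s), ∫ r in (0 : ℝ)..1, G r s t =
        ∫ r in (0 : ℝ)..1, ∫ t in (0 : ℝ)..(1 - s), G r s t := by
      intro s
      refine intervalIntegral_intervalIntegral_swap (F := fun t r => G r s t) ?_
      refine IntegrableOn.mono_set (t := Set.uIcc 0 (1 - s) ×ˢ Set.uIcc 0 1) ?_
        (Set.prod_mono Set.uIoc_subset_uIcc Set.uIoc_subset_uIcc)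
      exact ((hGc.comp (f := fun p : ℝ × ℝ => (p.2, s, p.1))
        (by fun_prop)).continuousOn.integrableOn_compact (isCompact_uIcc.prod isCompact_uIcc))
    simp only [h3]
    refine intervalIntegral_intervalIntegral_swap
      (F := fun s r => ∫ t in (0 : ℝ)..(1 - s), G r s t) ?_
    refine IntegrableOn.mono_set (t := Set.uIcc 0 1 ×ˢ Set.uIcc 0 1) ?_
        (Set.prod_mono Set.uIoc_subset_uIcc Set.uIoc_subset_uIcc)
    refine (Continuous.continuousOn ?_).integrableOn_compact (isCompact_uIcc.prod isCompact_uIcc)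
    exact continuous_parametric_intervalIntegral_of_continuous
      (f := fun (p : ℝ × ℝ) t => G p.2 p.1 t) (s := fun p : ℝ × ℝ => 1 - p.1)
      (hGc.comp (f := fun q : (ℝ × ℝ) × ℝ => (q.1.2, q.1.1, q.2)) (by fun_prop)) (by fun_prop)
  have hPs : ∀ r, ∫ s in (0 : ℝ)..1, ∫ t in (0 : ℝ)..(1 - s), P' r s t =
      ∫ t in (0 : ℝ)..1, (r * β (r • T (1 - t) t) w (T (1 - t) t) - r * β (r • T 0 t) w (T 0 t)) := by
    intro r
    -- `P'` is a derivative in s, so s has to be the inner variable.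
    rw [integral_simplex_swap (hP1 r)]
    refine integral_congr fun t _ => ?_
    exact integral_eq_sub_of_hasDerivAt (fun s _ => hP r s t)
      ((hP1 r).comp (f := fun s : ℝ => (s, t)) (by fun_prop) |>.intervalIntegrable _ _)
  have hQt : ∀ r, ∫ s in (0 : ℝ)..1, ∫ t in (0 : ℝ)..(1 - s), Q' r s t =
      ∫ s in (0 : ℝ)..1, (r * β (r • T s (1 - s)) (T s (1 - s)) v - r * β (r • T s 0) (T s 0) v) := by
    intro r
    refine integral_congr fun s _ => ?_
    exact integral_eq_sub_of_hasDerivAt (fun t _ => hQ r s t)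
      ((hQ1 r).comp (f := fun t : ℝ => (s, t)) (by fun_prop) |>.intervalIntegrable _ _)
  have hflip : ∀ f : ℝ → ℝ, ∫ t in (0 : ℝ)..1, f (1 - t) = ∫ t in (0 : ℝ)..1, f t := fun f => by
    simp
  have e2 : ∀ r : ℝ, ∫ s in (0 : ℝ)..1, ∫ t in (0 : ℝ)..(1 - s), G r s t =
      (∫ τ in (0 : ℝ)..1, r * β (r • (a + τ • (b - a))) a (b - a)) +
      (∫ τ in (0 : ℝ)..1, r * β (r • (b + τ • (c - b))) b (c - b)) +
      ∫ τ in (0 : ℝ)..1, r * β (r • (c + τ • (a - c))) c (a - c) := by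
    intro r
    have hinner : ∀ s, ∫ t in (0 : ℝ)..(1 - s), G r s t =
        -((∫ t in (0 : ℝ)..(1 - s), P' r s t) + ∫ t in (0 : ℝ)..(1 - s), Q' r s t) := by
      intro s
      rw [← intervalIntegral.integral_add, ← intervalIntegral.integral_neg]
      · exact integral_congr fun t _ => hsum r s t
      · exact (hP1 r).comp (f := fun t : ℝ => (s, t)) (by fun_prop) |>.intervalIntegrable _ _
      · exact (hQ1 r).comp (f := fun t : ℝ => (s, t)) (by fun_prop) |>.intervalIntegrable _ _
    simp only [hinner]
    rw [intervalIntegral.integral_neg, intervalIntegral.integral_add, hPs, hQt]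
    rotate_left
    · exact (continuous_parametric_intervalIntegral_of_continuous (hP1 r)
        (by fun_prop)).intervalIntegrable _ _
    · exact (continuous_parametric_intervalIntegral_of_continuous (hQ1 r)
        (by fun_prop)).intervalIntegrable _ _
    -- Reversing these parametrizations lets one variable t describe all edges: b + t(c-b), c +
    -- (1-t)(a-c) and a + (1-t)(b-a). The identity can then be checked pointwise.
    rw [← hflip (fun s => r * β (r • T s (1 - s)) (T s (1 - s)) v - r * β (r • T s 0) (T s 0) v),
      ← hflip (fun τ => r * β (r • (c + τ • (a - c))) c (a - c)),
      ← hflip (fun τ => r * β (r • (a + τ • (b - a))) a (b - a))]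
    have hTc : Continuous fun p : ℝ × ℝ => T p.1 p.2 := by simp only [T]; fun_prop
    rw [← intervalIntegral.integral_add, ← intervalIntegral.integral_neg,
      ← intervalIntegral.integral_add, ← intervalIntegral.integral_add]
    · refine integral_congr fun t _ => ?_
      have k1 : T (1 - t) t = b + t • (c - b) := by simp only [T, hv, hw]; module
      have k2 : T 0 t = c + (1 - t) • (a - c) := by simp only [T, hv, hw]; module
      have k3 : T (1 - t) 0 = a + (1 - t) • (b - a) := by simp only [T, hv, hw]; module
      have k4 : ∀ y, β y w (b + t • (c - b)) + β y (b + t • (c - b)) v = - β y b (c - b) := by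
        intro y
        rw [hswap y w, show w = v + (c - b) by rw [hv, hw]; abel]
        simp only [map_add, add_apply, map_smul, smul_apply,
          hanti, smul_zero]
        ring
      have k5 : ∀ y, β y w (c + (1 - t) • (a - c)) = β y c (a - c) := by
        intro y
        rw [show w = -(a - c) by rw [hw]; abel, hswap y _ (c + _)]
        simp only [map_add, map_neg, add_apply, map_smul,
          smul_apply, hanti, smul_zero]
        ring
      have k6 : ∀ y, β y (a + (1 - t) • (b - a)) v = β y a (b - a) := by
        intro y
        simp only [hv, map_add, add_apply, map_smul,
          smul_apply, hanti, smul_zero, add_zero]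
      have k1' : T (1 - t) (1 - (1 - t)) = b + t • (c - b) := by rw [sub_sub_cancel, k1]
      simp only [k1, k1', k2, k3, k5, k6]
      linear_combination (-r) * k4 (r • (b + t • (c - b)))
    all_goals
      refine Continuous.intervalIntegrable ?_ _ _
      fun_prop
  rw [e1]
  simp only [e2]
  rw [intervalIntegral.integral_add, intervalIntegral.integral_add,
    formFlux_zero_left hcont hanti, formFlux_zero_left hcont hanti, formFlux_zero_left hcont hanti]
  all_goals
    refine Continuous.intervalIntegrable ?_ _ _
    fun_prop

end Stokes

end SmoothFlux

/-! ### Flux of a continuous closed field: Stokes by mollification. -/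

section ContinuousFlux

variable {N : ℕ}

section FluxOfField

open scoped Convolution

/-- The bilinear form `u, v ↦ u j * v k`. -/
def coordForm (j k : Fin N) : Config N →L[ℝ] Config N →L[ℝ] ℝ :=
  (EuclideanSpace.proj j : Config N →L[ℝ] ℝ).smulRight (EuclideanSpace.proj k : Config N →L[ℝ] ℝ)

theorem coordForm_apply (j k : Fin N) (u v : Config N) : coordForm j k u v = u j * v k := by
  simp [coordForm]

/-- The two-form with components `C`. -/
def twoForm (C : Fin N → Fin N → Config N → ℝ) (x : Config N) :
    Config N →L[ℝ] Config N →L[ℝ] ℝ :=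
  ∑ j, ∑ k, C j k x • coordForm j k

theorem twoForm_apply (C : Fin N → Fin N → Config N → ℝ) (x u v : Config N) :
    twoForm C x u v = ∑ j, ∑ k, C j k x * u j * v k := by
  simp [twoForm, coordForm_apply, mul_assoc]

theorem flux_eq_formFlux (B : MagneticField N) (a b c : Config N) :
    flux B a b c = formFlux (fun x u v => twoForm B.comp x u v) a b c := by
  simp only [flux, formFlux, twoForm_apply]

theorem twoForm_self {C : Fin N → Fin N → Config N → ℝ} (hC : ∀ j k x, C j k x = -C k j x)
    (x u : Config N) : twoForm C x u u = 0 := by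
  have h : twoForm C x u u = -twoForm C x u u := by
    rw [twoForm_apply]
    nth_rewrite 1 [Finset.sum_comm]
    simp only [← Finset.sum_neg_distrib]
    refine Finset.sum_congr rfl fun j _ => Finset.sum_congr rfl fun k _ => ?_
    rw [hC k j]
    ring
  linarith

theorem continuous_flux (B : MagneticField N) :
    Continuous fun p : Config N × Config N × Config N => flux B p.1 p.2.1 p.2.2 := by
  unfold flux
  have hB := B.continuous_comp
  have hcomp : ∀ j k, Continuous fun q : ((Config N × Config N × Config N) × ℝ) × ℝ =>
      B.comp j k (q.1.1.1 + q.1.2 • (q.1.1.2.1 - q.1.1.1) + q.2 • (q.1.1.2.2 - q.1.1.1)) :=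
    fun j k => (hB j k).comp (by fun_prop)
  refine intervalIntegral.continuous_parametric_intervalIntegral_of_continuous'
    (f := fun (p : Config N × Config N × Config N) s => ∫ t in (0 : ℝ)..(1 - s),
      ∑ j, ∑ k, B.comp j k (p.1 + s • (p.2.1 - p.1) + t • (p.2.2 - p.1)) *
        (p.2.1 - p.1) j * (p.2.2 - p.1) k) ?_ 0 1
  refine intervalIntegral.continuous_parametric_intervalIntegral_of_continuous
    (f := fun (q : (Config N × Config N × Config N) × ℝ) t =>
      ∑ j, ∑ k, B.comp j k (q.1.1 + q.2 • (q.1.2.1 - q.1.1) + t • (q.1.2.2 - q.1.1)) *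
        (q.1.2.1 - q.1.1) j * (q.1.2.2 - q.1.1) k) (s := fun q => 1 - q.2) ?_ (by fun_prop)
  refine continuous_finsetSum _ fun j _ => continuous_finsetSum _ fun k _ => ?_
  exact ((hcomp j k).mul (by fun_prop)).mul (by fun_prop)

/-- Stokes' theorem for a closed continuously differentiable field. -/
theorem formFlux_twoForm_eq {C : Fin N → Fin N → Config N → ℝ}
    (hC : ∀ j k, ContDiff ℝ 1 (C j k)) (hanti : ∀ j k x, C j k x = -C k j x)
    (hclosed : ∀ j k l x, fderiv ℝ (C j k) x (EuclideanSpace.single l 1) +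
      fderiv ℝ (C k l) x (EuclideanSpace.single j 1) +
      fderiv ℝ (C l j) x (EuclideanSpace.single k 1) = 0) (a b c : Config N) :
    formFlux (fun x u v => twoForm C x u v) a b c =
      formFlux (fun x u v => twoForm C x u v) 0 a b +
      formFlux (fun x u v => twoForm C x u v) 0 b c +
      formFlux (fun x u v => twoForm C x u v) 0 c a := by
  let C' : Config N → Config N →L[ℝ] Config N →L[ℝ] Config N →L[ℝ] ℝ := fun x =>
    ∑ j, ∑ k, (fderiv ℝ (C j k) x).smulRight (coordForm j k)
  have hC' : ∀ x u v w, C' x w u v =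
      ∑ j, ∑ k, ∑ l, fderiv ℝ (C j k) x (EuclideanSpace.single l 1) * (u j * v k * w l) := by
    intro x u v w
    have hw : w = ∑ l, w l • EuclideanSpace.single l (1 : ℝ) := by
      simpa using ((EuclideanSpace.basisFun (Fin N) ℝ).sum_repr w).symm
    have : ∀ j k, fderiv ℝ (C j k) x w =
        ∑ l, fderiv ℝ (C j k) x (EuclideanSpace.single l 1) * w l := by
      intro j k
      conv_lhs => rw [hw]
      simp [mul_comm]
    simp only [C', sum_apply, ContinuousLinearMap.smulRight_apply,
      smul_apply, coordForm_apply, smul_eq_mul, this, Finset.sum_mul]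
    refine Finset.sum_congr rfl fun j _ => Finset.sum_congr rfl fun k _ =>
      Finset.sum_congr rfl fun l _ => ?_
    ring
  refine formFlux_eq_cone (β' := C') ?_ ?_ (twoForm_self hanti) ?_ a b c
  · intro x
    refine HasFDerivAt.fun_sum fun j _ => HasFDerivAt.fun_sum fun k _ => ?_
    exact ((hC j k).differentiable one_ne_zero x).hasFDerivAt.smul_const (coordForm j k)
  · refine continuous_finsetSum _ fun j _ => continuous_finsetSum _ fun k _ => ?_
    have := (hC j k).continuous_fderiv one_ne_zero
    exact ((ContinuousLinearMap.smulRightL ℝ (Config N)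
      (Config N →L[ℝ] Config N →L[ℝ] ℝ)).continuous₂.comp (this.prodMk continuous_const))
  · intro x u v w
    have e1 := hC' x u v w
    have e2 : C' x u v w =
        ∑ j, ∑ k, ∑ l, fderiv ℝ (C k l) x (EuclideanSpace.single j 1) * (u j * v k * w l) := by
      rw [hC', Finset.sum_congr rfl fun k _ => Finset.sum_comm, Finset.sum_comm]
      refine Finset.sum_congr rfl fun j _ => Finset.sum_congr rfl fun k _ =>
        Finset.sum_congr rfl fun l _ => ?_
      ring
    have e3 : C' x v w u =
        ∑ j, ∑ k, ∑ l, fderiv ℝ (C l j) x (EuclideanSpace.single k 1) * (u j * v k * w l) := by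
      rw [hC', Finset.sum_comm, Finset.sum_congr rfl fun k _ => Finset.sum_comm]
      refine Finset.sum_congr rfl fun j _ => Finset.sum_congr rfl fun k _ =>
        Finset.sum_congr rfl fun l _ => ?_
      ring
    rw [e1, e2, e3]
    simp only [← Finset.sum_add_distrib, ← add_mul, hclosed, zero_mul, Finset.sum_const_zero]

/-- The mollification of a component of a field. -/
def mollify (φ : ContDiffBump (0 : Config N)) (g : Config N → ℝ) : Config N → ℝ :=
  φ.normed volume ⋆[ContinuousLinearMap.lsmul ℝ ℝ, volume] g

/-- The derivative falls on the bump, and passing from x to the integration variable costs a sign.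
What results is a pairing with a derivative of the test function y ↦ φ(x-y), to which distributional
closedness applies. -/
theorem fderiv_mollify (φ : ContDiffBump (0 : Config N)) {g : Config N → ℝ} (hg : Continuous g)
    (x e : Config N) : fderiv ℝ (mollify φ g) x e =
      ∫ y, g y * -fderiv ℝ (fun y => φ.normed volume (x - y)) y e := by
  have h := (φ.hasCompactSupport_normed (μ := volume)).hasFDerivAt_convolution_left (μ := volume)
    (ContinuousLinearMap.lsmul ℝ ℝ) (φ.contDiff_normed (n := 1)) hg.locallyIntegrable x
  have hd : ∀ y, fderiv ℝ (fun y => φ.normed volume (x - y)) y e =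
      -fderiv ℝ (φ.normed volume) (x - y) e := by
    intro y
    have h1 : HasFDerivAt (φ.normed volume) (fderiv ℝ (φ.normed volume) (x - y)) (x - y) :=
      ((φ.contDiff_normed (n := 1)).differentiable one_ne_zero _).hasFDerivAt
    have h2 := h1.comp y ((hasFDerivAt_id y).const_sub x)
    rw [show (fun y => φ.normed volume (x - y)) = φ.normed volume ∘ HSub.hSub x from rfl,
      h2.fderiv]
    simp
  have hint : ConvolutionExistsAt (fderiv ℝ (φ.normed volume)) g x
      ((ContinuousLinearMap.lsmul ℝ ℝ).precompL (Config N)) volume :=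
    ((φ.hasCompactSupport_normed (μ := volume)).fderiv ℝ).convolutionExists_left _
      ((φ.contDiff_normed (n := 1)).continuous_fderiv one_ne_zero) hg.locallyIntegrable x
  rw [mollify, h.fderiv, convolution_eq_swap]
  have hint' := hint.integrable_swap
  rw [ContinuousLinearMap.integral_apply hint']
  refine integral_congr_ae (Eventually.of_forall fun y => ?_)
  simp [hd, mul_comm]

theorem mollify_closed (B : MagneticField N) (φ : ContDiffBump (0 : Config N)) (j k l : Fin N)
    (x : Config N) : fderiv ℝ (mollify φ (B.comp j k)) x (EuclideanSpace.single l 1) +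
      fderiv ℝ (mollify φ (B.comp k l)) x (EuclideanSpace.single j 1) +
      fderiv ℝ (mollify φ (B.comp l j)) x (EuclideanSpace.single k 1) = 0 := by
  have hψ : ContDiff ℝ ∞ fun y => φ.normed volume (x - y) :=
    φ.contDiff_normed.comp (contDiff_const.sub contDiff_id)
  have hs : HasCompactSupport fun y => φ.normed volume (x - y) :=
    φ.hasCompactSupport_normed.comp_homeomorph (Homeomorph.subLeft x)
  have hi : ∀ j k, ∀ e : Config N, Integrable fun y =>
      B.comp j k y * -fderiv ℝ (fun y => φ.normed volume (x - y)) y e := by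
    intro j k e
    refine Continuous.integrable_of_hasCompactSupport ?_ ?_
    · exact (B.continuous_comp j k).mul
        ((hψ.continuous_fderiv (by simp)).clm_apply continuous_const).neg
    · exact (((hs.fderiv_apply ℝ e).neg).mul_left)
  simp only [fderiv_mollify φ (B.continuous_comp _ _)]
  have hadd : Integrable fun y =>
      B.comp j k y * -fderiv ℝ (fun y => φ.normed volume (x - y)) y (EuclideanSpace.single l 1) +
      B.comp k l y * -fderiv ℝ (fun y => φ.normed volume (x - y)) y (EuclideanSpace.single j 1) :=
    (hi _ _ _).add (hi _ _ _)
  rw [← integral_add (hi _ _ _) (hi _ _ _), ← integral_add hadd (hi _ _ _)]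
  have := B.closed _ hψ hs j k l
  rw [← neg_eq_zero, ← integral_neg, ← this]
  congr 1 with y
  ring

theorem tendsto_formFlux_mollify (B : MagneticField N) {φ : ℕ → ContDiffBump (0 : Config N)}
    (hφ : Tendsto (fun n => (φ n).rOut) atTop (𝓝 0)) (a b c : Config N) :
    Tendsto (fun n => formFlux (fun x u v =>
      twoForm (fun j k => mollify (φ n) (B.comp j k)) x u v) a b c) atTop
      (𝓝 (formFlux (fun x u v => twoForm B.comp x u v) a b c)) := by
  -- The triangle lies in the ball of radius R. Once the bumps have radius below 1, the mollified
  -- components on it see only values of B in the ball of radius R + 1.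
  set R : ℝ := ‖a‖ + ‖b - a‖ + ‖c - a‖ with hR
  have hcomp : ∀ j k, ∃ K, ∀ x ∈ Metric.closedBall (0 : Config N) (R + 1), ‖B.comp j k x‖ ≤ K :=
    fun j k => (isCompact_closedBall _ _).exists_bound_of_continuousOn
      (B.continuous_comp j k).continuousOn
  choose K hK using hcomp
  have hmol : ∀ᶠ n in atTop, ∀ j k, ∀ x : Config N, ‖x‖ ≤ R →
      ‖mollify (φ n) (B.comp j k) x‖ ≤ 3 * K j k := by
    filter_upwards [hφ.eventually_lt_const zero_lt_one] with n hn j k x hx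
    have hx' : ‖B.comp j k x‖ ≤ K j k := hK j k x (by
      rw [mem_closedBall_zero_iff]; linarith)
    -- Two values bounded by K differ by at most 2K; adding the value at x gives the bound 3K.
    have h1 : dist (mollify (φ n) (B.comp j k) x) (B.comp j k x) ≤ 2 * K j k := by
      refine ContDiffBump.dist_normed_convolution_le
        (B.continuous_comp j k).aestronglyMeasurable fun y hy => ?_
      have hy' : ‖B.comp j k y‖ ≤ K j k := hK j k y (by
        rw [mem_closedBall_zero_iff]
        have h2 : ‖y‖ ≤ ‖y - x‖ + ‖x‖ := by simpa using norm_add_le (y - x) x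
        rw [Metric.mem_ball, dist_eq_norm] at hy
        linarith)
      rw [dist_eq_norm]
      linarith [norm_sub_le (B.comp j k y) (B.comp j k x)]
    rw [dist_eq_norm] at h1
    have h2 : ‖mollify (φ n) (B.comp j k) x‖ ≤
      ‖mollify (φ n) (B.comp j k) x - B.comp j k x‖ + ‖B.comp j k x‖ := by
        simpa using norm_add_le (mollify (φ n) (B.comp j k) x - B.comp j k x) (B.comp j k x)
    linarith
  have hcont : ∀ n j k, Continuous (mollify (φ n) (B.comp j k)) := fun n j k =>
    ((φ n).hasCompactSupport_normed.contDiff_convolution_left (μ := volume) (n := 0)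
      (ContinuousLinearMap.lsmul ℝ ℝ) (φ n).contDiff_normed
      (B.continuous_comp j k).locallyIntegrable).continuous
  set M : ℝ := ∑ j, ∑ k, 3 * K j k * |(b - a) j| * |(c - a) k| with hM
  have hbound : ∀ᶠ n in atTop, ∀ x : Config N, ‖x‖ ≤ R →
      ‖twoForm (fun j k => mollify (φ n) (B.comp j k)) x (b - a) (c - a)‖ ≤ M := by
    filter_upwards [hmol] with n hn x hx
    rw [twoForm_apply]
    refine (norm_sum_le _ _).trans (Finset.sum_le_sum fun j _ => (norm_sum_le _ _).trans
      (Finset.sum_le_sum fun k _ => ?_))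
    rw [norm_mul, norm_mul]
    have := hn j k x hx
    simp only [Real.norm_eq_abs] at this ⊢
    gcongr
  have hnorm : ∀ s t : ℝ, s ∈ Set.uIoc 0 1 → t ∈ Set.uIoc 0 (1 - s) →
      ‖a + s • (b - a) + t • (c - a)‖ ≤ R := by
    intro s t hs ht
    rw [Set.uIoc_of_le zero_le_one] at hs
    rw [Set.uIoc_of_le (by linarith [hs.2])] at ht
    have h1 : ‖s • (b - a)‖ ≤ ‖b - a‖ := by
      rw [norm_smul, Real.norm_of_nonneg hs.1.le]
      exact mul_le_of_le_one_left (norm_nonneg _) hs.2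
    have h2 : ‖t • (c - a)‖ ≤ ‖c - a‖ := by
      rw [norm_smul, Real.norm_of_nonneg ht.1.le]
      exact mul_le_of_le_one_left (norm_nonneg _) (by linarith [hs.1, ht.2])
    calc _ ≤ ‖a‖ + ‖s • (b - a)‖ + ‖t • (c - a)‖ := norm_add₃_le
      _ ≤ R := by rw [hR]; gcongr
  have hpt : ∀ x, Tendsto (fun n =>
      twoForm (fun j k => mollify (φ n) (B.comp j k)) x (b - a) (c - a)) atTop
      (𝓝 (twoForm B.comp x (b - a) (c - a))) := by
    intro x
    simp only [twoForm_apply]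
    refine tendsto_finsetSum _ fun j _ => tendsto_finsetSum _ fun k _ => ?_
    exact ((ContDiffBump.convolution_tendsto_right_of_continuous hφ
      (B.continuous_comp j k) x).mul_const _).mul_const _
  have hform : ∀ n, Continuous fun x =>
      twoForm (fun j k => mollify (φ n) (B.comp j k)) x (b - a) (c - a) := by
    intro n
    simp only [twoForm_apply]
    refine continuous_finsetSum _ fun j _ => continuous_finsetSum _ fun k _ => ?_
    exact ((hcont n j k).mul continuous_const).mul continuous_const
  unfold formFlux
  refine intervalIntegral.tendsto_integral_filter_of_dominated_convergence (fun _ => M) ?_ ?_ ?_ ?_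
  · refine Eventually.of_forall fun n => Continuous.aestronglyMeasurable ?_
    refine intervalIntegral.continuous_parametric_intervalIntegral_of_continuous
      (f := fun s t => twoForm (fun j k => mollify (φ n) (B.comp j k))
        (a + s • (b - a) + t • (c - a)) (b - a) (c - a)) (s := fun s => 1 - s) ?_ (by fun_prop)
    exact (hform n).comp (f := fun p : ℝ × ℝ => a + p.1 • (b - a) + p.2 • (c - a)) (by fun_prop)
  · filter_upwards [hbound] with n hn
    refine Eventually.of_forall fun s hs => ?_
    have h1 := intervalIntegral.norm_integral_le_of_norm_le_const (a := 0) (b := 1 - s) (C := M)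
      (f := fun t => twoForm (fun j k => mollify (φ n) (B.comp j k))
        (a + s • (b - a) + t • (c - a)) (b - a) (c - a)) fun t ht => hn _ (hnorm s t hs ht)
    refine h1.trans ?_
    have hM0 : 0 ≤ M := (norm_nonneg _).trans (hn a (by rw [hR]; linarith [norm_nonneg (b - a), norm_nonneg (c - a)]))
    rw [Set.uIoc_of_le zero_le_one] at hs
    have : |1 - s - 0| ≤ 1 := by
      rw [abs_le]; constructor <;> linarith [hs.1, hs.2]
    exact mul_le_of_le_one_right hM0 this
  · exact intervalIntegrable_const
  · refine Eventually.of_forall fun s hs => ?_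
    refine intervalIntegral.tendsto_integral_filter_of_dominated_convergence (fun _ => M)
      ?_ ?_ ?_ ?_
    · refine Eventually.of_forall fun n => Continuous.aestronglyMeasurable ?_
      exact (hform n).comp (f := fun t : ℝ => a + s • (b - a) + t • (c - a)) (by fun_prop)
    · filter_upwards [hbound] with n hn
      exact Eventually.of_forall fun t ht => hn _ (hnorm s t hs ht)
    · exact intervalIntegrable_const
    · exact Eventually.of_forall fun t _ => hpt _

/-- Stokes' theorem for the tetrahedron with vertices `0`, `a`, `b`, `c`. -/
theorem flux_eq_add (B : MagneticField N) (a b c : Config N) :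
    flux B a b c = flux B 0 a b + flux B 0 b c + flux B 0 c a := by
  let φ : ℕ → ContDiffBump (0 : Config N) := fun n =>
    { rIn := 1 / (n + 1 : ℝ) / 2, rOut := 1 / (n + 1 : ℝ), rIn_pos := by positivity,
      rIn_lt_rOut := half_lt_self (by positivity) }
  have hφ : Tendsto (fun n => (φ n).rOut) atTop (𝓝 0) := tendsto_one_div_add_atTop_nhds_zero_nat
  simp only [flux_eq_formFlux]
  have h := tendsto_formFlux_mollify B hφ
  -- All four fluxes converge along the mollified fields, which are smooth enough and closed, so
  -- that the identity holds for each of them.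
  refine tendsto_nhds_unique (h a b c) ?_
  refine (((h 0 a b).add (h 0 b c)).add (h 0 c a)).congr fun n => (formFlux_twoForm_eq ?_ ?_ ?_
    a b c).symm
  · intro j k
    exact (φ n).hasCompactSupport_normed.contDiff_convolution_left (μ := volume)
      (ContinuousLinearMap.lsmul ℝ ℝ) (φ n).contDiff_normed
      (B.continuous_comp j k).locallyIntegrable
  · intro j k x
    have : B.comp j k = fun y => -B.comp k j y := funext (B.antisymm j k)
    simp only [mollify, convolution, this]
    rw [← integral_neg]
    simp
  · exact mollify_closed B (φ n)

theorem flux_self (B : MagneticField N) (a b : Config N) : flux B a b b = 0 := by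
  rw [flux_eq_formFlux]
  simp only [formFlux, twoForm_self B.antisymm, intervalIntegral.integral_zero]

theorem flux_self_left (B : MagneticField N) (a b : Config N) : flux B a b a = 0 := by
  rw [flux_eq_formFlux]
  simp [formFlux]

theorem flux_zero_swap (B : MagneticField N) (a b : Config N) :
    flux B 0 b a = -flux B 0 a b := by
  have := flux_eq_add B a b a
  rw [flux_self_left, flux_self] at this
  linarith

end FluxOfField

end ContinuousFlux

/-! ### Symbols as kernels; multiplication by exponentials as phase shifts. -/

section KernelOperators

variable {N : ℕ}

/-- The function `p ↦ exp(-iθ(p)) k(p + t)`. -/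
def phaseShiftFun (θ : Phase N → ℝ) (t : Phase N) (k : Phase N → ℂ) (p : Phase N) : ℂ :=
  Complex.exp (-(Complex.I * (θ p : ℝ))) * k (p + t)

theorem norm_exp_neg_I_mul (r : ℝ) : ‖Complex.exp (-(Complex.I * (r : ℝ)))‖ = 1 := by
  rw [← mul_neg, ← Complex.ofReal_neg, mul_comm]
  exact Complex.norm_exp_ofReal_mul_I _

theorem conj_exp_neg_I_mul (r : ℝ) : conj (Complex.exp (-(Complex.I * (r : ℝ)))) =
    Complex.exp (-(Complex.I * ((-r : ℝ) : ℝ))) := by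
  rw [← Complex.exp_conj]
  simp

theorem measurePreserving_add_right_phase (t : Phase N) :
    MeasurePreserving (fun p : Phase N => p + t) :=
  (measurePreserving_add_right volume t.1).prod (measurePreserving_add_right volume t.2)

theorem ae_comp_add_right {k l : Phase N → ℂ} (h : k =ᵐ[volume] l) (t : Phase N) :
    (fun p => k (p + t)) =ᵐ[volume] fun p => l (p + t) :=
  (measurePreserving_add_right_phase t).quasiMeasurePreserving.ae h

theorem aestronglyMeasurable_phaseShiftFun {θ : Phase N → ℝ} (hθ : Continuous θ) (t : Phase N)
    {k : Phase N → ℂ} (hk : AEStronglyMeasurable k volume) :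
    AEStronglyMeasurable (phaseShiftFun θ t k) volume := by
  refine AEStronglyMeasurable.mul (Continuous.aestronglyMeasurable (by fun_prop)) ?_
  exact hk.comp_measurePreserving (measurePreserving_add_right_phase t)

theorem eLpNorm_phaseShiftFun {θ : Phase N → ℝ} (t : Phase N)
    {k : Phase N → ℂ} (hk : AEStronglyMeasurable k volume) :
    eLpNorm (phaseShiftFun θ t k) 2 volume = eLpNorm k 2 volume := by
  rw [← eLpNorm_comp_measurePreserving hk (measurePreserving_add_right_phase t)]
  refine eLpNorm_congr_norm_ae (Eventually.of_forall fun p => ?_)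
  simp [phaseShiftFun, norm_exp_neg_I_mul]

theorem memLp_phaseShiftFun (θ : C(Phase N, ℝ)) (t : Phase N) {k : Phase N → ℂ}
    (hk : MemLp k 2 volume) : MemLp (phaseShiftFun θ t k) 2 volume :=
  ⟨aestronglyMeasurable_phaseShiftFun θ.continuous t hk.1,
    by rw [eLpNorm_phaseShiftFun t hk.1]; exact hk.2⟩

/-- The unitary `k ↦ exp(-iθ) k(· + t)` of `L²(Ξ)`. -/
def phaseShift (θ : C(Phase N, ℝ)) (t : Phase N) : L2Phase N →ₗᵢ[ℂ] L2Phase N where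
  toFun k := (memLp_phaseShiftFun θ t (Lp.memLp k)).toLp (phaseShiftFun θ t k)
  map_add' k l := by
    rw [← MemLp.toLp_add]
    refine MemLp.toLp_congr _ _ ?_
    filter_upwards [ae_comp_add_right (Lp.coeFn_add k l) t] with p hp
    simp only [phaseShiftFun, Pi.add_apply] at hp ⊢
    rw [hp, mul_add]
  map_smul' c k := by
    rw [RingHom.id_apply, ← MemLp.toLp_const_smul]
    refine MemLp.toLp_congr _ _ ?_
    filter_upwards [ae_comp_add_right (Lp.coeFn_smul c k) t] with p hp
    simp only [phaseShiftFun, Pi.smul_apply, smul_eq_mul] at hp ⊢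
    rw [hp, mul_left_comm]
  norm_map' k := by
    simp only [LinearMap.coe_mk, AddHom.coe_mk]
    rw [Lp.norm_toLp, eLpNorm_phaseShiftFun t (Lp.aestronglyMeasurable k), Lp.norm_def]

theorem coeFn_phaseShift (θ : C(Phase N, ℝ)) (t : Phase N) (k : L2Phase N) :
    phaseShift θ t k =ᵐ[volume] phaseShiftFun θ t k :=
  (memLp_phaseShiftFun θ t (Lp.memLp k)).coeFn_toLp

/-- The inner phase is evaluated at the point moved by the outer shift. All relations between
products with exponentials reduce to this rule and an identity between phases. -/
theorem phaseShift_phaseShift {θ₁ θ₂ θ : C(Phase N, ℝ)} {t₁ t₂ t : Phase N}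
    (hθ : ∀ p, θ p = θ₁ p + θ₂ (p + t₁)) (ht : t = t₁ + t₂) (k : L2Phase N) :
    phaseShift θ₁ t₁ (phaseShift θ₂ t₂ k) = phaseShift θ t k := by
  refine Lp.ext ?_
  filter_upwards [coeFn_phaseShift θ₁ t₁ (phaseShift θ₂ t₂ k), coeFn_phaseShift θ t k,
    ae_comp_add_right (coeFn_phaseShift θ₂ t₂ k) t₁] with p h1 h2 h3
  rw [h1, h2]
  simp only [phaseShiftFun] at h3 ⊢
  rw [h3, hθ, ht, ← mul_assoc, ← Complex.exp_add, add_assoc]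
  congr 2
  push_cast
  ring

theorem phaseShift_zero {θ : C(Phase N, ℝ)} {t : Phase N} (hθ : ∀ p, θ p = 0) (ht : t = 0)
    (k : L2Phase N) : phaseShift θ t k = k := by
  refine Lp.ext ?_
  filter_upwards [coeFn_phaseShift θ t k] with p h
  rw [h]
  simp [phaseShiftFun, hθ, ht]

/-- The partial Fourier transform on `L²(Ξ)`. -/
def weylTransform (N : ℕ) : L2Phase N ≃ₗᵢ[ℂ] L2Phase N :=
  partialFourier (Config N) (volume : Measure (Config N))

/-- The first point `q - πw` of the kernel attached to `(q, w)`. -/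
def kernelLeft (p : Phase N) : Config N := p.1 - Real.pi • p.2

/-- The second point `q + πw` of the kernel attached to `(q, w)`. -/
def kernelRight (p : Phase N) : Config N := p.1 + Real.pi • p.2

@[fun_prop]
theorem continuous_kernelLeft : Continuous (kernelLeft (N := N)) := by
  unfold kernelLeft; fun_prop

@[fun_prop]
theorem continuous_kernelRight : Continuous (kernelRight (N := N)) := by
  unfold kernelRight; fun_prop

theorem continuous_flux_comp {α : Type*} [TopologicalSpace α] (B : MagneticField N)
    {a b c : α → Config N} (ha : Continuous a) (hb : Continuous b) (hc : Continuous c) :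
    Continuous fun x => flux B (a x) (b x) (c x) :=
  (continuous_flux B).comp (f := fun x => (a x, b x, c x)) (ha.prodMk (hb.prodMk hc))

/-- The phase of the left multiplication by `e_X` on kernels. -/
def leftPhase (B : MagneticField N) (X : Phase N) : C(Phase N, ℝ) where
  toFun p := flux B (kernelLeft p) (kernelLeft p + X.1) (kernelRight p) +
    inner ℝ (kernelLeft p + (2⁻¹ : ℝ) • X.1) X.2
  continuous_toFun := by
    refine Continuous.add (continuous_flux_comp B ?_ ?_ ?_) ?_ <;> fun_prop

/-- The shift of the left multiplication by `e_X` on kernels. -/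
def leftShift (X : Phase N) : Phase N := ((2⁻¹ : ℝ) • X.1, -((2 * Real.pi)⁻¹ • X.1))

/-- The phase of the right multiplication by `e_Y` on kernels. -/
def rightPhase (B : MagneticField N) (Y : Phase N) : C(Phase N, ℝ) where
  toFun p := flux B (kernelLeft p) (kernelRight p - Y.1) (kernelRight p) +
    inner ℝ (kernelRight p - (2⁻¹ : ℝ) • Y.1) Y.2
  continuous_toFun := by
    refine Continuous.add (continuous_flux_comp B ?_ ?_ ?_) ?_ <;> fun_prop

/-- The shift of the right multiplication by `e_Y` on kernels. -/
def rightShift (Y : Phase N) : Phase N := (-((2⁻¹ : ℝ) • Y.1), -((2 * Real.pi)⁻¹ • Y.1))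

theorem pi_smul_half_inv (x : Config N) :
    Real.pi • ((2 * Real.pi)⁻¹ • x) = (2⁻¹ : ℝ) • x := by
  rw [smul_smul, mul_inv, mul_left_comm, mul_inv_cancel₀ Real.pi_ne_zero, mul_one]

/-- This and the next three lemmas show that left multiplication moves only the first point of the
kernel and right multiplication only the second. -/
theorem kernelLeft_add_leftShift (p X : Phase N) :
    kernelLeft (p + leftShift X) = kernelLeft p + X.1 := by
  simp only [kernelLeft, leftShift, Prod.fst_add, Prod.snd_add, smul_add, smul_neg,
    pi_smul_half_inv]
  module

theorem kernelRight_add_leftShift (p X : Phase N) :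
    kernelRight (p + leftShift X) = kernelRight p := by
  simp only [kernelRight, leftShift, Prod.fst_add, Prod.snd_add, smul_add, smul_neg,
    pi_smul_half_inv]
  module

theorem kernelLeft_add_rightShift (p X : Phase N) :
    kernelLeft (p + rightShift X) = kernelLeft p := by
  simp only [kernelLeft, rightShift, Prod.fst_add, Prod.snd_add, smul_add, smul_neg,
    pi_smul_half_inv]
  module

theorem kernelRight_add_rightShift (p X : Phase N) :
    kernelRight (p + rightShift X) = kernelRight p - X.1 := by
  simp only [kernelRight, rightShift, Prod.fst_add, Prod.snd_add, smul_add, smul_neg,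
    pi_smul_half_inv]
  module

/-- The operator `f ↦ e_X #^B f`. -/
def leftProduct (B : MagneticField N) (X : Phase N) (f : L2Phase N) : L2Phase N :=
  (weylTransform N).symm (phaseShift (leftPhase B X) (leftShift X) (weylTransform N f))

/-- The operator `f ↦ f #^B e_Y`. -/
def rightProduct (B : MagneticField N) (f : L2Phase N) (Y : Phase N) : L2Phase N :=
  (weylTransform N).symm (phaseShift (rightPhase B Y) (rightShift Y) (weylTransform N f))

/-- The flux through the boundary of the tetrahedron abcd vanishes: each triangle is split into
cones from 0, and the cones over the diagonals ac and bd cancel. -/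
theorem flux_cocycle (B : MagneticField N) (a b c d : Config N) :
    flux B a b c + flux B a c d = flux B a b d + flux B b c d := by
  rw [flux_eq_add B a b c, flux_eq_add B a c d, flux_eq_add B a b d, flux_eq_add B b c d]
  linarith [flux_zero_swap B a c, flux_zero_swap B b d]

theorem flux_rotate (B : MagneticField N) (a b c : Config N) : flux B b c a = flux B a b c := by
  rw [flux_eq_add B b c a, flux_eq_add B a b c]
  ring

theorem flux_swap (B : MagneticField N) (a b c : Config N) : flux B b a c = -flux B a b c := by
  rw [flux_eq_add B b a c, flux_eq_add B a b c]
  linarith [flux_zero_swap B a c, flux_zero_swap B b c, flux_zero_swap B a b]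

theorem flux_reverse (B : MagneticField N) (a b c : Config N) :
    flux B c b a = -flux B a b c := by
  rw [flux_eq_add B c b a, flux_eq_add B a b c]
  linarith [flux_zero_swap B a c, flux_zero_swap B b c, flux_zero_swap B a b]

/-- The translations commute, and the linear parts of the phases do not interfere because they
involve different points of the kernel. The flux parts are the two ways to triangulate the
quadrilateral a, a+x, b-y, b. -/
theorem rightProduct_leftProduct (B : MagneticField N) (X Y : Phase N) (f : L2Phase N) :
    rightProduct B (leftProduct B X f) Y = leftProduct B X (rightProduct B f Y) := by
  simp only [rightProduct, leftProduct, LinearIsometryEquiv.apply_symm_apply]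
  congr 1
  let θ : C(Phase N, ℝ) := rightPhase B Y + (leftPhase B X).comp
    ⟨fun p => p + rightShift Y, by fun_prop⟩
  have h1 := phaseShift_phaseShift (θ₁ := rightPhase B Y) (θ₂ := leftPhase B X) (θ := θ)
    (t₁ := rightShift Y) (t₂ := leftShift X) (fun p => rfl) rfl (weylTransform N f)
  have h2 := phaseShift_phaseShift (θ₂ := rightPhase B Y) (θ₁ := leftPhase B X) (θ := θ)
    (t₂ := rightShift Y) (t₁ := leftShift X) (fun p => ?_) (add_comm _ _) (weylTransform N f)
  · rw [h1, h2]
  · simp only [θ, leftPhase, rightPhase, ContinuousMap.add_apply, ContinuousMap.comp_apply,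
      ContinuousMap.coe_mk, kernelLeft_add_leftShift, kernelRight_add_leftShift,
      kernelLeft_add_rightShift, kernelRight_add_rightShift]
    linarith [flux_cocycle B (kernelLeft p) (kernelLeft p + X.1) (kernelRight p - Y.1)
      (kernelRight p)]

/-- The way back crosses the same triangle with the opposite orientation, and the midpoint of the
step is the same, so both parts of the phase cancel. -/
theorem leftProduct_neg (B : MagneticField N) (X : Phase N) (f : L2Phase N) :
    leftProduct B (-X) (leftProduct B X f) = f := by
  simp only [leftProduct, LinearIsometryEquiv.apply_symm_apply]
  rw [phaseShift_phaseShift (θ := 0) (t := 0), phaseShift_zero (fun p => rfl) rfl,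
    LinearIsometryEquiv.symm_apply_apply]
  · intro p
    simp only [leftPhase, ContinuousMap.coe_mk, kernelLeft_add_leftShift, ContinuousMap.zero_apply,
      kernelRight_add_leftShift, Prod.fst_neg, Prod.snd_neg, smul_neg, inner_neg_right,
      neg_add_cancel_right]
    rw [flux_swap B (kernelLeft p)]
    have : kernelLeft p + -X.1 + (2⁻¹ : ℝ) • X.1 = kernelLeft p + -((2⁻¹ : ℝ) • X.1) := by module
    rw [this]
    ring
  · refine Prod.ext ?_ ?_ <;> simp [leftShift]

theorem rightProduct_neg (B : MagneticField N) (Y : Phase N) (f : L2Phase N) :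
    rightProduct B (rightProduct B f Y) (-Y) = f := by
  simp only [rightProduct, LinearIsometryEquiv.apply_symm_apply]
  rw [phaseShift_phaseShift (θ := 0) (t := 0), phaseShift_zero (fun p => rfl) rfl,
    LinearIsometryEquiv.symm_apply_apply]
  · intro p
    simp only [rightPhase, ContinuousMap.coe_mk, kernelLeft_add_rightShift, ContinuousMap.zero_apply,
      kernelRight_add_rightShift, Prod.fst_neg, Prod.snd_neg, smul_neg, inner_neg_right,
      sub_neg_eq_add, add_sub_cancel_right]
    rw [← flux_rotate B (kernelLeft p), flux_reverse B (kernelLeft p)]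
    have : kernelRight p + Y.1 - (2⁻¹ : ℝ) • Y.1 = kernelRight p + (2⁻¹ : ℝ) • Y.1 := by module
    rw [this]
    ring
  · refine Prod.ext ?_ ?_ <;> simp [rightShift]

/-- A unitary has its inverse as adjoint, and the inverse is the product with e_{-X}. -/
theorem inner_leftProduct (B : MagneticField N) (X : Phase N) (f g : L2Phase N) :
    inner ℂ (leftProduct B X f) g = inner ℂ f (leftProduct B (-X) g) := by
  have h := leftProduct_neg B (-X) g
  rw [neg_neg] at h
  conv_lhs => rw [← h]
  simp only [leftProduct, LinearIsometryEquiv.inner_map_map, LinearIsometry.inner_map_map]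

theorem inner_rightProduct (B : MagneticField N) (Y : Phase N) (f g : L2Phase N) :
    inner ℂ (rightProduct B f Y) g = inner ℂ f (rightProduct B g (-Y)) := by
  have h := rightProduct_neg B (-Y) g
  rw [neg_neg] at h
  conv_lhs => rw [← h]
  simp only [rightProduct, LinearIsometryEquiv.inner_map_map, LinearIsometry.inner_map_map]

section Conjugation

theorem coeFn_star_phase (f : L2Phase N) :
    (star f : L2Phase N) =ᵐ[volume] fun p => conj (f p) := Lp.coeFn_star f

theorem measurePreserving_neg_snd : MeasurePreserving (fun p : Phase N => (p.1, -p.2)) :=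
  (MeasurePreserving.id (volume : Measure (Config N))).prod (Measure.measurePreserving_neg volume)

theorem isometry_star_phase : Isometry (star : L2Phase N → L2Phase N) := by
  refine Isometry.of_dist_eq fun f g => ?_
  rw [dist_eq_norm, dist_eq_norm, Lp.norm_def, Lp.norm_def]
  congr 1
  refine eLpNorm_congr_norm_ae ?_
  filter_upwards [Lp.coeFn_sub f g, Lp.coeFn_sub (star f) (star g), coeFn_star_phase f,
    coeFn_star_phase g] with p h1 h2 h3 h4
  rw [h1, h2, Pi.sub_apply, Pi.sub_apply, h3, h4, ← map_sub, RCLike.norm_conj]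

/-- The antiunitary involution `k ↦ conj (k(q, -w))`. -/
def conjReflect (k : L2Phase N) : L2Phase N :=
  star (Lp.compMeasurePreserving _ (measurePreserving_neg_snd (N := N)) k)

theorem continuous_conjReflect : Continuous (conjReflect (N := N)) :=
  isometry_star_phase.continuous.comp
    (Lp.isometry_compMeasurePreserving measurePreserving_neg_snd).continuous

theorem coeFn_conjReflect (k : L2Phase N) :
    conjReflect k =ᵐ[volume] fun p => conj (k (p.1, -p.2)) := by
  filter_upwards [coeFn_star_phase (Lp.compMeasurePreserving _
    (measurePreserving_neg_snd (N := N)) k), Lp.coeFn_compMeasurePreserving k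
    (measurePreserving_neg_snd (N := N))] with p h1 h2
  rw [conjReflect, h1, h2]
  rfl

theorem weylTransform_toLp {φ : Phase N → ℂ} (h : MemLp φ 2 volume)
    (hs : SliceIntegrable (volume : Measure (Config N)) φ) :
    weylTransform N (h.toLp φ) =ᵐ[volume] sliceFourier φ := by
  have : weylTransform N (h.toLp φ) = (memLp_sliceFourier (μ := volume) h hs).toLp
    (sliceFourier φ) := partialFourier_toLp h hs
  rw [this]
  exact MemLp.coeFn_toLp _

theorem weylTransform_symm_toLp {φ : Phase N → ℂ} (h : MemLp φ 2 volume)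
    (hs : SliceIntegrable (volume : Measure (Config N)) φ) :
    (weylTransform N).symm (h.toLp φ) =ᵐ[volume] sliceFourierInv φ := by
  have : (weylTransform N).symm (h.toLp φ) = (memLp_sliceFourierInv (μ := volume) h hs).toLp
    (sliceFourierInv φ) := partialFourier_symm_toLp h hs
  rw [this]
  exact MemLp.coeFn_toLp _

/-- Conjugating a symbol replaces its kernel by the adjoint kernel conj K(b,a): the reflection w ↦
-w exchanges the two points. -/
theorem weylTransform_star (f : L2Phase N) :
    weylTransform N (star f) = conjReflect (weylTransform N f) := by
  refine (denseRange_sliceDomain (V := Config N) (μ := volume)).induction_on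
    (p := fun f : L2Phase N => weylTransform N (star f) = conjReflect (weylTransform N f)) f ?_ ?_
  · exact isClosed_eq ((weylTransform N).continuous.comp isometry_star_phase.continuous)
      (continuous_conjReflect.comp (weylTransform N).continuous)
  · rintro ⟨Φ, hΦ⟩
    have hm : MemLp (Φ : Phase N → ℂ) 2 volume := Lp.memLp Φ
    have hs : SliceIntegrable volume (Φ : Phase N → ℂ) := hΦ
    have h1 := weylTransform_toLp hm hs
    have h2 := weylTransform_toLp (memLp_conj hm) hs.conj
    have e1 : hm.toLp Φ = Φ := Lp.toLp_coeFn Φ hm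
    have e2 : (memLp_conj hm).toLp _ = (star Φ : L2Phase N) := by
      refine Lp.ext ?_
      filter_upwards [(memLp_conj hm).coeFn_toLp, coeFn_star_phase Φ] with p k1 k2
      rw [k1, k2]
    rw [e1] at h1
    rw [e2] at h2
    refine Lp.ext ?_
    simp only [Submodule.subtype_apply]
    filter_upwards [h2, coeFn_conjReflect (weylTransform N Φ),
      measurePreserving_neg_snd.quasiMeasurePreserving.ae h1] with p k1 k2 k3
    rw [k1, k2, k3, ← sliceFourierInv_eq, sliceFourierInv_eq_conj, Complex.conj_conj]

/-- Adjoints reverse products, and the adjoint of e_Y is e_{-Y}. This carries the analysis of the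
left product over to the right one. -/
theorem star_leftProduct_star (B : MagneticField N) (Y : Phase N) (f : L2Phase N) :
    star (leftProduct B (-Y) (star f)) = rightProduct B f Y := by
  refine (weylTransform N).injective ?_
  rw [weylTransform_star, rightProduct, leftProduct, LinearIsometryEquiv.apply_symm_apply,
    LinearIsometryEquiv.apply_symm_apply, weylTransform_star]
  refine Lp.ext ?_
  set k := weylTransform N f
  have h1 := coeFn_conjReflect (phaseShift (leftPhase B (-Y)) (leftShift (-Y)) (conjReflect k))
  have h2 := coeFn_phaseShift (leftPhase B (-Y)) (leftShift (-Y)) (conjReflect k)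
  have h3 := ae_comp_add_right (coeFn_conjReflect k) (leftShift (-Y))
  have h4 := coeFn_phaseShift (rightPhase B Y) (rightShift Y) k
  filter_upwards [h1, measurePreserving_neg_snd.quasiMeasurePreserving.ae h2,
    measurePreserving_neg_snd.quasiMeasurePreserving.ae h3, h4] with p k1 k2 k3 k4
  rw [k1, k2, k4]
  simp only [phaseShiftFun]
  rw [k3, map_mul, conj_exp_neg_I_mul, Complex.conj_conj]
  have ea : kernelLeft (p.1, -p.2) = kernelRight p := by simp [kernelLeft, kernelRight]
  have eb : kernelRight (p.1, -p.2) = kernelLeft p := by simp [kernelLeft, kernelRight]; abel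
  have e1 : -leftPhase B (-Y) (p.1, -p.2) = rightPhase B Y p := by
    simp only [leftPhase, rightPhase, ContinuousMap.coe_mk, ea, eb, Prod.fst_neg, Prod.snd_neg,
      inner_neg_right, smul_neg, ← sub_eq_add_neg]
    rw [flux_reverse B (kernelLeft p)]
    ring
  have e2 : (((p.1, -p.2) + leftShift (-Y)).1, -((p.1, -p.2) + leftShift (-Y)).2) =
      p + rightShift Y := by
    refine Prod.ext ?_ ?_
    · simp [leftShift, rightShift]
    · simp [leftShift, rightShift]
      abel
  rw [e1, e2]

end Conjugation

end KernelOperators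

/-! ### Frequency integrations in the composition law and Gaussian cut-offs. -/

section Composition

variable {N : ℕ}

theorem measurePreserving_prod_prod_comm {α β γ δ : Type*} [MeasureSpace α] [MeasureSpace β]
    [MeasureSpace γ] [MeasureSpace δ] [SFinite (volume : Measure α)] [SFinite (volume : Measure β)]
    [SFinite (volume : Measure γ)] [SFinite (volume : Measure δ)] :
    MeasurePreserving (fun p : (α × β) × (γ × δ) => ((p.1.1, p.2.1), (p.1.2, p.2.2))) := by
  have m1 := volume_preserving_prodAssoc (α₁ := α) (β₁ := β) (γ₁ := γ × δ)
  have m2 := (MeasurePreserving.id (volume : Measure α)).prod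
    (volume_preserving_prodAssoc (α₁ := β) (β₁ := γ) (γ₁ := δ)).symm
  have m3 := (MeasurePreserving.id (volume : Measure α)).prod
    ((Measure.measurePreserving_swap (μ := (volume : Measure β)) (ν := (volume : Measure γ))).prod
      (MeasurePreserving.id (volume : Measure δ)))
  have m4 := (MeasurePreserving.id (volume : Measure α)).prod
    (volume_preserving_prodAssoc (α₁ := γ) (β₁ := β) (γ₁ := δ))
  have m5 := (volume_preserving_prodAssoc (α₁ := α) (β₁ := γ) (γ₁ := β × δ)).symm
  exact m5.comp (m4.comp (m3.comp (m2.comp m1)))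

theorem integral_comp_of_measurePreserving {α β : Type*} [MeasurableSpace α] [MeasurableSpace β]
    {μ : Measure α} {ν : Measure β} {ρ : α → β} (hρ : MeasurePreserving ρ μ ν) {f : β → ℂ}
    (hf : AEStronglyMeasurable f ν) : ∫ x, f (ρ x) ∂μ = ∫ y, f y ∂ν := by
  rw [← hρ.map_eq, integral_map hρ.measurable.aemeasurable (by rwa [hρ.map_eq])]

/-- The exponential `exp(i⟨u, v⟩)`. -/
def planeWave (u v : Config N) : ℂ := Complex.exp (Complex.I * (inner ℝ u v : ℝ))

theorem norm_planeWave (u v : Config N) : ‖planeWave u v‖ = 1 := by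
  rw [planeWave, mul_comm]
  exact Complex.norm_exp_ofReal_mul_I _

theorem continuous_planeWave {α : Type*} [TopologicalSpace α] {u v : α → Config N}
    (hu : Continuous u) (hv : Continuous v) : Continuous fun x => planeWave (u x) (v x) := by
  unfold planeWave; fun_prop

/-- Once positions (y,z) and frequencies (η,ζ) are regrouped, the frequency integrand is a product:
the wave in η depends on z only, and the wave in ζ on y only. Integrability of both factors
justifies Fubini. -/
theorem composition_fubini {E : Phase N → ℂ} (hE : Continuous E) (hE1 : ∀ p, ‖E p‖ ≤ 1)
    {F g : Phase N → ℂ} (hF : Integrable F) (hg : Integrable g) {u v : Config N → Config N}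
    (hu : Continuous u) (hv : Continuous v) :
    Integrable (fun p : Phase N => E p * (∫ η, planeWave (u p.2) η * F (p.1, η)) *
      ∫ ζ, planeWave (v p.1) ζ * g (p.2, ζ)) ∧
    ∫ Y : Phase N, ∫ Z : Phase N, E (Y.1, Z.1) * (planeWave (u Z.1) Y.2 * F Y) *
      (planeWave (v Y.1) Z.2 * g Z) =
      ∫ p : Phase N, E p * (∫ η, planeWave (u p.2) η * F (p.1, η)) *
      ∫ ζ, planeWave (v p.1) ζ * g (p.2, ζ) := by
  let J : Phase N × Phase N → ℂ := fun W => E (W.1.1, W.2.1) *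
    (planeWave (u W.2.1) W.1.2 * F W.1) * (planeWave (v W.1.1) W.2.2 * g W.2)
  have hJ : Integrable J := by
    have h0 : Integrable (fun W : Phase N × Phase N => F W.1 * g W.2) := hF.mul_prod hg
    have h1 : Continuous fun W : Phase N × Phase N =>
        E (W.1.1, W.2.1) * planeWave (u W.2.1) W.1.2 * planeWave (v W.1.1) W.2.2 :=
      ((hE.comp (by fun_prop)).mul (continuous_planeWave (by fun_prop) (by fun_prop))).mul
        (continuous_planeWave (by fun_prop) (by fun_prop))
    have h2 := h0.bdd_mul (c := 1) h1.aestronglyMeasurable (Eventually.of_forall fun W => by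
      rw [norm_mul, norm_mul, norm_planeWave, norm_planeWave, mul_one, mul_one]
      exact hE1 _)
    refine h2.congr (Eventually.of_forall fun W => ?_)
    simp only [J]
    ring
  have hρ := measurePreserving_prod_prod_comm (α := Config N) (β := Config N) (γ := Config N)
    (δ := Config N)
  have hJρ : Integrable (fun p : Phase N × Phase N => J ((p.1.1, p.2.1), (p.1.2, p.2.2))) :=
    hρ.integrable_comp_of_integrable hJ
  have hinner : ∀ p : Phase N, ∫ s : Phase N, J ((p.1, s.1), (p.2, s.2)) =
      E p * (∫ η, planeWave (u p.2) η * F (p.1, η)) * ∫ ζ, planeWave (v p.1) ζ * g (p.2, ζ) := by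
    intro p
    rw [mul_assoc, ← integral_prod_mul (μ := (volume : Measure (Config N)))
      (ν := (volume : Measure (Config N))), ← MeasureTheory.integral_const_mul]
    refine integral_congr_ae (Eventually.of_forall fun s => ?_)
    simp only [J]
    ring
  constructor
  · exact (Integrable.integral_prod_left hJρ).congr (Eventually.of_forall hinner)
  · rw [show (∫ Y : Phase N, ∫ Z : Phase N, E (Y.1, Z.1) * (planeWave (u Z.1) Y.2 * F Y) *
      (planeWave (v Y.1) Z.2 * g Z)) = ∫ Y : Phase N, ∫ Z : Phase N, J (Y, Z) from rfl,
      ← integral_prod _ hJ]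
    refine (integral_comp_of_measurePreserving hρ hJ.aestronglyMeasurable).symm.trans ?_
    refine (integral_prod _ hJρ).trans ?_
    exact integral_congr_ae (Eventually.of_forall hinner)

section Gaussian

theorem integrable_gaussian {b : ℝ} (hb : 0 < b) :
    Integrable fun v : Config N => Real.exp (-(b * ‖v‖ ^ 2)) := by
  have h := (GaussianFourier.integrable_cexp_neg_mul_sq_norm_add (b := (b : ℂ)) (V := Config N)
    (by simpa using hb) 0 0).re
  refine h.congr (Eventually.of_forall fun v => ?_)
  simp only [zero_mul, add_zero]
  rw [show (-(b : ℂ) * (‖v‖ : ℂ) ^ 2) = ((-(b * ‖v‖ ^ 2) : ℝ) : ℂ) by push_cast; ring]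
  exact Complex.exp_ofReal_re _

/-- The Gaussian cut-off on phase space. -/
def cutoff (ε : ℝ) (X : Phase N) : ℝ := Real.exp (-(ε * (‖X.1‖ ^ 2 + ‖X.2‖ ^ 2)))

theorem damp_eq (ε : ℝ) (f : Phase N → ℂ) (X : Phase N) : damp ε f X = (cutoff ε X : ℝ) * f X := rfl

@[fun_prop]
theorem continuous_cutoff (ε : ℝ) : Continuous (cutoff (N := N) ε) := by
  unfold cutoff; fun_prop

theorem cutoff_eq_mul (ε : ℝ) (X : Phase N) :
    cutoff ε X = Real.exp (-(ε * ‖X.1‖ ^ 2)) * Real.exp (-(ε * ‖X.2‖ ^ 2)) := by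
  rw [cutoff, ← Real.exp_add]
  ring_nf

theorem cutoff_pos (ε : ℝ) (X : Phase N) : 0 < cutoff ε X := Real.exp_pos _

theorem cutoff_le_one {ε : ℝ} (hε : 0 ≤ ε) (X : Phase N) : cutoff ε X ≤ 1 := by
  rw [cutoff, Real.exp_le_one_iff]
  have : 0 ≤ ε * (‖X.1‖ ^ 2 + ‖X.2‖ ^ 2) := by positivity
  linarith

theorem integrable_cutoff {ε : ℝ} (hε : 0 < ε) : Integrable (cutoff (N := N) ε) := by
  have := (integrable_gaussian (N := N) hε).mul_prod (integrable_gaussian (N := N) hε)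
  exact this.congr (Eventually.of_forall fun X => (cutoff_eq_mul ε X).symm)

theorem memLp_cutoff {ε : ℝ} (hε : 0 < ε) :
    MemLp (fun X : Phase N => (cutoff ε X : ℂ)) 2 volume := by
  rw [memLp_two_iff_integrable_sq_norm (Continuous.aestronglyMeasurable (by fun_prop))]
  refine (integrable_cutoff (ε := 2 * ε) (by positivity)).congr (Eventually.of_forall fun X => ?_)
  simp only [Complex.norm_real, Real.norm_eq_abs, sq_abs]
  rw [cutoff, cutoff, ← Real.exp_nat_mul]
  congr 1
  push_cast
  ring

theorem integrable_damp {ε : ℝ} (hε : 0 < ε) {f : Phase N → ℂ} (hf : MemLp f 2 volume) :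
    Integrable (damp ε f) :=
  (memLp_cutoff hε).integrable_mul hf

theorem aestronglyMeasurable_damp (ε : ℝ) {f : Phase N → ℂ} (hf : AEStronglyMeasurable f volume) :
    AEStronglyMeasurable (damp ε f) volume :=
  (Continuous.aestronglyMeasurable (f := fun X : Phase N => (cutoff ε X : ℂ)) (by fun_prop)).mul hf

theorem norm_damp_le {ε : ℝ} (hε : 0 ≤ ε) (f : Phase N → ℂ) (X : Phase N) :
    ‖damp ε f X‖ ≤ ‖f X‖ := by
  rw [damp_eq, norm_mul, Complex.norm_real, Real.norm_of_nonneg (cutoff_pos _ _).le]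
  exact mul_le_of_le_one_left (norm_nonneg _) (cutoff_le_one hε X)

theorem memLp_damp {ε : ℝ} (hε : 0 ≤ ε) {f : Phase N → ℂ} (hf : MemLp f 2 volume) :
    MemLp (damp ε f) 2 volume :=
  hf.of_le (aestronglyMeasurable_damp ε hf.1) (Eventually.of_forall (norm_damp_le hε f))

theorem continuous_expSymbol (X : Phase N) : Continuous (expSymbol X) := by
  unfold expSymbol sympl; fun_prop

theorem norm_expSymbol (X Z : Phase N) : ‖expSymbol X Z‖ = 1 := norm_exp_neg_I_mul _

theorem integrable_damp_expSymbol {ε : ℝ} (hε : 0 < ε) (X : Phase N) :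
    Integrable (damp ε (expSymbol X)) := by
  have h := (integrable_cutoff (N := N) hε).ofReal (𝕜 := ℂ)
  exact (h.bdd_mul (c := 1) (continuous_expSymbol X).aestronglyMeasurable
    (Eventually.of_forall fun Z => (norm_expSymbol X Z).le)).congr
    (Eventually.of_forall fun Z => mul_comm _ _)

/-- The probability measure of density `π^{-N/2} exp(-|s|²)`. -/
def gaussMeasure (N : ℕ) : Measure (Config N) :=
  volume.withDensity fun s => ENNReal.ofReal ((Real.pi ^ ((N : ℝ) / 2))⁻¹ * Real.exp (-(1 * ‖s‖ ^ 2)))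

theorem integral_gaussian_one :
    ∫ s : Config N, Real.exp (-(1 * ‖s‖ ^ 2)) = Real.pi ^ ((N : ℝ) / 2) := by
  have := GaussianFourier.integral_rexp_neg_mul_sq_norm (V := Config N) (b := 1) zero_lt_one
  simpa using this

instance isProbabilityMeasure_gaussMeasure : IsProbabilityMeasure (gaussMeasure N) := by
  constructor
  rw [gaussMeasure, withDensity_apply _ MeasurableSet.univ, Measure.restrict_univ,
    ← ofReal_integral_eq_lintegral_ofReal ((integrable_gaussian zero_lt_one).const_mul _)
      (Eventually.of_forall fun s => by positivity), MeasureTheory.integral_const_mul,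
    integral_gaussian_one, inv_mul_cancel₀ (by positivity), ENNReal.ofReal_one]

theorem integral_gaussMeasure (φ : Config N → ℂ) :
    ∫ s, φ s ∂(gaussMeasure N) =
      ((Real.pi ^ ((N : ℝ) / 2))⁻¹ : ℝ) * ∫ s, (Real.exp (-(1 * ‖s‖ ^ 2)) : ℝ) * φ s := by
  rw [gaussMeasure, integral_withDensity_eq_integral_toReal_smul (by fun_prop)
    (Eventually.of_forall fun s => ENNReal.ofReal_lt_top), ← MeasureTheory.integral_const_mul]
  refine integral_congr_ae (Eventually.of_forall fun s => ?_)
  simp only []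
  rw [ENNReal.toReal_ofReal (by positivity), Complex.real_smul]
  push_cast
  ring

/-- As ε tends to 0 this is an approximate delta function at u = -X.1, of width of order √ε: the
smoothed version of the delta kernel of e_X. -/
theorem fourier_damp_expSymbol {ε : ℝ} (hε : 0 < ε) (X : Phase N) (u y : Config N) :
    ∫ η, planeWave u η * damp ε (expSymbol X) (y, η) =
      Complex.exp (-(Complex.I * (inner ℝ y X.2 : ℝ))) * (Real.exp (-(ε * ‖y‖ ^ 2)) : ℝ) *
      ((Real.pi / ε) ^ ((N : ℝ) / 2) : ℝ) * (Real.exp (-(‖u + X.1‖ ^ 2 / (4 * ε))) : ℝ) := by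
  have h := GaussianFourier.integral_cexp_neg_mul_sq_norm_add (b := (ε : ℂ)) (V := Config N)
    (by simpa using hε) Complex.I (u + X.1)
  have e : ∀ η, planeWave u η * damp ε (expSymbol X) (y, η) =
      Complex.exp (-(Complex.I * (inner ℝ y X.2 : ℝ))) * (Real.exp (-(ε * ‖y‖ ^ 2)) : ℝ) *
      Complex.exp (-(ε : ℂ) * (‖η‖ : ℂ) ^ 2 + Complex.I * ((inner ℝ (u + X.1) η : ℝ) : ℂ)) := by
    intro η
    simp only [planeWave, damp, expSymbol, sympl, inner_add_left, Complex.ofReal_exp,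
      ← Complex.exp_add]
    congr 1
    push_cast
    ring
  simp only [e]
  rw [MeasureTheory.integral_const_mul, h]
  simp only [finrank_euclideanSpace, Fintype.card_fin]
  rw [Complex.ofReal_cpow (by positivity)]
  push_cast
  rw [mul_assoc, mul_assoc, mul_assoc]
  congr 4
  rw [Complex.I_sq]
  field_simp

end Gaussian

end Composition

/-! ### The damped product as a Gaussian average of phase shifts. -/

section DampedProduct

open FourierTransform

variable {N : ℕ}

/-- The direction `(r, -r/π)` in which the kernel of a damped exponential spreads. -/
def shiftDir (r : Config N) : Phase N := (r, -(Real.pi⁻¹ • r))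

/-- The phase of the damped exponential at distance `r` from the diagonal. -/
def approxPhase (B : MagneticField N) (X : Phase N) (r : Config N) (p : Phase N) : ℝ :=
  flux B (kernelLeft p) (kernelLeft p + X.1 + (2 : ℝ) • r) (kernelRight p) +
    inner ℝ (kernelLeft p + (2⁻¹ : ℝ) • X.1 + r) X.2

/-- The integrand of the partial Fourier transform of the damped product. -/
def dampedIntegrand (B : MagneticField N) (X : Phase N) (ε : ℝ) (κ : Phase N → ℂ)
    (s : Config N) (p : Phase N) : ℂ :=
  Complex.exp (-(Complex.I * (approxPhase B X (√ε • s) p : ℝ))) *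
    (Real.exp (-(ε * ‖kernelLeft p + (2⁻¹ : ℝ) • X.1 + √ε • s‖ ^ 2)) : ℝ) *
    κ (p + (leftShift X + shiftDir (√ε • s)))

/-- The partial Fourier transform of the damped product. -/
def dampedKernel (B : MagneticField N) (X : Phase N) (ε : ℝ) (f : Phase N → ℂ) (p : Phase N) : ℂ :=
  ∫ s, dampedIntegrand B X ε (sliceFourier (damp ε f)) s p ∂(gaussMeasure N)

/-- The coordinates v = z - y and z are used, since v is the variable conjugate to the momentum of
the product. -/
theorem measurePreserving_sub_shear :
    MeasurePreserving (fun p : Phase N => (p.2 - p.1, p.2)) := by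
  have h : MeasurePreserving (fun p : Config N × Config N => (p.1, p.1 - p.2))
      (volume.prod volume) (volume.prod volume) := by
    refine MeasurePreserving.skew_product (g := fun z v => z - v) (MeasurePreserving.id _)
      (measurable_fst.sub measurable_snd) (Eventually.of_forall fun z => ?_)
    exact (Measure.measurePreserving_sub_left volume z).map_eq
  exact (Measure.measurePreserving_swap.comp h).comp Measure.measurePreserving_swap

theorem integral_planeWave_eq_sliceFourier (g : Phase N → ℂ) (u z : Config N) :
    ∫ ζ, planeWave u ζ * g (z, ζ) = sliceFourier g (z, -((2 * Real.pi)⁻¹ • u)) := by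
  rw [sliceFourier, Real.fourier_eq']
  refine integral_congr_ae (Eventually.of_forall fun ζ => ?_)
  simp only [planeWave, smul_eq_mul, inner_neg_right, inner_smul_right]
  congr 2
  rw [real_inner_comm]
  push_cast
  have : (Real.pi : ℂ) ≠ 0 := by exact_mod_cast Real.pi_ne_zero
  field_simp

/-- The amplitude left after the frequency integrations. -/
def fluxAmplitude (B : MagneticField N) (q : Config N) (p : Phase N) : ℂ :=
  Complex.exp (-(Complex.I * (flux B (q - p.1 + p.2) (p.1 - p.2 + q) (p.2 - q + p.1) : ℝ)))

/-- The integrand in the configuration variables after the frequency integrations. -/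
def reducedIntegrand (B : MagneticField N) (X : Phase N) (ε : ℝ) (f : Phase N → ℂ) (q : Config N)
    (p : Phase N) : ℂ :=
  fluxAmplitude B q p *
    (∫ η, planeWave ((2 : ℝ) • (q - p.2)) η * damp ε (expSymbol X) (p.1, η)) *
    ∫ ζ, planeWave ((2 : ℝ) • (p.1 - q)) ζ * damp ε f (p.2, ζ)

theorem continuous_fluxAmplitude (B : MagneticField N) (q : Config N) :
    Continuous (fluxAmplitude B q) := by
  have := continuous_flux_comp B (a := fun p : Phase N => q - p.1 + p.2)
    (b := fun p : Phase N => p.1 - p.2 + q) (c := fun p : Phase N => p.2 - q + p.1)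
    (by fun_prop) (by fun_prop) (by fun_prop)
  unfold fluxAmplitude
  fun_prop

/-- The output momentum p enters only through the wave with exponent 2(z-y)·p. The Fubini lemma is
used with this wave in the amplitude for the formula, and without it for integrability. -/
theorem compositionIntegral_damp_eq (B : MagneticField N) (X : Phase N) {ε : ℝ} (hε : 0 < ε)
    {f : Phase N → ℂ} (hf : MemLp f 2 volume) (q : Config N) :
    Integrable (reducedIntegrand B X ε f q) ∧ ∀ p : Config N,
      compositionIntegral B (damp ε (expSymbol X)) (damp ε f) (q, p) =
        ((Real.pi ^ (2 * N))⁻¹ : ℝ) * ∫ W : Phase N, planeWave ((2 : ℝ) • (W.2 - W.1)) p *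
          reducedIntegrand B X ε f q W := by
  have key := fun (E : Phase N → ℂ) hE hE1 => composition_fubini (E := E) hE hE1
    (integrable_damp_expSymbol hε X) (integrable_damp hε hf)
    (u := fun z => (2 : ℝ) • (q - z)) (v := fun y => (2 : ℝ) • (y - q))
    (by fun_prop) (by fun_prop)
  have hamp := continuous_fluxAmplitude B q
  have hamp1 : ∀ p, ‖fluxAmplitude B q p‖ = 1 := fun p => norm_exp_neg_I_mul _
  refine ⟨(key (fluxAmplitude B q) hamp fun p => (hamp1 p).le).1, fun p => ?_⟩
  have h2 := (key (fun W => planeWave ((2 : ℝ) • (W.2 - W.1)) p * fluxAmplitude B q W)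
    ((continuous_planeWave (by fun_prop) (by fun_prop)).mul hamp) fun W => by
      rw [norm_mul, norm_planeWave, hamp1, one_mul]).2
  rw [compositionIntegral]
  congr 1
  refine Eq.trans ?_ (h2.trans ?_)
  · refine integral_congr_ae (Eventually.of_forall fun Y => ?_)
    refine integral_congr_ae (Eventually.of_forall fun Z => ?_)
    have e : Complex.exp (-(2 * Complex.I * (sympl ((q, p) - Y) ((q, p) - Z) : ℝ))) =
        planeWave ((2 : ℝ) • (Z.1 - Y.1)) p * planeWave ((2 : ℝ) • (q - Z.1)) Y.2 *
          planeWave ((2 : ℝ) • (Y.1 - q)) Z.2 := by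
      simp only [planeWave, ← Complex.exp_add]
      congr 1
      simp only [sympl, Prod.fst_sub, Prod.snd_sub, inner_sub_left, inner_sub_right,
        inner_smul_left, RCLike.conj_to_real]
      push_cast
      ring
    simp only [e, fluxAmplitude]
    ring
  · refine integral_congr_ae (Eventually.of_forall fun W => ?_)
    simp only [reducedIntegrand]
    ring

/-- The Gaussian produced by the damped exponential is centred at z = q + x/2, so z is written as
this centre plus √ε s, which makes the Gaussian exp(-|s|²). The vertices of the flux triangle become
a, a + x + 2√ε s and b. -/
theorem reducedIntegrand_shear_eq (B : MagneticField N) (X : Phase N) {ε : ℝ} (hε : 0 < ε)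
    (f : Phase N → ℂ) (q w s : Config N) :
    reducedIntegrand B X ε f q ((2⁻¹ : ℝ) • X.1 + q + √ε • s - Real.pi • w,
      (2⁻¹ : ℝ) • X.1 + q + √ε • s) =
    ((Real.pi / ε) ^ ((N : ℝ) / 2) : ℝ) * ((Real.exp (-(1 * ‖s‖ ^ 2)) : ℝ) *
      dampedIntegrand B X ε (sliceFourier (damp ε f)) s (q, w)) := by
  set r := √ε • s with hr
  have hpi := Real.pi_ne_zero
  rw [reducedIntegrand, fourier_damp_expSymbol hε, integral_planeWave_eq_sliceFourier]
  have e1 : fluxAmplitude B q ((2⁻¹ : ℝ) • X.1 + q + r - Real.pi • w, (2⁻¹ : ℝ) • X.1 + q + r) =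
      Complex.exp (-(Complex.I * (flux B (kernelLeft (q, w)) (kernelLeft (q, w) + X.1 + (2 : ℝ) • r)
        (kernelRight (q, w)) : ℝ))) := by
    have p1 : q - ((2⁻¹ : ℝ) • X.1 + q + r - Real.pi • w) + ((2⁻¹ : ℝ) • X.1 + q + r) =
        kernelRight (q, w) := by simp only [kernelRight]; module
    have p2 : (2⁻¹ : ℝ) • X.1 + q + r - Real.pi • w - ((2⁻¹ : ℝ) • X.1 + q + r) + q =
        kernelLeft (q, w) := by simp only [kernelLeft]; module
    have p3 : (2⁻¹ : ℝ) • X.1 + q + r - q + ((2⁻¹ : ℝ) • X.1 + q + r - Real.pi • w) =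
        kernelLeft (q, w) + X.1 + (2 : ℝ) • r := by simp only [kernelLeft]; module
    simp only [fluxAmplitude, p1, p2, p3]
    rw [flux_rotate B (kernelRight (q, w))]
  have e2 : (2⁻¹ : ℝ) • X.1 + q + r - Real.pi • w = kernelLeft (q, w) + (2⁻¹ : ℝ) • X.1 + r := by
    simp only [kernelLeft]; module
  have e3 : ‖(2 : ℝ) • (q - ((2⁻¹ : ℝ) • X.1 + q + r)) + X.1‖ ^ 2 / (4 * ε) = 1 * ‖s‖ ^ 2 := by
    have : (2 : ℝ) • (q - ((2⁻¹ : ℝ) • X.1 + q + r)) + X.1 = -((2 * √ε) • s) := by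
      rw [hr]; module
    rw [this, norm_neg, norm_smul, Real.norm_of_nonneg (by positivity), mul_pow, mul_pow,
      Real.sq_sqrt hε.le]
    field_simp
    ring
  have e4 : (((2⁻¹ : ℝ) • X.1 + q + r,
      -((2 * Real.pi)⁻¹ • (2 : ℝ) • ((2⁻¹ : ℝ) • X.1 + q + r - Real.pi • w - q))) : Phase N) =
      (q, w) + (leftShift X + shiftDir r) := by
    refine Prod.ext ?_ ?_
    · simp only [leftShift, shiftDir, Prod.fst_add]
      module
    · simp only [leftShift, shiftDir, Prod.snd_add]
      match_scalars <;> field_simp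
      ring
  simp only [e3, e4]
  rw [e1, e2, dampedIntegrand, approxPhase]
  have e5 : ∀ x y : ℝ, Complex.exp (-(Complex.I * ((x + y : ℝ) : ℂ))) =
      Complex.exp (-(Complex.I * (x : ℂ))) * Complex.exp (-(Complex.I * (y : ℂ))) := by
    intro x y
    rw [← Complex.exp_add]
    congr 1
    push_cast
    ring
  rw [e5]
  ring

/-- The Jacobian ε^{N/2} of z ↦ s cancels the ε in (π/ε)^{N/2}. The remaining powers of π combine to
π^{-N/2}, the normalization of `gaussMeasure`. -/
theorem dampedKernel_eq (B : MagneticField N) (X : Phase N) {ε : ℝ} (hε : 0 < ε)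
    (f : Phase N → ℂ) (q w : Config N) :
    dampedKernel B X ε f (q, w) = ((Real.pi ^ (2 * N))⁻¹ * Real.pi ^ N : ℝ) *
      ∫ z, reducedIntegrand B X ε f q (z - Real.pi • w, z) := by
  have h1 : ∫ z, reducedIntegrand B X ε f q (z - Real.pi • w, z) =
      ∫ r, reducedIntegrand B X ε f q ((2⁻¹ : ℝ) • X.1 + q + r - Real.pi • w,
        (2⁻¹ : ℝ) • X.1 + q + r) :=
    (integral_add_left_eq_self (fun z => reducedIntegrand B X ε f q (z - Real.pi • w, z)) _).symm
  have h2 := Measure.integral_comp_smul (volume : Measure (Config N))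
    (fun r => reducedIntegrand B X ε f q ((2⁻¹ : ℝ) • X.1 + q + r - Real.pi • w,
        (2⁻¹ : ℝ) • X.1 + q + r)) √ε
  simp only [reducedIntegrand_shear_eq B X hε, MeasureTheory.integral_const_mul] at h2
  rw [dampedKernel, integral_gaussMeasure, h1]
  have hsε : 0 < √ε := Real.sqrt_pos.2 hε
  rw [finrank_euclideanSpace, Fintype.card_fin, abs_of_nonneg (by positivity),
    Complex.real_smul] at h2
  have hc : (((√ε ^ N)⁻¹ : ℝ) : ℂ) ≠ 0 := by
    exact_mod_cast (by positivity : (√ε ^ N)⁻¹ ≠ 0)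
  rw [← mul_right_inj' hc, mul_left_comm _ _ (∫ r, reducedIntegrand B X ε f q _), ← h2, ← mul_assoc,
    ← mul_assoc]
  congr 1
  rw [← Complex.ofReal_mul, ← Complex.ofReal_mul]
  congr 1
  have hpε : ε ^ ((N : ℝ) / 2) = √ε ^ N := by
    rw [Real.sqrt_eq_rpow, ← Real.rpow_natCast, ← Real.rpow_mul hε.le]
    congr 1
    ring
  have hpp : Real.pi ^ N = Real.pi ^ ((N : ℝ) / 2) * Real.pi ^ ((N : ℝ) / 2) := by
    rw [← Real.rpow_add Real.pi_pos, add_halves, Real.rpow_natCast]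
  rw [Real.div_rpow Real.pi_pos.le hε.le, hpε, two_mul, pow_add]
  have : Real.pi ^ ((N : ℝ) / 2) ≠ 0 := by positivity
  rw [hpp]
  field_simp

theorem integrable_reducedIntegrand_shear (B : MagneticField N) (X : Phase N) {ε : ℝ} (hε : 0 < ε)
    {f : Phase N → ℂ} (hf : MemLp f 2 volume) (q : Config N) :
    Integrable fun p : Phase N => reducedIntegrand B X ε f q (p.2 - p.1, p.2) :=
  measurePreserving_sub_shear.integrable_comp_of_integrable
    (compositionIntegral_damp_eq B X hε hf q).1

theorem integrable_dampedKernel (B : MagneticField N) (X : Phase N) {ε : ℝ} (hε : 0 < ε)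
    {f : Phase N → ℂ} (hf : MemLp f 2 volume) (q : Config N) :
    Integrable fun w => dampedKernel B X ε f (q, w) := by
  have h := (integrable_reducedIntegrand_shear B X hε hf q).integral_prod_left.comp_smul
    Real.pi_ne_zero
  simp only [dampedKernel_eq B X hε f]
  exact h.const_mul _

/-- Setting z - y = πw turns exp(2i(z-y)·p) into the character exp(2πi w·p) of the inverse transform
and contributes the factor π^N. -/
theorem compositionIntegral_damp_eq_sliceFourierInv (B : MagneticField N) (X : Phase N) {ε : ℝ}
    (hε : 0 < ε) {f : Phase N → ℂ} (hf : MemLp f 2 volume) (X₀ : Phase N) :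
    compositionIntegral B (damp ε (expSymbol X)) (damp ε f) X₀ =
      sliceFourierInv (dampedKernel B X ε f) X₀ := by
  obtain ⟨q, p⟩ := X₀
  obtain ⟨hint, heq⟩ := compositionIntegral_damp_eq B X hε hf q
  have hpw : Integrable fun W : Phase N => planeWave ((2 : ℝ) • (W.2 - W.1)) p *
      reducedIntegrand B X ε f q W :=
    hint.bdd_mul (c := 1) (continuous_planeWave (by fun_prop) (by fun_prop)).aestronglyMeasurable
      (Eventually.of_forall fun W => (norm_planeWave _ _).le)
  rw [heq p, ← integral_comp_of_measurePreserving measurePreserving_sub_shear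
    hpw.aestronglyMeasurable]
  have hpw' := measurePreserving_sub_shear.integrable_comp_of_integrable hpw
  have h1 := integral_prod (μ := (volume : Measure (Config N))) (ν := (volume : Measure (Config N)))
    _ hpw'
  refine (congrArg _ h1).trans ?_
  simp only [Function.comp_apply, sub_sub_cancel, MeasureTheory.integral_const_mul]
  have h2 := Measure.integral_comp_smul (volume : Measure (Config N))
    (fun v => planeWave ((2 : ℝ) • v) p * ∫ z, reducedIntegrand B X ε f q (z - v, z)) Real.pi
  rw [finrank_euclideanSpace, Fintype.card_fin, abs_of_nonneg (by positivity),
    Complex.real_smul] at h2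
  have h3 : ∫ v, planeWave ((2 : ℝ) • v) p * ∫ z, reducedIntegrand B X ε f q (z - v, z) =
      ((Real.pi ^ N : ℝ) : ℂ) * ∫ w, planeWave ((2 : ℝ) • (Real.pi • w)) p *
        ∫ z, reducedIntegrand B X ε f q (z - Real.pi • w, z) := by
    rw [h2, ← mul_assoc, ← Complex.ofReal_mul, mul_inv_cancel₀ (by positivity), Complex.ofReal_one,
      one_mul]
  rw [h3, sliceFourierInv, Real.fourierInv_eq']
  simp only [dampedKernel_eq B X hε f]
  rw [← mul_assoc, ← Complex.ofReal_mul, ← MeasureTheory.integral_const_mul]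
  refine integral_congr_ae (Eventually.of_forall fun w => ?_)
  simp only [planeWave, inner_smul_left, RCLike.conj_to_real, smul_eq_mul]
  have : Complex.exp (Complex.I * ((2 * (Real.pi * inner ℝ w p) : ℝ) : ℂ)) =
      Complex.exp (((2 * Real.pi * inner ℝ w p : ℝ) : ℂ) * Complex.I) := by
    congr 1
    push_cast
    ring
  rw [this]
  ring

end DampedProduct

/-! ### Mean-square convergence of weighted translates and of averages. -/

section MeanSquare

open scoped ENNReal

variable {N : ℕ}

section Convergence

variable {ι : Type*} {l : Filter ι}

theorem tendsto_zero_of_sq_tendsto_zero {x : ι → ℝ≥0∞} (h : Tendsto (fun i => x i ^ 2) l (𝓝 0)) :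
    Tendsto x l (𝓝 0) := by
  have h2 := (ENNReal.continuous_rpow_const (y := (2⁻¹ : ℝ))).tendsto 0 |>.comp h
  rw [ENNReal.zero_rpow_of_pos (by norm_num)] at h2
  refine h2.congr fun i => ?_
  simp only [Function.comp_apply]
  rw [← ENNReal.rpow_natCast, ← ENNReal.rpow_mul]
  norm_num

theorem tendsto_eLpNorm_translate {k : Phase N → ℂ} (hk : MemLp k 2 volume) {t : ι → Phase N}
    {t₀ : Phase N} (ht : Tendsto t l (𝓝 t₀)) :
    Tendsto (fun i => eLpNorm (fun p => k (p + t i) - k (p + t₀)) 2 volume) l (𝓝 0) := by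
  let g : Phase N → C(Phase N, Phase N) := fun t => ⟨fun p => p + t, by fun_prop⟩
  have hg : Continuous g := ContinuousMap.continuous_of_continuous_uncurry _
    (by unfold Function.uncurry; simp only [g, ContinuousMap.coe_mk]; fun_prop)
  have h := Filter.Tendsto.compMeasurePreservingLp (p := 2) (tendsto_const_nhds (x := hk.toLp k))
    ((hg.tendsto t₀).comp ht) (fun i => measurePreserving_add_right_phase (t i))
    (measurePreserving_add_right_phase t₀) (by norm_num)
  rw [Lp.tendsto_Lp_iff_tendsto_eLpNorm'] at h
  refine h.congr fun i => eLpNorm_congr_ae ?_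
  have e : ∀ s, (Lp.compMeasurePreserving (fun p : Phase N => p + s)
      (measurePreserving_add_right_phase s) (hk.toLp k) : Phase N → ℂ) =ᵐ[volume]
      fun p => k (p + s) := fun s =>
    (Lp.coeFn_compMeasurePreserving _ _).trans (ae_comp_add_right hk.coeFn_toLp s)
  exact (e (t i)).sub (e t₀)

theorem tendsto_eLpNorm_mul_sub [l.IsCountablyGenerated] {α : Type*} [MeasurableSpace α]
    {μ : Measure α} {k : α → ℂ} (hk : MemLp k 2 μ) {u : ι → α → ℂ} {v : α → ℂ}
    (hu : ∀ᶠ i in l, AEStronglyMeasurable (u i) μ) (hv : AEStronglyMeasurable v μ)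
    (hu1 : ∀ᶠ i in l, ∀ p, ‖u i p‖ ≤ 1) (hv1 : ∀ p, ‖v p‖ ≤ 1)
    (huv : ∀ p, Tendsto (fun i => u i p) l (𝓝 (v p))) :
    Tendsto (fun i => eLpNorm (fun p => u i p * k p - v p * k p) 2 μ) l (𝓝 0) := by
  refine tendsto_zero_of_sq_tendsto_zero ?_
  simp only [eLpNorm_two_sq]
  have h := tendsto_lintegral_filter_of_dominated_convergence' (μ := μ) (l := l)
    (F := fun i p => ‖u i p * k p - v p * k p‖ₑ ^ 2) (f := fun _ => 0)
    (fun p => 4 * ‖k p‖ₑ ^ 2) ?_ ?_ ?_ ?_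
  · simpa using h
  · filter_upwards [hu] with i hi
    exact ((hi.mul hk.1).sub (hv.mul hk.1)).enorm.pow_const 2
  · filter_upwards [hu1] with i hi
    refine Eventually.of_forall fun p => ?_
    have : ‖u i p * k p - v p * k p‖ₑ ≤ 2 * ‖k p‖ₑ := by
      rw [← sub_mul, enorm_mul]
      gcongr
      rw [← ofReal_norm, ← ENNReal.ofReal_ofNat 2]
      refine ENNReal.ofReal_le_ofReal ((norm_sub_le _ _).trans ?_)
      linarith [hi p, hv1 p]
    calc ‖u i p * k p - v p * k p‖ₑ ^ 2 ≤ (2 * ‖k p‖ₑ) ^ 2 := by gcongr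
      _ = 4 * ‖k p‖ₑ ^ 2 := by rw [mul_pow]; norm_num
  · rw [lintegral_const_mul' _ _ (by norm_num), ← eLpNorm_two_sq]
    exact ENNReal.mul_ne_top (by norm_num) (ENNReal.pow_ne_top hk.2.ne)
  · refine Eventually.of_forall fun p => ?_
    have h1 : Tendsto (fun i => u i p * k p - v p * k p) l (𝓝 (v p * k p - v p * k p)) :=
      ((huv p).mul_const _).sub_const _
    rw [sub_self] at h1
    have h2 := h1.enorm
    have h3 := (ENNReal.continuous_pow 2).tendsto 0
    rw [enorm_zero] at h2
    simpa using! h3.comp h2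

theorem eLpNorm_mul_comp_add_le {u : Phase N → ℂ} (hu1 : ∀ p, ‖u p‖ ≤ 1) {k : Phase N → ℂ}
    (hk : AEStronglyMeasurable k volume) (t : Phase N) :
    eLpNorm (fun p => u p * k (p + t)) 2 volume ≤ eLpNorm k 2 volume := by
  rw [← eLpNorm_comp_measurePreserving hk (measurePreserving_add_right_phase t)]
  refine eLpNorm_mono fun p => ?_
  rw [norm_mul]
  exact mul_le_of_le_one_left (norm_nonneg _) (hu1 p)

/-- The error splits into three: replacing κ by k, replacing t by t₀ (continuity of translations in
L²), and replacing u by v (dominated convergence). The weights are bounded by 1, so they do not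
amplify the first two. -/
theorem tendsto_eLpNorm_mul_translate [l.IsCountablyGenerated] {u : ι → Phase N → ℂ}
    {v : Phase N → ℂ} (hu : ∀ᶠ i in l, AEStronglyMeasurable (u i) volume)
    (hv : AEStronglyMeasurable v volume)
    (hu1 : ∀ᶠ i in l, ∀ p, ‖u i p‖ ≤ 1) (hv1 : ∀ p, ‖v p‖ ≤ 1)
    (huv : ∀ p, Tendsto (fun i => u i p) l (𝓝 (v p))) {t : ι → Phase N} {t₀ : Phase N}
    (ht : Tendsto t l (𝓝 t₀)) {κ : ι → Phase N → ℂ} {k : Phase N → ℂ}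
    (hκ : ∀ᶠ i in l, AEStronglyMeasurable (κ i) volume) (hk : MemLp k 2 volume)
    (hκk : Tendsto (fun i => eLpNorm (fun p => κ i p - k p) 2 volume) l (𝓝 0)) :
    Tendsto (fun i => eLpNorm (fun p => u i p * κ i (p + t i) - v p * k (p + t₀)) 2 volume) l
      (𝓝 0) := by
  have hadd := measurePreserving_add_right_phase (N := N)
  have h1 := tendsto_eLpNorm_translate hk ht
  have hk0 : MemLp (fun p => k (p + t₀)) 2 volume := hk.comp_measurePreserving (hadd t₀)
  have h2 := tendsto_eLpNorm_mul_sub hk0 hu hv hu1 hv1 huv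
  have h3 := (hκk.add h1).add h2
  rw [add_zero, add_zero] at h3
  refine tendsto_of_tendsto_of_tendsto_of_le_of_le' tendsto_const_nhds h3
    (Eventually.of_forall fun _ => zero_le) ?_
  filter_upwards [hu, hu1, hκ] with i hui hui1 hκi
  have m1 : AEStronglyMeasurable (fun p => κ i p - k p) volume := hκi.sub hk.1
  have m2 : ∀ s, AEStronglyMeasurable (fun p => k (p + s)) volume := fun s =>
    hk.1.comp_measurePreserving (hadd s)
  have a1 : AEStronglyMeasurable (fun p => u i p * (κ i (p + t i) - k (p + t i))) volume :=
    hui.mul (m1.comp_measurePreserving (hadd (t i)))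
  have a2 : AEStronglyMeasurable (fun p => u i p * (k (p + t i) - k (p + t₀))) volume :=
    hui.mul ((m2 _).sub (m2 _))
  have a3 : AEStronglyMeasurable (fun p => u i p * k (p + t₀) - v p * k (p + t₀)) volume :=
    (hui.mul (m2 _)).sub (hv.mul (m2 _))
  have e : (fun p => u i p * κ i (p + t i) - v p * k (p + t₀)) =
      (fun p => u i p * (κ i (p + t i) - k (p + t i))) +
      (fun p => u i p * (k (p + t i) - k (p + t₀))) +
      (fun p => u i p * k (p + t₀) - v p * k (p + t₀)) := by
    funext p
    simp only [Pi.add_apply]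
    ring
  rw [e]
  refine (eLpNorm_add_le (a1.add a2) a3 (by norm_num)).trans ?_
  gcongr
  refine (eLpNorm_add_le a1 a2 (by norm_num)).trans ?_
  gcongr
  · exact eLpNorm_mul_comp_add_le (k := fun p => κ i p - k p) hui1 m1 (t i)
  · refine eLpNorm_mono fun p => ?_
    rw [norm_mul]
    exact mul_le_of_le_one_left (norm_nonneg _) (hui1 p)

end Convergence

section Averages

variable {S P : Type*} [MeasurableSpace S] [MeasurableSpace P] {γ : Measure S}
  [IsProbabilityMeasure γ] {μ : Measure P} [SFinite μ]

/-- Cauchy-Schwarz for a probability measure, then Tonelli. -/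
theorem lintegral_enorm_integral_sq_le {F : S × P → ℂ} (hF : AEStronglyMeasurable F (γ.prod μ)) :
    ∫⁻ p, ‖∫ s, F (s, p) ∂γ‖ₑ ^ 2 ∂μ ≤ ∫⁻ s, ∫⁻ p, ‖F (s, p)‖ₑ ^ 2 ∂μ ∂γ := by
  rw [lintegral_lintegral_swap (f := fun s p => ‖F (s, p)‖ₑ ^ 2) (hF.enorm.pow_const 2)]
  refine lintegral_mono_ae ?_
  filter_upwards [hF.prod_swap.prodMk_left] with p hp
  have hp' : AEStronglyMeasurable (fun s => F (s, p)) γ := hp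
  calc ‖∫ s, F (s, p) ∂γ‖ₑ ^ 2 ≤ (eLpNorm (fun s => F (s, p)) 1 γ) ^ 2 := by
        gcongr
        rw [eLpNorm_one_eq_lintegral_enorm]
        exact enorm_integral_le_lintegral_enorm _
    _ ≤ (eLpNorm (fun s => F (s, p)) 2 γ) ^ 2 := by
        gcongr
        exact eLpNorm_le_eLpNorm_of_exponent_le (by norm_num) hp'
    _ = _ := eLpNorm_two_sq _

theorem ae_integrable_of_lintegral_sq_lt_top {F : S × P → ℂ}
    (hF : AEStronglyMeasurable F (γ.prod μ))
    (hfin : ∫⁻ s, ∫⁻ p, ‖F (s, p)‖ₑ ^ 2 ∂μ ∂γ < ⊤) :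
    ∀ᵐ p ∂μ, Integrable (fun s => F (s, p)) γ := by
  have hm : AEMeasurable (fun x : S × P => ‖F x‖ₑ ^ 2) (γ.prod μ) := hF.enorm.pow_const 2
  rw [lintegral_lintegral_swap (f := fun s p => ‖F (s, p)‖ₑ ^ 2) hm] at hfin
  filter_upwards [hF.prod_swap.prodMk_left, ae_lt_top' hm.lintegral_prod_left' hfin.ne] with p hp h2
  have hp' : AEStronglyMeasurable (fun s => F (s, p)) γ := hp
  have : MemLp (fun s => F (s, p)) 2 γ := by
    refine ⟨hp', ?_⟩
    rw [← eLpNorm_two_sq] at h2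
    by_contra h
    rw [not_lt, top_le_iff] at h
    rw [h] at h2
    simp at h2
  exact this.integrable (by norm_num)

end Averages

/-- Gives joint measurability of (s,p) ↦ κ(p + g(s)) when κ is only almost everywhere strongly
measurable: null sets must pull back to null sets. -/
theorem measurePreserving_add_comp {S : Type*} [MeasurableSpace S] {γ : Measure S}
    [IsProbabilityMeasure γ] {g : S → Phase N} (hg : Measurable g) :
    MeasurePreserving (fun x : S × Phase N => x.2 + g x.1) (γ.prod volume) volume := by
  have h := MeasurePreserving.skew_product (μa := γ) (μc := (volume : Measure (Phase N)))
    (μd := (volume : Measure (Phase N))) (g := fun s p => p + g s) (MeasurePreserving.id γ)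
    (measurable_snd.add (hg.comp measurable_fst))
    (Eventually.of_forall fun s => (measurePreserving_add_right_phase (g s)).map_eq)
  exact measurePreserving_snd.comp h

end MeanSquare

/-! ### The left product is the limit of the damped products. -/

section LeftProduct

open scoped ENNReal

variable {N : ℕ}

/-- The bounded factor of `dampedIntegrand`. -/
def dampedWeight (B : MagneticField N) (X : Phase N) (ε : ℝ) (s : Config N) (p : Phase N) : ℂ :=
  Complex.exp (-(Complex.I * (approxPhase B X (√ε • s) p : ℝ))) *
    (Real.exp (-(ε * ‖kernelLeft p + (2⁻¹ : ℝ) • X.1 + √ε • s‖ ^ 2)) : ℝ)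

theorem continuous_approxPhase (B : MagneticField N) (X : Phase N) {α : Type*} [TopologicalSpace α]
    {r : α → Config N} {p : α → Phase N} (hr : Continuous r) (hp : Continuous p) :
    Continuous fun x => approxPhase B X (r x) (p x) := by
  unfold approxPhase
  refine Continuous.add (continuous_flux_comp B ?_ ?_ ?_) ?_ <;> fun_prop

theorem approxPhase_zero (B : MagneticField N) (X p : Phase N) :
    approxPhase B X 0 p = leftPhase B X p := by
  simp [approxPhase, leftPhase]

theorem continuous_dampedWeight (B : MagneticField N) (X : Phase N) {α : Type*}
    [TopologicalSpace α] {ε : α → ℝ} {s : α → Config N} {p : α → Phase N} (hε : Continuous ε)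
    (hs : Continuous s) (hp : Continuous p) :
    Continuous fun x => dampedWeight B X (ε x) (s x) (p x) := by
  have h := continuous_approxPhase B X (r := fun x => √(ε x) • s x) (p := p) (by fun_prop) hp
  unfold dampedWeight
  fun_prop

theorem norm_dampedWeight_le (B : MagneticField N) (X : Phase N) {ε : ℝ} (hε : 0 ≤ ε)
    (s : Config N) (p : Phase N) : ‖dampedWeight B X ε s p‖ ≤ 1 := by
  rw [dampedWeight, norm_mul, norm_exp_neg_I_mul, one_mul, Complex.norm_real,
    Real.norm_of_nonneg (Real.exp_pos _).le, Real.exp_le_one_iff, neg_nonpos]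
  positivity

theorem dampedWeight_zero (B : MagneticField N) (X : Phase N) (s : Config N) (p : Phase N) :
    dampedWeight B X 0 s p = Complex.exp (-(Complex.I * (leftPhase B X p : ℝ))) := by
  simp [dampedWeight, approxPhase_zero]

theorem continuous_shiftDir : Continuous (shiftDir (N := N)) := by
  unfold shiftDir; fun_prop

theorem shiftDir_zero : shiftDir (0 : Config N) = 0 := by simp [shiftDir]

theorem aestronglyMeasurable_dampedIntegrand (B : MagneticField N) (X : Phase N) (ε : ℝ)
    {κ : Phase N → ℂ} (hκ : AEStronglyMeasurable κ volume) :
    AEStronglyMeasurable (fun x : Config N × Phase N => dampedIntegrand B X ε κ x.1 x.2)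
      ((gaussMeasure N).prod volume) := by
  have h1 : Continuous fun x : Config N × Phase N => dampedWeight B X ε x.1 x.2 :=
    continuous_dampedWeight B X continuous_const continuous_fst continuous_snd
  have h2 := continuous_shiftDir (N := N)
  exact h1.aestronglyMeasurable.mul (hκ.comp_measurePreserving
    (measurePreserving_add_comp (γ := gaussMeasure N)
      (g := fun s => leftShift X + shiftDir (√ε • s)) (Continuous.measurable (by fun_prop))))

theorem lintegral_dampedIntegrand_le (B : MagneticField N) (X : Phase N) {ε : ℝ} (hε : 0 ≤ ε)
    {κ : Phase N → ℂ} (hκ : AEStronglyMeasurable κ volume) (s : Config N) :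
    ∫⁻ p, ‖dampedIntegrand B X ε κ s p‖ₑ ^ 2 ≤ eLpNorm κ 2 volume ^ 2 := by
  rw [← eLpNorm_two_sq]
  gcongr
  exact eLpNorm_mul_comp_add_le (norm_dampedWeight_le B X hε s) hκ _

theorem aestronglyMeasurable_dampedKernel (B : MagneticField N) (X : Phase N) (ε : ℝ)
    {f : Phase N → ℂ} (hf : AEStronglyMeasurable f volume) :
    AEStronglyMeasurable (dampedKernel B X ε f) volume :=
  (aestronglyMeasurable_dampedIntegrand B X ε (aestronglyMeasurable_sliceFourier (μ := volume)
    (aestronglyMeasurable_damp ε hf))).prod_swap.integral_prod_right'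

theorem sliceIntegrable_damp {ε : ℝ} (hε : 0 < ε) {f : Phase N → ℂ} (hf : MemLp f 2 volume) :
    SliceIntegrable (volume : Measure (Config N)) (damp ε f) :=
  (integrable_damp hε hf).prod_right_ae

theorem tendsto_eLpNorm_damp_sub {f : Phase N → ℂ} (hf : MemLp f 2 volume) :
    Tendsto (fun ε => eLpNorm (fun p => damp ε f p - f p) 2 volume) (𝓝[>] 0) (𝓝 0) := by
  have h := tendsto_eLpNorm_mul_sub (l := 𝓝[>] (0 : ℝ)) hf (u := fun ε p => (cutoff ε p : ℂ))
    (v := fun _ => 1) (Eventually.of_forall fun ε => Continuous.aestronglyMeasurable (by fun_prop))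
    aestronglyMeasurable_const ?_ (by simp) ?_
  · simpa only [one_mul] using! h
  · filter_upwards [self_mem_nhdsWithin] with ε hε p
    rw [Complex.norm_real, Real.norm_of_nonneg (cutoff_pos _ _).le]
    exact cutoff_le_one (le_of_lt hε) p
  · intro p
    have hc : Continuous fun ε : ℝ => (cutoff ε p : ℂ) := by unfold cutoff; fun_prop
    have := (hc.tendsto 0).mono_left (nhdsWithin_le_nhds (s := Set.Ioi 0))
    simpa [cutoff] using this

theorem eLpNorm_sliceFourier_damp_sub {ε : ℝ} (hε : 0 < ε) (f : L2Phase N) :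
    eLpNorm (fun p => sliceFourier (damp ε f) p - weylTransform N f p) 2 volume =
      eLpNorm (fun p => damp ε f p - f p) 2 volume := by
  have hd := memLp_damp hε.le (Lp.memLp f)
  have h1 : (fun p => sliceFourier (damp ε f) p - weylTransform N f p) =ᵐ[volume]
      (weylTransform N (hd.toLp _ - f) : L2Phase N) := by
    rw [map_sub]
    filter_upwards [weylTransform_toLp hd (sliceIntegrable_damp hε (Lp.memLp f)),
      Lp.coeFn_sub (weylTransform N (hd.toLp _)) (weylTransform N f)] with p h1 h2
    rw [h2, Pi.sub_apply, h1]
  have h2 : (fun p => damp ε f p - f p) =ᵐ[volume] (hd.toLp _ - f : L2Phase N) := by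
    filter_upwards [hd.coeFn_toLp, Lp.coeFn_sub (hd.toLp _) f] with p h1 h2
    rw [h2, Pi.sub_apply, h1]
  rw [eLpNorm_congr_ae h1, eLpNorm_congr_ae h2, ← Lp.enorm_def, ← Lp.enorm_def,
    ← ofReal_norm, ← ofReal_norm, LinearIsometryEquiv.norm_map]

theorem eLpNorm_sliceFourier_damp_le {ε : ℝ} (hε : 0 < ε) {f : Phase N → ℂ}
    (hf : MemLp f 2 volume) :
    eLpNorm (sliceFourier (damp ε f)) 2 volume ≤ eLpNorm f 2 volume := by
  have h := eLpNorm_sliceFourier (μ := (volume : Measure (Config N))) (memLp_damp hε.le hf)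
    (sliceIntegrable_damp hε hf)
  exact h.le.trans (eLpNorm_mono fun p => norm_damp_le hε.le f p)

theorem eLpNorm_dampedKernel_le (B : MagneticField N) (X : Phase N) {ε : ℝ} (hε : 0 < ε)
    {f : Phase N → ℂ} (hf : MemLp f 2 volume) :
    eLpNorm (dampedKernel B X ε f) 2 volume ≤ eLpNorm f 2 volume := by
  have hκ := aestronglyMeasurable_sliceFourier (μ := (volume : Measure (Config N)))
    (aestronglyMeasurable_damp ε hf.1)
  have hF := aestronglyMeasurable_dampedIntegrand B X ε hκ
  rw [← ENNReal.pow_le_pow_left_iff two_ne_zero, eLpNorm_two_sq]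
  refine (lintegral_enorm_integral_sq_le hF).trans ?_
  refine (lintegral_mono fun s => (lintegral_dampedIntegrand_le B X hε.le hκ s)).trans ?_
  rw [lintegral_const, measure_univ, mul_one]
  gcongr
  exact eLpNorm_sliceFourier_damp_le hε hf

theorem memLp_dampedKernel (B : MagneticField N) (X : Phase N) {ε : ℝ} (hε : 0 < ε)
    {f : Phase N → ℂ} (hf : MemLp f 2 volume) : MemLp (dampedKernel B X ε f) 2 volume :=
  ⟨aestronglyMeasurable_dampedKernel B X ε hf.1, (eLpNorm_dampedKernel_le B X hε hf).trans_lt hf.2⟩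

theorem tendsto_dampedIntegrand (B : MagneticField N) (X : Phase N) (f : L2Phase N)
    (s : Config N) :
    Tendsto (fun ε => eLpNorm (fun p => dampedIntegrand B X ε (sliceFourier (damp ε f)) s p -
      phaseShiftFun (leftPhase B X) (leftShift X) (weylTransform N f) p) 2 volume)
      (𝓝[>] 0) (𝓝 0) := by
  have hf := Lp.memLp f
  refine tendsto_eLpNorm_mul_translate (u := fun ε p => dampedWeight B X ε s p)
    (v := fun p => Complex.exp (-(Complex.I * (leftPhase B X p : ℝ))))
    (t := fun ε => leftShift X + shiftDir (√ε • s)) ?_ ?_ ?_ ?_ ?_ ?_ ?_ (Lp.memLp _) ?_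
  · exact Eventually.of_forall fun ε => (continuous_dampedWeight B X continuous_const
      continuous_const continuous_id).aestronglyMeasurable
  · exact Continuous.aestronglyMeasurable (by fun_prop)
  · filter_upwards [self_mem_nhdsWithin] with ε hε p
    exact norm_dampedWeight_le B X (le_of_lt hε) s p
  · exact fun p => (norm_exp_neg_I_mul _).le
  · intro p
    have hc : Continuous fun ε : ℝ => dampedWeight B X ε s p :=
      continuous_dampedWeight B X continuous_id continuous_const continuous_const
    have := (hc.tendsto 0).mono_left (nhdsWithin_le_nhds (s := Set.Ioi 0))
    rwa [dampedWeight_zero] at this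
  · have h2 := continuous_shiftDir (N := N)
    have hc : Continuous fun ε : ℝ => leftShift X + shiftDir (√ε • s) := by fun_prop
    have := (hc.tendsto 0).mono_left (nhdsWithin_le_nhds (s := Set.Ioi 0))
    simpa [shiftDir_zero] using this
  · exact Eventually.of_forall fun ε => aestronglyMeasurable_sliceFourier (μ := volume)
      (aestronglyMeasurable_damp ε hf.1)
  · refine (tendsto_eLpNorm_damp_sub hf).congr' ?_
    filter_upwards [self_mem_nhdsWithin] with ε hε
    exact (eLpNorm_sliceFourier_damp_sub hε f).symm

/-- For each s the integrand converges in L², with a bound independent of s and ε. Dominated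
convergence in s followed by the averaging inequality gives convergence of the mean. -/
theorem tendsto_dampedKernel (B : MagneticField N) (X : Phase N) (f : L2Phase N) :
    Tendsto (fun ε => eLpNorm (fun p => dampedKernel B X ε f p -
      phaseShiftFun (leftPhase B X) (leftShift X) (weylTransform N f) p) 2 volume)
      (𝓝[>] 0) (𝓝 0) := by
  have hf := Lp.memLp f
  set T := phaseShiftFun (leftPhase B X) (leftShift X) (weylTransform N f) with hT
  have hTm : MemLp T 2 volume := memLp_phaseShiftFun _ _ (Lp.memLp _)
  have hκ := fun ε => aestronglyMeasurable_sliceFourier (μ := (volume : Measure (Config N)))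
    (aestronglyMeasurable_damp ε hf.1)
  have hF := fun ε => aestronglyMeasurable_dampedIntegrand B X ε (hκ ε)
  have hT2 : AEStronglyMeasurable (fun x : Config N × Phase N => T x.2)
      ((gaussMeasure N).prod volume) := hTm.1.comp_snd
  have hG : ∀ ε, AEStronglyMeasurable (fun x : Config N × Phase N =>
      dampedIntegrand B X ε (sliceFourier (damp ε f)) x.1 x.2 - T x.2)
      ((gaussMeasure N).prod volume) := fun ε => (hF ε).sub hT2
  refine tendsto_zero_of_sq_tendsto_zero ?_
  have hlim : Tendsto (fun ε => ∫⁻ s, (∫⁻ p, ‖dampedIntegrand B X ε (sliceFourier (damp ε f)) s p -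
      T p‖ₑ ^ 2) ∂(gaussMeasure N)) (𝓝[>] 0) (𝓝 (∫⁻ _, 0 ∂(gaussMeasure N))) := by
    refine tendsto_lintegral_filter_of_dominated_convergence'
      (fun _ => (eLpNorm f 2 volume + eLpNorm T 2 volume) ^ 2) ?_ ?_ ?_ ?_
    · exact Eventually.of_forall fun ε => ((hG ε).enorm.pow_const 2).lintegral_prod_right'
    · filter_upwards [self_mem_nhdsWithin] with ε hε
      filter_upwards [(hF ε).prodMk_left] with s hs
      rw [← eLpNorm_two_sq]
      gcongr
      refine (eLpNorm_sub_le hs hTm.1 (by norm_num)).trans ?_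
      gcongr
      exact (eLpNorm_mul_comp_add_le (norm_dampedWeight_le B X (le_of_lt hε) s) (hκ ε) _).trans
        (eLpNorm_sliceFourier_damp_le hε hf)
    · rw [lintegral_const, measure_univ, mul_one]
      exact ENNReal.pow_ne_top (ENNReal.add_ne_top.2 ⟨hf.2.ne, hTm.2.ne⟩)
    · refine Eventually.of_forall fun s => ?_
      have h := ((ENNReal.continuous_pow 2).tendsto 0).comp (tendsto_dampedIntegrand B X f s)
      simpa [Function.comp_def, eLpNorm_two_sq] using! h
  rw [lintegral_zero] at hlim
  refine tendsto_of_tendsto_of_tendsto_of_le_of_le' tendsto_const_nhds hlim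
    (Eventually.of_forall fun _ => zero_le) ?_
  filter_upwards [self_mem_nhdsWithin] with ε hε
  have hε' : 0 < ε := hε
  refine le_trans (le_of_eq ?_) (lintegral_enorm_integral_sq_le (hG ε))
  rw [eLpNorm_two_sq]
  refine lintegral_congr_ae ?_
  -- Integrability in s for almost every p is needed to write the mean minus its limit as the mean
  -- of the differences.
  have hfin : ∫⁻ s, (∫⁻ p, ‖dampedIntegrand B X ε (sliceFourier (damp ε f)) s p‖ₑ ^ 2)
      ∂(gaussMeasure N) < ⊤ := by
    refine (lintegral_mono fun s => (lintegral_dampedIntegrand_le B X hε'.le (hκ ε) s)).trans_lt ?_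
    rw [lintegral_const, measure_univ, mul_one]
    exact (ENNReal.pow_lt_top ((eLpNorm_sliceFourier_damp_le hε' hf).trans_lt hf.2))
  filter_upwards [ae_integrable_of_lintegral_sq_lt_top (hF ε) hfin] with p hp
  have hp' : Integrable (fun s => dampedIntegrand B X ε (sliceFourier (damp ε f)) s p)
    (gaussMeasure N) := hp
  rw [integral_sub hp' (integrable_const _), integral_const, probReal_univ, one_smul]
  rfl

/-- The inverse partial Fourier transform is an isometry, so convergence of the kernels is
convergence of the damped products. -/
theorem isMagneticProduct_leftProduct (B : MagneticField N) (X : Phase N) (f : L2Phase N) :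
    IsMagneticProduct B (expSymbol X) f (leftProduct B X f) := by
  refine (tendsto_dampedKernel B X f).congr' ?_
  filter_upwards [self_mem_nhdsWithin] with ε hε
  have hε' : 0 < ε := hε
  have hf := Lp.memLp f
  have hK := memLp_dampedKernel B X hε' hf
  have hs : SliceIntegrable (volume : Measure (Config N)) (dampedKernel B X ε f) :=
    Eventually.of_forall fun q => integrable_dampedKernel B X hε' hf q
  set T := phaseShift (leftPhase B X) (leftShift X) (weylTransform N f) with hT
  have h1 : (fun p => dampedKernel B X ε f p -
      phaseShiftFun (leftPhase B X) (leftShift X) (weylTransform N f) p) =ᵐ[volume]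
      (hK.toLp _ - T : L2Phase N) := by
    filter_upwards [hK.coeFn_toLp, Lp.coeFn_sub (hK.toLp _) T,
      coeFn_phaseShift (leftPhase B X) (leftShift X) (weylTransform N f)] with p h1 h2 h3
    rw [h2, Pi.sub_apply, h1, hT, h3]
  have h2 : (fun p => compositionIntegral B (damp ε (expSymbol X)) (damp ε f) p -
      leftProduct B X f p) =ᵐ[volume] ((weylTransform N).symm (hK.toLp _ - T) : L2Phase N) := by
    rw [map_sub]
    filter_upwards [weylTransform_symm_toLp hK hs,
      Lp.coeFn_sub ((weylTransform N).symm (hK.toLp _)) ((weylTransform N).symm T)] with p h1 h2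
    rw [h2, Pi.sub_apply, h1, compositionIntegral_damp_eq_sliceFourierInv B X hε' hf]
    rfl
  rw [eLpNorm_congr_ae h1, eLpNorm_congr_ae h2, ← Lp.enorm_def, ← Lp.enorm_def,
    ← ofReal_norm, ← ofReal_norm, LinearIsometryEquiv.norm_map]

end LeftProduct

/-! ### Right products by conjugation, and uniqueness of the product. -/

section MagneticProducts

variable {N : ℕ}

/-- The oscillatory factor of the composition law. -/
def compositionPhase (B : MagneticField N) (X Y Z : Phase N) : ℂ :=
  Complex.exp (-(2 * Complex.I * (sympl (X - Y) (X - Z) : ℝ))) *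
      Complex.exp (-(Complex.I *
        (flux B (X.1 - Y.1 + Z.1) (Y.1 - Z.1 + X.1) (Z.1 - X.1 + Y.1) : ℝ)))

theorem compositionIntegral_eq (B : MagneticField N) (f g : Phase N → ℂ) (X : Phase N) :
    compositionIntegral B f g X = ((Real.pi ^ (2 * N))⁻¹ : ℝ) * ∫ Y : Phase N, ∫ Z : Phase N,
      compositionPhase B X Y Z * f Y * g Z := rfl

theorem norm_compositionPhase (B : MagneticField N) (X Y Z : Phase N) :
    ‖compositionPhase B X Y Z‖ = 1 := by
  rw [compositionPhase, norm_mul, norm_exp_neg_I_mul, mul_one]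
  have := norm_exp_neg_I_mul (2 * sympl (X - Y) (X - Z))
  rw [← this]
  congr 2
  push_cast
  ring

/-- Exchanging Y and Z changes the sign of the symplectic form and reverses the orientation of the
triangle. -/
theorem conj_compositionPhase (B : MagneticField N) (X Y Z : Phase N) :
    conj (compositionPhase B X Y Z) = compositionPhase B X Z Y := by
  have h1 : sympl (X - Z) (X - Y) = -sympl (X - Y) (X - Z) := by
    simp only [sympl]
    ring_nf
  have h2 : flux B (X.1 - Z.1 + Y.1) (Z.1 - Y.1 + X.1) (Y.1 - X.1 + Z.1) =
      -flux B (X.1 - Y.1 + Z.1) (Y.1 - Z.1 + X.1) (Z.1 - X.1 + Y.1) := by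
    rw [← flux_swap B]
    congr 1 <;> abel
  rw [compositionPhase, compositionPhase, map_mul, ← Complex.exp_conj, ← Complex.exp_conj, h1, h2]
  simp [Complex.conj_ofNat]

theorem continuous_compositionPhase (B : MagneticField N) :
    Continuous fun x : (Phase N × Phase N) × Phase N => compositionPhase B x.1.1 x.1.2 x.2 := by
  have h := continuous_flux_comp B
    (a := fun x : (Phase N × Phase N) × Phase N => x.1.1.1 - x.1.2.1 + x.2.1)
    (b := fun x : (Phase N × Phase N) × Phase N => x.1.2.1 - x.2.1 + x.1.1.1)
    (c := fun x : (Phase N × Phase N) × Phase N => x.2.1 - x.1.1.1 + x.1.2.1)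
    (by fun_prop) (by fun_prop) (by fun_prop)
  unfold compositionPhase sympl
  fun_prop

theorem compositionIntegral_congr_ae (B : MagneticField N) {f f' g g' : Phase N → ℂ}
    (hf : f =ᵐ[volume] f') (hg : g =ᵐ[volume] g') (X : Phase N) :
    compositionIntegral B f g X = compositionIntegral B f' g' X := by
  rw [compositionIntegral_eq, compositionIntegral_eq]
  congr 1
  refine integral_congr_ae ?_
  filter_upwards [hf] with Y hY
  refine integral_congr_ae ?_
  filter_upwards [hg] with Z hZ
  rw [hY, hZ]

/-- Needed for the triangle inequality in the uniqueness of the L² limit. -/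
theorem stronglyMeasurable_compositionIntegral (B : MagneticField N) {f g : Phase N → ℂ}
    (hf : AEStronglyMeasurable f volume) (hg : AEStronglyMeasurable g volume) :
    StronglyMeasurable (compositionIntegral B f g) := by
  have e : compositionIntegral B f g = compositionIntegral B (hf.mk f) (hg.mk g) :=
    funext (compositionIntegral_congr_ae B hf.ae_eq_mk hg.ae_eq_mk)
  rw [e]
  have h : StronglyMeasurable fun x : (Phase N × Phase N) × Phase N =>
      compositionPhase B x.1.1 x.1.2 x.2 * hf.mk f x.1.2 * hg.mk g x.2 :=
    ((continuous_compositionPhase B).stronglyMeasurable.mul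
      (hf.stronglyMeasurable_mk.comp_measurable (by fun_prop))).mul
      (hg.stronglyMeasurable_mk.comp_measurable (by fun_prop))
  have h2 := (h.integral_prod_right' (ν := (volume : Measure (Phase N)))).integral_prod_right'
    (ν := (volume : Measure (Phase N)))
  exact h2.const_mul _

theorem conj_compositionIntegral (B : MagneticField N) {f g : Phase N → ℂ}
    (hf : Integrable f) (hg : Integrable g) (X : Phase N) :
    conj (compositionIntegral B f g X) =
      compositionIntegral B (fun Z => conj (g Z)) (fun Z => conj (f Z)) X := by
  rw [compositionIntegral_eq, compositionIntegral_eq, map_mul, Complex.conj_ofReal]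
  congr 1
  have hint : Integrable (fun x : Phase N × Phase N =>
      compositionPhase B X x.1 x.2 * conj (g x.1) * conj (f x.2)) := by
    have h0 : Integrable (fun x : Phase N × Phase N => conj (g x.1) * conj (f x.2)) :=
      ((Complex.conjCLE.integrable_comp_iff).2 hg).mul_prod
        ((Complex.conjCLE.integrable_comp_iff).2 hf)
    have hc : Continuous fun x : Phase N × Phase N => compositionPhase B X x.1 x.2 :=
      (continuous_compositionPhase B).comp (f := fun x : Phase N × Phase N => ((X, x.1), x.2))
        (by fun_prop)
    refine (h0.bdd_mul (c := 1) hc.aestronglyMeasurable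
      (Eventually.of_forall fun x => (norm_compositionPhase B X _ _).le)).congr
      (Eventually.of_forall fun x => ?_)
    simp only [mul_assoc]
  rw [integral_integral_swap (f := fun Y Z => compositionPhase B X Y Z * conj (g Y) * conj (f Z))
    hint, ← integral_conj]
  refine integral_congr_ae (Eventually.of_forall fun Y => ?_)
  simp only []
  rw [← integral_conj]
  refine integral_congr_ae (Eventually.of_forall fun Z => ?_)
  simp only [map_mul, conj_compositionPhase]
  ring

theorem damp_congr_ae (ε : ℝ) {f g : Phase N → ℂ} (h : f =ᵐ[volume] g) :
    damp ε f =ᵐ[volume] damp ε g := by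
  filter_upwards [h] with p hp
  rw [damp_eq, damp_eq, hp]

theorem conj_damp (ε : ℝ) (f : Phase N → ℂ) (p : Phase N) :
    conj (damp ε f p) = damp ε (fun Z => conj (f Z)) p := by
  rw [damp_eq, damp_eq, map_mul, Complex.conj_ofReal]

theorem conj_expSymbol (X Z : Phase N) : conj (expSymbol X Z) = expSymbol (-X) Z := by
  rw [expSymbol, conj_exp_neg_I_mul, expSymbol]
  congr 4
  simp only [sympl, Prod.fst_neg, Prod.snd_neg, inner_neg_right, inner_neg_left]
  ring

theorem IsMagneticProduct.congr_ae {B : MagneticField N} {f f' g g' : Phase N → ℂ} {p : L2Phase N}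
    (h : IsMagneticProduct B f g p) (hf : f =ᵐ[volume] f') (hg : g =ᵐ[volume] g') :
    IsMagneticProduct B f' g' p := by
  refine h.congr fun ε => ?_
  congr 1
  funext X
  rw [compositionIntegral_congr_ae B (damp_congr_ae ε hf) (damp_congr_ae ε hg)]

/-- Conjugating the damped integral exchanges its factors, so this is the left product of e_{-Y}
with the conjugate of f. -/
theorem isMagneticProduct_rightProduct (B : MagneticField N) (f : L2Phase N) (Y : Phase N) :
    IsMagneticProduct B f (expSymbol Y) (rightProduct B f Y) := by
  have h := (isMagneticProduct_leftProduct B (-Y) (star f)).congr_ae (EventuallyEq.refl _ _)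
    (coeFn_star_phase f)
  refine h.congr' ?_
  filter_upwards [self_mem_nhdsWithin] with ε hε
  have hε' : 0 < ε := hε
  refine eLpNorm_congr_norm_ae ?_
  have e := coeFn_star_phase (leftProduct B (-Y) (star f))
  rw [star_leftProduct_star] at e
  filter_upwards [e] with p hp
  rw [hp, ← RCLike.norm_conj, map_sub]
  congr 2
  rw [conj_compositionIntegral B (integrable_damp_expSymbol hε' _)
    (integrable_damp hε' (memLp_conj (Lp.memLp f)))]
  congr 1
  · funext Z
    rw [conj_damp]
    simp only [Complex.conj_conj]
  · funext Z
    rw [conj_damp]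
    simp only [conj_expSymbol, neg_neg]

theorem IsMagneticProduct.unique {B : MagneticField N} {f g : Phase N → ℂ} {p q : L2Phase N}
    (hf : AEStronglyMeasurable f volume) (hg : AEStronglyMeasurable g volume)
    (hp : IsMagneticProduct B f g p) (hq : IsMagneticProduct B f g q) : p = q := by
  have hsum := hp.add hq
  rw [add_zero] at hsum
  have hle : ∀ ε : ℝ, eLpNorm (p - q : L2Phase N) 2 volume ≤
      eLpNorm (fun X => compositionIntegral B (damp ε f) (damp ε g) X - p X) 2 volume +
      eLpNorm (fun X => compositionIntegral B (damp ε f) (damp ε g) X - q X) 2 volume := by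
    intro ε
    have hC := (stronglyMeasurable_compositionIntegral B (aestronglyMeasurable_damp ε hf)
      (aestronglyMeasurable_damp ε hg)).aestronglyMeasurable (μ := volume)
    have e : (p - q : L2Phase N) =ᵐ[volume]
        (fun X => compositionIntegral B (damp ε f) (damp ε g) X - q X) -
        (fun X => compositionIntegral B (damp ε f) (damp ε g) X - p X) := by
      filter_upwards [Lp.coeFn_sub p q] with X hX
      rw [hX, Pi.sub_apply, Pi.sub_apply]
      ring
    rw [eLpNorm_congr_ae e, add_comm]
    exact eLpNorm_sub_le (hC.sub (Lp.aestronglyMeasurable q))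
      (hC.sub (Lp.aestronglyMeasurable p)) (by norm_num)
  have h0 := ge_of_tendsto' hsum hle
  rw [← sub_eq_zero, ← norm_eq_zero, Lp.norm_def, le_antisymm h0 zero_le, ENNReal.toReal_zero]

theorem IsMagneticProduct.magneticProduct_eq {B : MagneticField N} {f g : Phase N → ℂ}
    {p : L2Phase N} (hf : AEStronglyMeasurable f volume) (hg : AEStronglyMeasurable g volume)
    (hp : IsMagneticProduct B f g p) : magneticProduct B f g = p := by
  have hex : ∃ p, IsMagneticProduct B f g p := ⟨p, hp⟩
  rw [magneticProduct, dif_pos hex]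
  exact hex.choose_spec.unique hf hg hp

theorem magneticProduct_expSymbol_left (B : MagneticField N) (X : Phase N) {φ : Phase N → ℂ}
    {f : L2Phase N} (h : f =ᵐ[volume] φ) :
    magneticProduct B (expSymbol X) φ = leftProduct B X f :=
  ((isMagneticProduct_leftProduct B X f).congr_ae (EventuallyEq.refl _ _) h).magneticProduct_eq
    (continuous_expSymbol X).aestronglyMeasurable ((Lp.aestronglyMeasurable f).congr h)

theorem magneticProduct_expSymbol_right (B : MagneticField N) (f : L2Phase N) (Y : Phase N) :
    magneticProduct B f (expSymbol Y) = rightProduct B f Y :=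
  (isMagneticProduct_rightProduct B f Y).magneticProduct_eq (Lp.aestronglyMeasurable f)
    (continuous_expSymbol Y).aestronglyMeasurable

theorem sandwich_eq (B : MagneticField N) (X Y : Phase N) {φ : Phase N → ℂ}
    {f : L2Phase N} (h : f =ᵐ[volume] φ) :
    sandwich B X φ Y = rightProduct B (leftProduct B X f) Y := by
  rw [sandwich, magneticProduct_expSymbol_left B X h, magneticProduct_expSymbol_right]

end MagneticProducts

/-! ### The linear change of variables behind the modulation mapping. -/

section ChangeOfVariables

open scoped ENNReal

variable {N : ℕ}

/-- The linear map `(x, y) ↦ (-x + y/2, y/(2π))`. -/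
def shearScale (p : Phase N) : Phase N := (-p.1 + (2⁻¹ : ℝ) • p.2, (2 * Real.pi)⁻¹ • p.2)

/-- The shear preserves volume and y ↦ y/(2π) pushes it to (2π)^N times itself. Used once for
positions and once for momenta, this is the source of the constant (2π)^{2N}. -/
theorem measurePreserving_shearScale :
    MeasurePreserving (shearScale (N := N)) volume
      (ENNReal.ofReal ((2 * Real.pi) ^ N) • volume) := by
  have h1 : MeasurePreserving (fun p : Config N × Config N => (p.1, -p.2 + (2⁻¹ : ℝ) • p.1))
      (volume.prod volume) (volume.prod volume) := by
    refine MeasurePreserving.skew_product (g := fun y x => -x + (2⁻¹ : ℝ) • y)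
      (MeasurePreserving.id _) (by fun_prop) (Eventually.of_forall fun y => ?_)
    exact ((measurePreserving_add_right volume ((2⁻¹ : ℝ) • y)).comp
      (Measure.measurePreserving_neg volume)).map_eq
  have h2 : MeasurePreserving (fun y : Config N => (2 * Real.pi)⁻¹ • y) volume
      (ENNReal.ofReal ((2 * Real.pi) ^ N) • volume) := by
    refine ⟨by fun_prop, ?_⟩
    rw [Measure.map_addHaar_smul _ (by positivity), finrank_euclideanSpace, Fintype.card_fin,
      abs_of_nonneg (by positivity), inv_pow, inv_inv]
  have h3 := (MeasurePreserving.id (volume : Measure (Config N))).prod h2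
  rw [Measure.prod_smul_right] at h3
  exact h3.comp ((Measure.measurePreserving_swap.comp h1).comp Measure.measurePreserving_swap)

/-- The frequency space dual to `Phase N`, as an inner product space. -/
abbrev PhaseDual (N : ℕ) : Type := WithLp 2 (Config N × Config N)

/-- The change of variables that turns the modulation mapping into a partial Fourier transform. -/
def modulationCoord (W : Phase N × Phase N) : Phase N × PhaseDual N :=
  ((-W.1.1 + (2⁻¹ : ℝ) • W.2.1, (2 * Real.pi)⁻¹ • W.2.1),
    WithLp.toLp 2 (-((2 * Real.pi)⁻¹ • W.2.2), W.1.2 - (2⁻¹ : ℝ) • W.2.2))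

theorem measurePreserving_modulationCoord :
    MeasurePreserving (modulationCoord (N := N)) volume
      (ENNReal.ofReal ((2 * Real.pi) ^ (2 * N)) • (volume.prod volume)) := by
  have h1 := measurePreserving_prod_prod_comm (α := Config N) (β := Config N) (γ := Config N)
    (δ := Config N)
  have h2 := (measurePreserving_shearScale (N := N)).prod (measurePreserving_shearScale (N := N))
  have h3 : MeasurePreserving (fun p : Phase N => (WithLp.toLp 2 (-p.2, -p.1) : PhaseDual N)) :=
    (WithLp.volume_preserving_toLp (Config N) (Config N)).comp
      (((Measure.measurePreserving_neg volume).prod (Measure.measurePreserving_neg volume)).comp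
        Measure.measurePreserving_swap)
  have h4 := ((MeasurePreserving.id (volume : Measure (Phase N))).prod h3)
  rw [Measure.prod_smul_left, Measure.prod_smul_right, smul_smul, ← ENNReal.ofReal_mul
    (by positivity), ← pow_add, ← two_mul] at h2
  have h5 := (h4.smul_measure (ENNReal.ofReal ((2 * Real.pi) ^ (2 * N)))).comp (h2.comp h1)
  have e : (Prod.map id fun p : Phase N => (WithLp.toLp 2 (-p.2, -p.1) : PhaseDual N)) ∘
      Prod.map shearScale shearScale ∘ (fun p : Phase N × Phase N =>
        ((p.1.1, p.2.1), p.1.2, p.2.2)) = modulationCoord := by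
    funext W
    refine Prod.ext rfl ?_
    simp only [modulationCoord, shearScale, Function.comp_apply, Prod.map_snd]
    congr 2
    module
  rwa [e] at h5

end ChangeOfVariables

/-! ### The modulation mapping as a partial Fourier transform. -/

section ModulationSymbol

open scoped ENNReal

variable {N : ℕ}

/-- The flux part of the phase of the modulation mapping. -/
def modulationPhase (B : MagneticField N) (t p : Phase N) : ℝ :=
  flux B (kernelLeft p) (kernelRight (p + t)) (kernelRight p) +
    flux B (kernelLeft p) (kernelLeft (p + t)) (kernelRight (p + t))

/-- The product `(t, p) ↦ conj (ψ p) φ (p + t)`. -/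
def translateProduct (ψ φ : Phase N → ℂ) (x : Phase N × PhaseDual N) : ℂ :=
  conj (ψ (WithLp.ofLp x.2)) * φ (WithLp.ofLp x.2 + x.1)

/-- The function whose partial Fourier transform is, up to a unimodular factor and a change of
variables, the modulation mapping. -/
def modulationSymbol (B : MagneticField N) (ψ φ : Phase N → ℂ) (x : Phase N × PhaseDual N) : ℂ :=
  Complex.exp (-(Complex.I * (modulationPhase B x.1 (WithLp.ofLp x.2) : ℝ))) *
    translateProduct ψ φ x

/-- The unimodular factor of the modulation mapping. -/
def modulationFactor (W : Phase N × Phase N) : ℂ :=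
  Complex.exp (-(Complex.I * ((inner ℝ ((2⁻¹ : ℝ) • W.1.1) W.1.2 -
    inner ℝ ((2⁻¹ : ℝ) • (W.1.1 - W.2.1)) (W.1.2 - W.2.2) : ℝ) : ℂ)))

theorem continuous_ofLp_phase : Continuous (WithLp.ofLp : PhaseDual N → Phase N) :=
  WithLp.prod_continuous_ofLp 2 _ _

theorem continuous_modulationPhase (B : MagneticField N) :
    Continuous fun x : Phase N × PhaseDual N => modulationPhase B x.1 (WithLp.ofLp x.2) := by
  have h := continuous_ofLp_phase (N := N)
  unfold modulationPhase
  refine Continuous.add (continuous_flux_comp B ?_ ?_ ?_) (continuous_flux_comp B ?_ ?_ ?_) <;>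
    fun_prop

theorem measurePreserving_translate_pair :
    MeasurePreserving (fun x : Phase N × PhaseDual N =>
      ((WithLp.ofLp x.2 : Phase N), (WithLp.ofLp x.2 : Phase N) + x.1))
      (volume.prod volume) (volume.prod volume) := by
  have h1 := (MeasurePreserving.id (volume : Measure (Phase N))).prod
    (WithLp.volume_preserving_ofLp (Config N) (Config N))
  have h2 : MeasurePreserving (fun x : Phase N × Phase N => (x.1, x.1 + x.2))
      (volume.prod volume) (volume.prod volume) := by
    refine MeasurePreserving.skew_product (g := fun z v => z + v) (MeasurePreserving.id _)
      (by fun_prop) (Eventually.of_forall fun z => ?_)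
    have : (fun v : Phase N => z + v) = fun v => v + z := funext fun v => add_comm _ _
    rw [this]
    exact (measurePreserving_add_right_phase z).map_eq
  exact (h2.comp Measure.measurePreserving_swap).comp h1

theorem memLp_two_mul_prod {ψ φ : Phase N → ℂ} (hψ : MemLp ψ 2 volume) (hφ : MemLp φ 2 volume) :
    MemLp (fun x : Phase N × Phase N => conj (ψ x.1) * φ x.2) 2 (volume.prod volume) := by
  have hm : AEStronglyMeasurable (fun x : Phase N × Phase N => conj (ψ x.1) * φ x.2)
      (volume.prod volume) := (memLp_conj hψ).1.comp_fst.mul hφ.1.comp_snd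
  rw [memLp_two_iff_integrable_sq_norm hm]
  refine (((memLp_two_iff_integrable_sq_norm hψ.1).1 hψ).mul_prod
    ((memLp_two_iff_integrable_sq_norm hφ.1).1 hφ)).congr (Eventually.of_forall fun x => ?_)
  simp only [norm_mul, RCLike.norm_conj, mul_pow]

theorem memLp_translateProduct {ψ φ : Phase N → ℂ} (hψ : MemLp ψ 2 volume)
    (hφ : MemLp φ 2 volume) : MemLp (translateProduct ψ φ) 2 (volume.prod volume) :=
  (memLp_two_mul_prod hψ hφ).comp_measurePreserving measurePreserving_translate_pair

theorem memLp_modulationSymbol (B : MagneticField N) {ψ φ : Phase N → ℂ} (hψ : MemLp ψ 2 volume)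
    (hφ : MemLp φ 2 volume) : MemLp (modulationSymbol B ψ φ) 2 (volume.prod volume) := by
  have h := memLp_translateProduct hψ hφ
  have hc := continuous_modulationPhase B
  refine h.of_le ((Continuous.aestronglyMeasurable (by fun_prop)).mul h.1)
    (Eventually.of_forall fun x => ?_)
  rw [modulationSymbol, norm_mul, norm_exp_neg_I_mul, one_mul]

theorem integrable_modulationSymbol (B : MagneticField N) {ψ φ : Phase N → ℂ}
    (hψ : MemLp ψ 2 volume) (hφ : MemLp φ 2 volume) (t : Phase N) :
    Integrable fun v => modulationSymbol B ψ φ (t, v) := by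
  have h1 : Integrable fun p => conj (ψ p) * φ (p + t) :=
    (memLp_conj hψ).integrable_mul (hφ.comp_measurePreserving (measurePreserving_add_right_phase t))
  have h2 := (WithLp.volume_preserving_ofLp (Config N) (Config N)).integrable_comp_of_integrable h1
  have hc := continuous_modulationPhase B
  have hE : Continuous fun x : Phase N × PhaseDual N =>
    Complex.exp (-(Complex.I * (modulationPhase B x.1 (WithLp.ofLp x.2) : ℝ))) := by fun_prop
  exact h2.bdd_mul (c := 1)
    (hE.comp (f := fun v : PhaseDual N => (t, v)) (by fun_prop)).aestronglyMeasurable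
    (Eventually.of_forall fun v => (norm_exp_neg_I_mul _).le)

/-- The flux phase depends on (t,p) but not on the functions, so it cancels pointwise. The
measure-preserving map (t,p) ↦ (p,p+t) then separates the variables. -/
theorem integral_conj_modulationSymbol_mul (B : MagneticField N) {ψ φ ψ' φ' : Phase N → ℂ}
    (hψ : MemLp ψ 2 volume) (hφ : MemLp φ 2 volume) (hψ' : MemLp ψ' 2 volume)
    (hφ' : MemLp φ' 2 volume) :
    ∫ x, conj (modulationSymbol B ψ φ x) * modulationSymbol B ψ' φ' x ∂(volume.prod volume) =
      (∫ p, conj (ψ' p) * ψ p) * ∫ p, conj (φ p) * φ' p := by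
  rw [← integral_prod_mul (μ := (volume : Measure (Phase N))) (ν := (volume : Measure (Phase N)))
    (fun p => conj (ψ' p) * ψ p) (fun p => conj (φ p) * φ' p)]
  have hm := ((memLp_conj (memLp_two_mul_prod hψ hφ)).integrable_mul
    (memLp_two_mul_prod hψ' hφ')).aestronglyMeasurable
  have h := integral_comp_of_measurePreserving measurePreserving_translate_pair hm
  refine Eq.trans ?_ (h.trans ?_)
  · refine integral_congr_ae (Eventually.of_forall fun x => ?_)
    simp only [modulationSymbol, translateProduct, Pi.mul_apply, map_mul, Complex.conj_conj]
    have : ∀ r : ℝ, conj (Complex.exp (-(Complex.I * (r : ℂ)))) *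
        Complex.exp (-(Complex.I * (r : ℂ))) = 1 := fun r => by
      rw [Complex.conj_mul', norm_exp_neg_I_mul]
      simp
    linear_combination (ψ (WithLp.ofLp x.2) * conj (φ (WithLp.ofLp x.2 + x.1)) *
      (conj (ψ' (WithLp.ofLp x.2)) * φ' (WithLp.ofLp x.2 + x.1))) *
      this (modulationPhase B x.1 (WithLp.ofLp x.2))
  · refine integral_congr_ae (Eventually.of_forall fun x => ?_)
    simp only [Pi.mul_apply, map_mul, Complex.conj_conj]
    ring

theorem modulation_eq_inner (B : MagneticField N) (h f : L2Phase N) (W : Phase N × Phase N) :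
    modulation B h f W =
      inner ℂ (star h) (rightProduct B (leftProduct B (-W.1) f) (W.1 - W.2)) := by
  rw [modulation, pairing, sandwich_eq B (-W.1) (W.1 - W.2) (EventuallyEq.refl _ f), L2.inner_def]
  refine integral_congr_ae ?_
  filter_upwards [coeFn_star_phase h] with p hp
  rw [hp, RCLike.inner_apply', Complex.conj_conj, mul_comm]

/-- In the kernel picture the scalar product integrates conj(ψ(p)) against a phase times φ(p+t),
where t depends only on the positions of X and Y. The momenta enter only the linear part of the
phase, so they act as Fourier variables dual to p. -/
theorem modulation_eq_sliceFourier (B : MagneticField N) (h f : L2Phase N)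
    (W : Phase N × Phase N) :
    modulation B h f W = modulationFactor W * sliceFourier
      (modulationSymbol B (weylTransform N (star h)) (weylTransform N f)) (modulationCoord W) := by
  set ψ := weylTransform N (star h) with hψ
  set φ := weylTransform N f with hφ
  let θ : C(Phase N, ℝ) := rightPhase B (W.1 - W.2) + (leftPhase B (-W.1)).comp
    ⟨fun p => p + rightShift (W.1 - W.2), by fun_prop⟩
  have hT := phaseShift_phaseShift (θ₁ := rightPhase B (W.1 - W.2)) (θ₂ := leftPhase B (-W.1))
    (θ := θ) (t₁ := rightShift (W.1 - W.2)) (t₂ := leftShift (-W.1)) (t := (modulationCoord W).1)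
    (fun p => rfl) (by
      refine Prod.ext ?_ ?_
      · simp only [modulationCoord, rightShift, leftShift, Prod.fst_add, Prod.fst_sub, Prod.fst_neg]
        module
      · simp only [modulationCoord, rightShift, leftShift, Prod.snd_add, Prod.fst_sub, Prod.fst_neg]
        module) φ
  rw [modulation_eq_inner, ← (weylTransform N).inner_map_map, rightProduct, leftProduct,
    LinearIsometryEquiv.apply_symm_apply, LinearIsometryEquiv.apply_symm_apply, ← hψ, ← hφ, hT,
    L2.inner_def, sliceFourier, Real.fourier_eq', ← MeasureTheory.integral_const_mul]
  rw [← (WithLp.volume_preserving_ofLp (Config N) (Config N)).integral_comp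
    (MeasurableEquiv.toLp 2 (Config N × Config N)).symm.measurableEmbedding]
  have hae := (WithLp.volume_preserving_ofLp (Config N) (Config N)).quasiMeasurePreserving.ae
    (coeFn_phaseShift θ (modulationCoord W).1 φ)
  refine integral_congr_ae ?_
  filter_upwards [hae] with v hv
  rw [hv, RCLike.inner_apply']
  simp only [phaseShiftFun, modulationSymbol, translateProduct, smul_eq_mul, modulationFactor]
  generalize hp : (WithLp.ofLp v : Phase N) = p
  have hθ : Complex.exp (-(Complex.I * (θ p : ℝ))) = modulationFactor W *
      (Complex.exp (((-2 * Real.pi * inner ℝ v (modulationCoord W).2 : ℝ) : ℂ) * Complex.I) *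
      Complex.exp (-(Complex.I * (modulationPhase B (modulationCoord W).1 p : ℝ)))) := by
    -- The phase consists of a constant in p (`modulationFactor`), a term linear in p (the
    -- character) and fluxes whose vertices are determined by p and p + t.
    have e : θ p = inner ℝ ((2⁻¹ : ℝ) • W.1.1) W.1.2 -
        inner ℝ ((2⁻¹ : ℝ) • (W.1.1 - W.2.1)) (W.1.2 - W.2.2) +
        2 * Real.pi * inner ℝ v (modulationCoord W).2 +
        modulationPhase B (modulationCoord W).1 p := by
      have k1 : kernelRight p - (W.1 - W.2).1 = kernelRight (p + (modulationCoord W).1) := by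
        simp only [kernelRight, modulationCoord, Prod.fst_add, Prod.snd_add, Prod.fst_sub]
        match_scalars <;> field_simp
        norm_num
      have k2 : kernelLeft p + (-W.1).1 = kernelLeft (p + (modulationCoord W).1) := by
        simp only [kernelLeft, modulationCoord, Prod.fst_add, Prod.snd_add, Prod.fst_neg]
        match_scalars <;> field_simp
        norm_num
      have k3 : inner ℝ v (modulationCoord W).2 = inner ℝ p.1 (-((2 * Real.pi)⁻¹ • W.2.2)) +
          inner ℝ p.2 (W.1.2 - (2⁻¹ : ℝ) • W.2.2) := by
        rw [← hp]
        rfl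
      simp only [θ, leftPhase, rightPhase, ContinuousMap.add_apply, ContinuousMap.comp_apply,
        ContinuousMap.coe_mk, kernelLeft_add_rightShift, kernelRight_add_rightShift, k1, k2, k3,
        modulationPhase]
      simp only [kernelLeft, kernelRight, Prod.fst_sub, Prod.snd_sub, Prod.fst_neg, Prod.snd_neg,
        inner_add_left, inner_sub_left, inner_sub_right, inner_neg_left, inner_neg_right,
        inner_smul_left, inner_smul_right, RCLike.conj_to_real, smul_neg]
      have hpi := Real.pi_ne_zero
      field_simp
      ring
    rw [e, modulationFactor, ← Complex.exp_add, ← Complex.exp_add]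
    congr 1
    push_cast
    ring
  rw [hθ, modulationFactor]
  ring

end ModulationSymbol

/-! ### Boundedness, orthogonality relations and adjoint of the modulation mapping. -/

section ModulationOperator

open scoped ENNReal

variable {N : ℕ}

theorem norm_modulationFactor (W : Phase N × Phase N) : ‖modulationFactor W‖ = 1 :=
  norm_exp_neg_I_mul _

theorem continuous_modulationFactor : Continuous (modulationFactor (N := N)) := by
  unfold modulationFactor; fun_prop

/-- The partial Fourier transform of the symbol of the modulation mapping. -/
def modulationTransform (B : MagneticField N) (h f : L2Phase N) : Phase N × PhaseDual N → ℂ :=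
  sliceFourier (modulationSymbol B (weylTransform N (star h)) (weylTransform N f))

theorem memLp_modulationTransform (B : MagneticField N) (h f : L2Phase N) :
    MemLp (modulationTransform B h f) 2 (volume.prod volume) :=
  memLp_sliceFourier (memLp_modulationSymbol B (Lp.memLp _) (Lp.memLp _))
    (Eventually.of_forall (integrable_modulationSymbol B (Lp.memLp _) (Lp.memLp _)))

theorem memLp_modulation (B : MagneticField N) (h f : L2Phase N) :
    MemLp (modulation B h f) 2 volume := by
  have h1 := ((memLp_modulationTransform B h f).smul_measure
    (ENNReal.ofReal_ne_top (r := (2 * Real.pi) ^ (2 * N)))).comp_measurePreserving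
    measurePreserving_modulationCoord
  have e : modulation B h f = fun W => modulationFactor W *
      (modulationTransform B h f ∘ modulationCoord) W :=
    funext (modulation_eq_sliceFourier B h f)
  rw [e]
  refine h1.of_le (continuous_modulationFactor.aestronglyMeasurable.mul h1.1)
    (Eventually.of_forall fun W => ?_)
  rw [norm_mul, norm_modulationFactor, one_mul]

theorem inner_star_star (h k : L2Phase N) :
    inner ℂ (star h) (star k) = pairing h fun Z => conj (k Z) := by
  rw [L2.inner_def, pairing]
  refine integral_congr_ae ?_
  filter_upwards [coeFn_star_phase h, coeFn_star_phase k] with p h1 h2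
  rw [h1, h2, RCLike.inner_apply', Complex.conj_conj]

/-- The polarized inversion formula. The unimodular factors cancel, the change of variables gives
(2π)^{2N}, Plancherel removes the transform, and unitarity of `weylTransform` returns the two scalar
products to symbols. -/
theorem integral_conj_modulation_mul (B : MagneticField N) (h k f g : L2Phase N) :
    ∫ W, conj (modulation B k g W) * modulation B h f W =
      (((2 * Real.pi) ^ (2 * N) : ℝ) : ℂ) * pairing h (fun Z => conj (k Z)) * inner ℂ g f := by
  have hint := (memLp_conj (memLp_modulationTransform B k g)).integrable_mul
    (memLp_modulationTransform B h f)
  have e1 : ∀ W, conj (modulation B k g W) * modulation B h f W =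
      conj (modulationTransform B k g (modulationCoord W)) *
        modulationTransform B h f (modulationCoord W) := by
    intro W
    have : conj (modulationFactor W) * modulationFactor W = 1 := by
      rw [Complex.conj_mul', norm_modulationFactor]
      simp
    rw [modulation_eq_sliceFourier, modulation_eq_sliceFourier, map_mul, modulationTransform,
      modulationTransform]
    linear_combination (conj (sliceFourier (modulationSymbol B (weylTransform N (star k))
      (weylTransform N g)) (modulationCoord W)) * sliceFourier (modulationSymbol B
      (weylTransform N (star h)) (weylTransform N f)) (modulationCoord W)) * this
  simp only [e1]
  have h1 := integral_comp_of_measurePreserving measurePreserving_modulationCoord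
    (hint.smul_measure (ENNReal.ofReal_ne_top (r := (2 * Real.pi) ^ (2 * N)))).aestronglyMeasurable
  refine h1.trans ?_
  rw [integral_smul_measure, ENNReal.toReal_ofReal (by positivity), Complex.real_smul, mul_assoc]
  congr 1
  refine (inner_sliceFourier (memLp_modulationSymbol B (Lp.memLp _) (Lp.memLp _))
    (Eventually.of_forall (integrable_modulationSymbol B (Lp.memLp _) (Lp.memLp _)))
    (memLp_modulationSymbol B (Lp.memLp _) (Lp.memLp _))
    (Eventually.of_forall (integrable_modulationSymbol B (Lp.memLp _) (Lp.memLp _)))).trans ?_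
  rw [integral_conj_modulationSymbol_mul B (Lp.memLp _) (Lp.memLp _) (Lp.memLp _) (Lp.memLp _),
    ← inner_star_star, ← (weylTransform N).inner_map_map (star h), ← (weylTransform N).inner_map_map g,
    L2.inner_def, L2.inner_def]
  simp only [RCLike.inner_apply']

/-- The modulation mapping as a linear map. -/
def modulationLinear (B : MagneticField N) (h : L2Phase N) : L2Phase N →ₗ[ℂ] L2Double N where
  toFun f := (memLp_modulation B h f).toLp _
  map_add' f g := by
    rw [← MemLp.toLp_add]
    refine MemLp.toLp_congr _ _ (Eventually.of_forall fun W => ?_)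
    simp only [Pi.add_apply, modulation_eq_inner, leftProduct, rightProduct, map_add,
      inner_add_right]
  map_smul' c f := by
    rw [RingHom.id_apply, ← MemLp.toLp_const_smul]
    refine MemLp.toLp_congr _ _ (Eventually.of_forall fun W => ?_)
    simp only [Pi.smul_apply, modulation_eq_inner, leftProduct, rightProduct, map_smul,
      inner_smul_right, smul_eq_mul]

theorem coeFn_modulationLinear (B : MagneticField N) (h f : L2Phase N) :
    modulationLinear B h f =ᵐ[volume] modulation B h f :=
  (memLp_modulation B h f).coeFn_toLp

theorem inner_modulationLinear (B : MagneticField N) (h k f g : L2Phase N) :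
    inner ℂ (modulationLinear B k g) (modulationLinear B h f) =
      (((2 * Real.pi) ^ (2 * N) : ℝ) : ℂ) * pairing h (fun Z => conj (k Z)) * inner ℂ g f := by
  rw [← integral_conj_modulation_mul, L2.inner_def]
  refine integral_congr_ae ?_
  filter_upwards [coeFn_modulationLinear B k g, coeFn_modulationLinear B h f] with W h1 h2
  rw [h1, h2, RCLike.inner_apply']

theorem norm_modulationLinear_le (B : MagneticField N) (h f : L2Phase N) :
    ‖modulationLinear B h f‖ ≤
      √‖(((2 * Real.pi) ^ (2 * N) : ℝ) : ℂ) * pairing h (fun Z => conj (h Z))‖ * ‖f‖ := by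
  refine (sq_le_sq₀ (norm_nonneg _) (by positivity)).1 ?_
  rw [mul_pow, Real.sq_sqrt (norm_nonneg _)]
  have h1 := congrArg norm (inner_modulationLinear B h h f f)
  rw [inner_self_eq_norm_sq_to_K, inner_self_eq_norm_sq_to_K] at h1
  rw [norm_mul] at h1
  simpa using h1.le

/-- The modulation mapping as a bounded operator. -/
def modulationOperator (B : MagneticField N) (h : L2Phase N) : L2Phase N →L[ℂ] L2Double N :=
  (modulationLinear B h).mkContinuous _ (norm_modulationLinear_le B h)

theorem modulationOperator_apply (B : MagneticField N) (h f : L2Phase N) :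
    modulationOperator B h f = modulationLinear B h f := rfl

/-- Both exponentials are moved to the other side of the scalar product, which changes their signs;
commuting them restores the bracketing used in `sandwich`. -/
theorem conj_modulation (B : MagneticField N) (h g : L2Phase N) (W : Phase N × Phase N) :
    conj (modulation B h g W) =
      inner ℂ g (sandwich B W.1 (fun Z => conj (h Z)) (W.2 - W.1)) := by
  rw [modulation_eq_inner, inner_conj_symm, inner_rightProduct, inner_leftProduct, neg_neg, neg_sub,
    sandwich_eq B W.1 (W.2 - W.1) (coeFn_star_phase h), rightProduct_leftProduct]

end ModulationOperator

end MagneticWeyl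

end

open MagneticWeyl

theorem corollary2p4 (N : ℕ) (B : MagneticField N) :
    -- the products with the exponentials exist in L², and the triple product needs no brackets
    (∀ (X : Phase N) (f : L2Phase N),
      IsMagneticProduct B (expSymbol X) f (magneticProduct B (expSymbol X) f) ∧
      IsMagneticProduct B f (expSymbol X) (magneticProduct B f (expSymbol X))) ∧
    (∀ (X Y : Phase N) (f : L2Phase N),
      sandwich B X f Y =
        magneticProduct B (expSymbol X) (magneticProduct B f (expSymbol Y))) ∧
    -- the modulation mappings are bounded linear operators from L²(Ξ) to L²(Ξ × Ξ)
    ∃ M : L2Phase N → (L2Phase N →L[ℂ] L2Double N),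
      (∀ h f : L2Phase N, ⇑(M h f) =ᵐ[volume] modulation B h f) ∧
      -- the inversion formula
      (∀ h k : L2Phase N,
        (ContinuousLinearMap.adjoint (M k)) ∘L (M h) =
          ((((2 * Real.pi) ^ (2 * N) : ℝ) : ℂ) * pairing h (fun Z => conj (k Z))) •
            ContinuousLinearMap.id ℂ (L2Phase N)) ∧
      -- the adjoint, as a weak integral of G(X,Y) (e_X # conj h # e_{Y-X})
      (∀ (h : L2Phase N) (G : L2Double N) (g : L2Phase N),
        Integrable (fun W : Phase N × Phase N =>
          G W * inner ℂ g (sandwich B W.1 (fun Z => conj (h Z)) (W.2 - W.1))) ∧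
        inner ℂ g (ContinuousLinearMap.adjoint (M h) G) =
          ∫ W : Phase N × Phase N,
            G W * inner ℂ g (sandwich B W.1 (fun Z => conj (h Z)) (W.2 - W.1))) := by
  refine ⟨fun X f => ⟨?_, ?_⟩, fun X Y f => ?_, modulationOperator B, ?_, fun h k => ?_,
    fun h G g => ?_⟩
  · rw [magneticProduct_expSymbol_left B X (EventuallyEq.refl _ f)]
    exact isMagneticProduct_leftProduct B X f
  · rw [magneticProduct_expSymbol_right]
    exact isMagneticProduct_rightProduct B f X
  · rw [sandwich_eq B X Y (EventuallyEq.refl _ f), magneticProduct_expSymbol_right,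
      magneticProduct_expSymbol_left B X (EventuallyEq.refl _ _), rightProduct_leftProduct]
  · exact coeFn_modulationLinear B
  · refine ContinuousLinearMap.ext fun f => ext_inner_left ℂ fun g => ?_
    rw [ContinuousLinearMap.comp_apply, ContinuousLinearMap.adjoint_inner_right,
      modulationOperator_apply, modulationOperator_apply, inner_modulationLinear,
      smul_apply, ContinuousLinearMap.id_apply, inner_smul_right]
  -- The weak integrand is the pointwise scalar product of M_h(g) with G, so its integrability is
  -- that of a product of two L² functions.
  · have e : (fun W => inner ℂ (modulationOperator B h g W) (G W)) =ᵐ[volume] fun W =>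
        G W * inner ℂ g (sandwich B W.1 (fun Z => conj (h Z)) (W.2 - W.1)) := by
      filter_upwards [coeFn_modulationLinear B h g] with W hW
      rw [modulationOperator_apply, hW, RCLike.inner_apply, conj_modulation]
    refine ⟨(L2.integrable_inner (modulationOperator B h g) G).congr e, ?_⟩
    rw [ContinuousLinearMap.adjoint_inner_right, L2.inner_def]
    exact integral_congr_ae e
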